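/- **Algebra.** Let $R$ be a commutative $\mathbb R$-algebra (below, an algebra of smooth functions), $W=R\theta_0\oplus R\theta_1\oplus R\theta_2\oplus R\theta_3$ with the inner product $g$ for which the basis is orthonormal of signature $-+++$; only its conformal class matters. All tensor and exterior products are over $R$. * $\mathrm{CDerEnd}(W)$ consists of the pairs $(X,\delta)$ of $X\in\mathrm{Der}_{\mathbb R}(R)$ and an $\mathbb R$-linear $\delta:W\to W$ such that $\delta(fw)=X(f)w+f\delta(w)$ and, for some $\ell\in R$, $X(g(v,w))+\ell\, g(v,w)=g(\delta v,w)+g(v,\delta w)$. There is a (basis-dependent) inclusion $\mathrm{Der}(R)\hookrightarrow\mathrm{CDerEnd}(W)$ whose image annihilates the $\theta_a$. Let $\sigma_0=\mathrm{id}_W$; let $\sigma_i$ ($i=1,2,3$) be the $R$-linear map exchanging $\theta_0$ and $\theta_i$ and annihilating the other basis elements; let $\sigma_{ij}=[\sigma_i,\sigma_j]$, so $\theta_j\mapsto\theta_i$, $\theta_i\mapsto-\theta_j$ for $i\neq j$. * $\mathcal L=\wedge W\otimes\mathrm{CDerEnd}(W)$ is the real graded Lie algebra (gLa) with bracket $[\omega\delta,\omega'\delta']=\omega\omega'[\delta,\delta']+\omega\delta(\omega')\delta'-\delta'(\omega)\omega'\delta$,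 where $\delta$ acts on $\wedge W$ as a derivation. $\mathcal I\subset\mathcal L$ is the $\wedge W$-submodule generated by the Weyl tensors: the elements $\sum_{a,b}\theta_a\theta_b\otimes A_{ab}$ with $A_{ab}=-A_{ba}\in\mathfrak{so}(W)$, $\sum_{a,b}\theta_a\theta_bA_{ab}(w)=0$ in $\wedge^3W$ for all $w\in W$, and $\sum_bA_{ab}(\theta_b)=0$ for all $a$. It is an ideal, and $\mathcal E=\mathcal L/\mathcal I$. * $\mathcal E$ acts on $\wedge W$ and on $\wedge W\otimes\Omega$, $\Omega=\wedge^4W$, by $\omega\delta:\omega'z\mapsto\omega\delta(\omega')z+\omega\omega'\delta(z)$ with $z=1$ respectively $z\in\Omega$. **Filtrations.** A filtration of a real gLa $\mathfrak g$, indexed by $\alpha\in\mathbb Z_{\ge0}^m$, is a family of graded subspaces $F_\alpha\mathfrak g$ with $F_\alpha\subset F_\beta$ for $\alpha\le\beta$, $F_\alpha=\mathfrak g$ for some $\alpha$, and $[F_\alpha,F_\beta]\subset F_{\alpha+\beta}$. Its Rees algebra is $\{\sum_\alpha s^\alpha x_\alpha\mid x_\alpha\in F_\alpha\mathfrak g\}\subset\mathfrak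 g[[s]]$, a gLa; its associated graded is the quotient of the Rees algebra by the ideal generated by the symbols $s$. For $i\in\{1,2,3\}$ let $W_0=R\theta_0\oplus R\theta_i$ and let $W_1$ be spanned by the other two basis elements. This gives $\mathbb Z_2$-gradings of $W$, $\wedge W$, $\mathrm{CDerEnd}(W)$ and $\mathcal E=\mathcal E_0\oplus\mathcal E_1$. Let $F_{\lhd p}(\wedge W)$ be spanned by the monomials in the basis whose degree in $W_1$ is at most $p$ and congruent to $p$ modulo 2; let $F_{\lhd p}(\wedge W\otimes\Omega)=F_{\lhd p}(\wedge W)\otimes\Omega$; let $F_{\lhd p}\mathcal E$ be the set of $x\in\mathcal E_{p\bmod 2}$ that map $F_{\lhd q}$ to $F_{\lhd q+p}$ for all $q\ge0$, both on $\wedge W$ and on $\wedge W\otimes\Omega$; let $F_p\mathcal E=F_{\lhd p}\mathcal E\oplus F_{\lhd p-1}\mathcal E$ with $F_{\lhd-1}\mathcal E=0$. Write $F_p$, $F'_p$, $F''_p$ for the results with $i=1,2,3$ (the 1-index BKL filtrations). The 2-index BKL filtration is $F_{p_2p_3}=F'_{p_2}\cap F''_{p_3}$, the 3-index BKL filtration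 is $F_{p_1p_2p_3}=F_{p_1}\cap F'_{p_2}\cap F''_{p_3}$. Let $P_{bounce}\subset\mathcal E[[s_2,s_3]]$, $A_{bounce}$ and $P_{free}\subset\mathcal E[[s_1,s_2,s_3]]$, $A_{free}$ be the Rees algebra and the associated graded of the 2-index respectively the 3-index filtration. **The 1+3 groupoid.** An object is given by a smooth manifold $S$ diffeomorphic to $\mathbb R^3$; the base manifold is $\mathbb R\times S$, with coordinate $t$ on the first factor, $D_0=\partial/\partial t$, $R=C^\infty=C^\infty(\mathbb R\times S,\mathbb R)$, and $W=\bigoplus_aC^\infty\theta_a$. A morphism from $S$ to $S'$ is given by $a,b,c\in C^\infty(S,\mathbb R)$ with $a,c>0$ and a diffeomorphism $\varphi:S\to S'$; it consists of $$\Phi:\mathbb R\times S\to\mathbb R\times S',\ (t,x)\mapsto(a(x)t+b(x),\varphi(x)),\qquad \Psi:W'\to W,\ \textstyle\sum_if_i\theta_i\mapsto\sum_ic\,(f_i\circ\Phi)\,\theta_i .$$ **Theorem.** 1. Objects and morphisms form a groupoid: identities and composition are those of the maps $\Phi$ and (in the opposite order) $\Psi$, and a morphism is determined by the pair $(\Phi,\Psi)$.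 2. The construction of $\mathcal E$ is a functor from this groupoid to real gLa. It is contravariant when morphisms are directed as $\Phi$: a morphism acts as the isomorphism $\mathcal E(S')\to\mathcal E(S)$ with $\omega\otimes\delta\mapsto\lambda(\omega)\otimes\Psi\delta\Psi^{-1}$, where $\lambda:\wedge W'\to\wedge W$ is the ring homomorphism with $f\mapsto f\circ\Phi$ that extends $\Psi$. Every $X\in\mathrm{Der}(C^\infty(S))$ extends uniquely to $X\in\mathrm{Der}(C^\infty)$ with $X(t)=0$. For a morphism with $\varphi=\mathbb 1$ the isomorphism is induced by $$f\mapsto f\circ\Phi,\quad\theta_0\mapsto c\theta_0,\quad\theta_i\mapsto c\theta_i,\quad\sigma_0\mapsto\sigma_0,\quad\sigma_i\mapsto\sigma_i,\quad\sigma_{ij}\mapsto\sigma_{ij},$$ $$D_0\mapsto\tfrac1aD_0,\qquad X\mapsto X-\tfrac1aX(at+b)D_0-\tfrac1cX(c)\sigma_0$$ for all $f\in C^\infty$ and all $X\in\mathrm{Der}(C^\infty(S,\mathbb R))$ extended by $X(t)=0$. For a morphism with $a=c=1$, $b=0$ it is induced by $f\mapsto f\circ\Phi$, $\theta_a\mapsto\theta_a$,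 $\sigma_0\mapsto\sigma_0$, $\sigma_i\mapsto\sigma_i$, $\sigma_{ij}\mapsto\sigma_{ij}$, $D_0\mapsto D_0$ and $X'\mapsto\varphi^*\circ X'\circ(\varphi^*)^{-1}$. 3. The three 1-index BKL filtrations, the 2-index BKL filtration and the 3-index BKL filtration of $\mathcal E$ are filtrations, and the functor in 2 respects them: it induces functors to real filtered gLa. For every morphism, the induced isomorphisms of $\mathcal E[[s_2,s_3]]$ and $\mathcal E[[s_1,s_2,s_3]]$ restrict to isomorphisms of $P_{bounce}$ and $P_{free}$ respectively, and these induce isomorphisms of the associated gradeds $A_{bounce}$ and $A_{free}$. -/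

import Mathlib

open scoped TensorProduct

universe u

set_option linter.unusedSectionVars false

noncomputable section

namespace BKL

section Algebra

/-- The free module `W` with basis `θ₀, θ₁, θ₂, θ₃`, over the algebra `R` of functions. -/
abbrev WMod (R : Type u) : Type u := Fin 4 → R

/-- The exterior algebra `∧W`. -/
abbrev Wedge (R : Type u) [CommRing R] : Type u := ExteriorAlgebra R (WMod R)

/-- A representative of the conformal inner product, of signature `-+++`; the basis is conformally
orthonormal. -/
def confForm {R : Type u} [CommRing R] (v w : WMod R) : R :=
  - (v 0 * w 0) + v 1 * w 1 + v 2 * w 2 + v 3 * w 3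

/-- The conformal derivations of `W`: pairs of a derivation `X` of `R` and a map `δ : W → W` with
`δ(fw) = X(f)w + fδ(w)`, which preserve the inner product up to a factor. -/
def cDerEndSub (R : Type u) [CommRing R] [Algebra ℝ R] :
    Submodule R (Derivation ℝ R R × (WMod R →ₗ[ℝ] WMod R)) where
  carrier := {δ | (∀ (f : R) (w : WMod R), δ.2 (f • w) = δ.1 f • w + f • δ.2 w) ∧
    ∃ l : R, ∀ v w : WMod R,
      δ.1 (confForm v w) + l * confForm v w = confForm (δ.2 v) w + confForm v (δ.2 w)}
  add_mem' := by
    rintro ⟨X, d⟩ ⟨Y, e⟩ ⟨h1, l, hl⟩ ⟨h2, m, hm⟩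
    refine ⟨fun f w => ?_, l + m, fun v w => ?_⟩
    · simp only [Prod.fst_add, Prod.snd_add, LinearMap.add_apply, Derivation.add_apply] at *
      rw [h1, h2]; module
    · have := hl v w; have := hm v w
      simp only [Prod.fst_add, Prod.snd_add, LinearMap.add_apply, Derivation.add_apply] at *
      simp only [confForm, Pi.add_apply] at *
      linear_combination hl v w + hm v w
  zero_mem' := ⟨fun f w => by simp, 0, fun v w => by simp [confForm]⟩
  smul_mem' := by
    rintro r ⟨X, d⟩ ⟨h1, l, hl⟩
    refine ⟨fun f w => ?_, r * l, fun v w => ?_⟩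
    · simp only [Prod.smul_fst, Prod.smul_snd, LinearMap.smul_apply, Derivation.smul_apply] at *
      rw [h1, smul_eq_mul]; module
    · simp only [Prod.smul_fst, Prod.smul_snd, LinearMap.smul_apply, Derivation.smul_apply] at *
      simp only [confForm, Pi.smul_apply, smul_eq_mul] at *
      linear_combination r * hl v w

/-- The module `CDerEnd(W)`. -/
def CDerEnd (R : Type u) [CommRing R] [Algebra ℝ R] : Type u := cDerEndSub R

instance (R : Type u) [CommRing R] [Algebra ℝ R] : AddCommGroup (CDerEnd R) :=
  inferInstanceAs (AddCommGroup (cDerEndSub R))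
instance (R : Type u) [CommRing R] [Algebra ℝ R] : Module R (CDerEnd R) :=
  inferInstanceAs (Module R (cDerEndSub R))

theorem ι_mem_one {R : Type u} [CommRing R] (w : WMod R) :
    ExteriorAlgebra.ι R w ∈ ⋀[R]^1 (WMod R) := by
  have : ⋀[R]^1 (WMod R) = LinearMap.range (ExteriorAlgebra.ι R (M := WMod R)) := pow_one _
  rw [this]; exact ⟨w, rfl⟩

theorem ι_mul_comm {R : Type u} [CommRing R] (w : WMod R) {k : ℕ} {x : Wedge R}
    (h : x ∈ ⋀[R]^k (WMod R)) :
    x * ExteriorAlgebra.ι R w = (-1 : Wedge R) ^ k * (ExteriorAlgebra.ι R w * x) := by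
  induction h using Submodule.pow_induction_on_left' with
  | algebraMap r => simp [Algebra.commutes]
  | add x y i hx hy ihx ihy => rw [add_mul, ihx, ihy]; noncomm_ring
  | mem_mul m hm i x hx ih =>
    obtain ⟨v, rfl⟩ := hm
    have e := ExteriorAlgebra.ι_add_mul_swap (R := R) v w
    rw [mul_assoc, ih, Nat.succ_eq_add_one, pow_succ]
    have c : Commute (ExteriorAlgebra.ι R v) ((-1 : Wedge R) ^ i) :=
      ((Commute.neg_one_right _).pow_right i)
    rw [← mul_assoc, c.eq, mul_assoc, ← mul_assoc _ _ x, eq_neg_of_add_eq_zero_left e]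
    noncomm_ring

/-- The exterior algebra is graded commutative. -/
theorem wedge_comm {R : Type u} [CommRing R] {i j : ℕ} {x y : Wedge R}
    (hx : x ∈ ⋀[R]^i (WMod R)) (hy : y ∈ ⋀[R]^j (WMod R)) :
    x * y = (-1 : Wedge R) ^ (i * j) * (y * x) := by
  induction hy using Submodule.pow_induction_on_left' with
  | algebraMap r => simp [Algebra.commutes]
  | add y z i hy hz ihy ihz => rw [mul_add, ihy, ihz]; noncomm_ring
  | mem_mul m hm j y hy ih =>
    obtain ⟨v, rfl⟩ := hm
    rw [← mul_assoc, ι_mul_comm v hx, mul_assoc, mul_assoc, ih, Nat.succ_eq_add_one, mul_add,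
      mul_one, pow_add]
    have c : Commute (ExteriorAlgebra.ι R v) ((-1 : Wedge R) ^ (i * j)) :=
      ((Commute.neg_one_right _).pow_right _)
    rw [← mul_assoc (ExteriorAlgebra.ι R v), c.eq]
    have c2 : Commute ((-1 : Wedge R) ^ i) ((-1 : Wedge R) ^ (i * j)) :=
      (Commute.refl _).pow_pow _ _
    simp only [← mul_assoc]; rw [c2.eq]

namespace CDerEnd
variable {R : Type u} [CommRing R] [Algebra ℝ R]

/-- The derivation of `R` that belongs to `δ`. -/
def anchor (δ : CDerEnd R) : Derivation ℝ R R := δ.1.1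
/-- The action of `δ` on `W`. -/
def op (δ : CDerEnd R) : WMod R →ₗ[ℝ] WMod R := δ.1.2

theorem op_smul (δ : CDerEnd R) (f : R) (w : WMod R) :
    δ.op (f • w) = δ.anchor f • w + f • δ.op w := δ.2.1 f w

theorem ext' {δ ε : CDerEnd R} (h1 : ∀ f, δ.anchor f = ε.anchor f)
    (h2 : ∀ w, δ.op w = ε.op w) : δ = ε :=
  Subtype.ext (Prod.ext (Derivation.ext h1) (LinearMap.ext h2))

@[simp] theorem anchor_add (δ ε : CDerEnd R) : (δ + ε).anchor = δ.anchor + ε.anchor := rfl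
@[simp] theorem op_add (δ ε : CDerEnd R) : (δ + ε).op = δ.op + ε.op := rfl
@[simp] theorem anchor_rsmul (r : R) (δ : CDerEnd R) : (r • δ).anchor = r • δ.anchor := rfl
@[simp] theorem op_rsmul (r : R) (δ : CDerEnd R) : (r • δ).op = r • δ.op := rfl

/-- The commutator. -/
def comm (δ ε : CDerEnd R) : CDerEnd R :=
  ⟨(⁅δ.anchor, ε.anchor⁆, δ.op ∘ₗ ε.op - ε.op ∘ₗ δ.op), by
    obtain ⟨⟨X, d⟩, h1, l, hl⟩ := δ
    obtain ⟨⟨Y, e⟩, h2, m, hm⟩ := ε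
    refine ⟨fun f w => ?_, X m - Y l, fun v w => ?_⟩
    · simp only [anchor, op, LinearMap.sub_apply, LinearMap.comp_apply,
        Derivation.commutator_apply] at *
      simp only [h1, h2, map_add]
      module
    · simp only [anchor, op, LinearMap.sub_apply, LinearMap.comp_apply,
        Derivation.commutator_apply] at *
      have e1 := congrArg X (hm v w)
      have e2 := congrArg Y (hl v w)
      simp only [map_add, Derivation.leibniz, smul_eq_mul] at e1 e2
      have a1 := hl (e v) w
      have a2 := hl v (e w)
      have a3 := hm (d v) w
      have a4 := hm v (d w)
      have b1 := hl v w
      have b2 := hm v w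
      have s1 : ∀ a b c : WMod R, confForm (a - b) c = confForm a c - confForm b c := by
        intros; simp only [confForm, Pi.sub_apply]; ring
      have s2 : ∀ a b c : WMod R, confForm a (b - c) = confForm a b - confForm a c := by
        intros; simp only [confForm, Pi.sub_apply]; ring
      rw [s1, s2]
      linear_combination e1 - e2 + a1 + a2 - a3 - a4 + l * b2 - m * b1⟩

theorem comm_anchor_apply (δ ε : CDerEnd R) (f : R) :
    (comm δ ε).anchor f = δ.anchor (ε.anchor f) - ε.anchor (δ.anchor f) :=
  Derivation.commutator_apply f
theorem comm_op_apply (δ ε : CDerEnd R) (w : WMod R) :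
    (comm δ ε).op w = δ.op (ε.op w) - ε.op (δ.op w) := rfl

/-- Dual numbers `a + ε b` over the exterior algebra. As an `R`-algebra, `R` acts through
`f ↦ f + ε δ(f)`, with `δ` acting on functions by its anchor. -/
def TwDual (_δ : CDerEnd R) : Type u := TrivSqZeroExt (Wedge R) (Wedge R)

instance (δ : CDerEnd R) : Ring (TwDual δ) :=
  inferInstanceAs (Ring (TrivSqZeroExt (Wedge R) (Wedge R)))

namespace TwDual
variable {δ : CDerEnd R}
def mk (a b : Wedge R) : TwDual δ := ((a, b) : Wedge R × Wedge R)
def fst (x : TwDual δ) : Wedge R := TrivSqZeroExt.fst x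
def snd (x : TwDual δ) : Wedge R := TrivSqZeroExt.snd x
theorem ext {x y : TwDual δ} (h1 : x.fst = y.fst) (h2 : x.snd = y.snd) : x = y :=
  TrivSqZeroExt.ext h1 h2
theorem fst_mk (a b : Wedge R) : (mk a b : TwDual δ).fst = a := rfl
theorem snd_mk (a b : Wedge R) : (mk a b : TwDual δ).snd = b := rfl
theorem fst_add (x y : TwDual δ) : (x + y).fst = x.fst + y.fst := rfl
theorem snd_add (x y : TwDual δ) : (x + y).snd = x.snd + y.snd := rfl
theorem fst_mul (x y : TwDual δ) : (x * y).fst = x.fst * y.fst := rfl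
theorem snd_mul (x y : TwDual δ) : (x * y).snd = x.fst * y.snd + x.snd * y.fst := rfl
theorem fst_zero : (0 : TwDual δ).fst = 0 := rfl
theorem snd_zero : (0 : TwDual δ).snd = 0 := rfl
theorem fst_one : (1 : TwDual δ).fst = 1 := rfl
theorem snd_one : (1 : TwDual δ).snd = 0 := rfl
end TwDual

open TwDual

/-- The map `f ↦ f + ε δ(f)`. -/
def twHom (δ : CDerEnd R) : R →+* TwDual δ where
  toFun f := TwDual.mk (algebraMap R _ f) (algebraMap R _ (δ.anchor f))
  map_one' := by apply TwDual.ext <;> simp [fst_mk, snd_mk, fst_one, snd_one]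
  map_zero' := by apply TwDual.ext <;> simp [fst_mk, snd_mk, fst_zero, snd_zero]
  map_add' f g := by apply TwDual.ext <;> simp [fst_mk, snd_mk, fst_add, snd_add]
  map_mul' f g := by
    apply TwDual.ext
    · simp [fst_mk, fst_mul]
    · simp only [snd_mk, snd_mul, fst_mk, Derivation.leibniz, smul_eq_mul, map_add, map_mul]
      rw [Algebra.commutes g]

instance (δ : CDerEnd R) : Algebra R (TwDual δ) :=
  RingHom.toAlgebra' (twHom δ) (by
    intro c x
    apply TwDual.ext
    · simp [twHom, fst_mk, fst_mul, Algebra.commutes]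
    · simp [twHom, fst_mk, snd_mk, snd_mul, Algebra.commutes, add_comm])

theorem algebraMap_twDual (δ : CDerEnd R) (f : R) : algebraMap R (TwDual δ) f =
  TwDual.mk (algebraMap R _ f) (algebraMap R _ (δ.anchor f)) := rfl

/-- The map `w ↦ w + ε δ(w)`. -/
def twLin (δ : CDerEnd R) : WMod R →ₗ[R] TwDual δ where
  toFun w := TwDual.mk (ExteriorAlgebra.ι R w) (ExteriorAlgebra.ι R (δ.op w))
  map_add' v w := by
    apply TwDual.ext <;> simp [fst_mk, snd_mk, fst_add, snd_add]
  map_smul' f w := by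
    rw [RingHom.id_apply, Algebra.smul_def (A := TwDual δ), algebraMap_twDual]
    apply TwDual.ext
    · rw [fst_mul, fst_mk, fst_mk, fst_mk, map_smul, Algebra.smul_def]
    · rw [snd_mul, snd_mk, snd_mk, snd_mk, fst_mk, fst_mk, op_smul, map_add, map_smul, map_smul,
        Algebra.smul_def, Algebra.smul_def, add_comm]

/-- The algebra homomorphism `ω ↦ ω + ε δ(ω)`. -/
def twExt (δ : CDerEnd R) : Wedge R →ₐ[R] TwDual δ :=
  ExteriorAlgebra.lift R ⟨twLin δ, fun w => by
    apply TwDual.ext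
    · simp only [twLin, LinearMap.coe_mk, AddHom.coe_mk, fst_mul, fst_mk, fst_zero,
        ExteriorAlgebra.ι_sq_zero]
    · simp only [twLin, LinearMap.coe_mk, AddHom.coe_mk, snd_mul, fst_mk, snd_mk, snd_zero,
        ExteriorAlgebra.ι_add_mul_swap]⟩

theorem twExt_ι (δ : CDerEnd R) (w : WMod R) : twExt δ (ExteriorAlgebra.ι R w) =
    TwDual.mk (ExteriorAlgebra.ι R w) (ExteriorAlgebra.ι R (δ.op w)) := by
  rw [twExt, ExteriorAlgebra.lift_ι_apply]; rfl

theorem fst_twExt (δ : CDerEnd R) (ω : Wedge R) : (twExt δ ω).fst = ω := by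
  induction ω using ExteriorAlgebra.induction with
  | algebraMap r => rw [AlgHom.commutes, algebraMap_twDual, fst_mk]
  | ι x => rw [twExt_ι, fst_mk]
  | mul a b ha hb => rw [map_mul, fst_mul, ha, hb]
  | add a b ha hb => rw [map_add, fst_add, ha, hb]

/-- The extension of `δ` to a derivation of the exterior algebra. -/
def wact (δ : CDerEnd R) (ω : Wedge R) : Wedge R := (twExt δ ω).snd

theorem wact_algebraMap (δ : CDerEnd R) (f : R) :
    wact δ (algebraMap R _ f) = algebraMap R _ (δ.anchor f) := by
  rw [wact, AlgHom.commutes, algebraMap_twDual, snd_mk]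
theorem wact_ι (δ : CDerEnd R) (w : WMod R) :
    wact δ (ExteriorAlgebra.ι R w) = ExteriorAlgebra.ι R (δ.op w) := by
  rw [wact, twExt_ι, snd_mk]
theorem wact_add (δ : CDerEnd R) (a b : Wedge R) : wact δ (a + b) = wact δ a + wact δ b := by
  rw [wact, map_add]; rfl
theorem wact_mul (δ : CDerEnd R) (a b : Wedge R) :
    wact δ (a * b) = wact δ a * b + a * wact δ b := by
  rw [wact, map_mul, snd_mul, fst_twExt, fst_twExt, add_comm]; rfl

theorem wact_zero (δ : CDerEnd R) : wact δ 0 = 0 := by simpa using wact_algebraMap δ 0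
theorem wact_sub (δ : CDerEnd R) (a b : Wedge R) : wact δ (a - b) = wact δ a - wact δ b := by
  have := wact_add δ (a - b) b; rw [sub_add_cancel] at this; rw [this]; abel
theorem wact_one (δ : CDerEnd R) : wact δ 1 = 0 := by
  have := wact_algebraMap δ 1; simpa using this
theorem wact_smul (δ : CDerEnd R) (f : R) (a : Wedge R) :
    wact δ (f • a) = δ.anchor f • a + f • wact δ a := by
  rw [Algebra.smul_def, wact_mul, wact_algebraMap, Algebra.smul_def, Algebra.smul_def]
theorem wact_real (δ : CDerEnd R) (c : ℝ) (a : Wedge R) : wact δ (c • a) = c • wact δ a := by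
  have : c • a = (algebraMap ℝ R c) • a := by rw [algebraMap_smul]
  rw [this, wact_smul]; simp

theorem add_wact (δ ε : CDerEnd R) (ω : Wedge R) : wact (δ + ε) ω = wact δ ω + wact ε ω := by
  induction ω using ExteriorAlgebra.induction with
  | algebraMap r => simp [wact_algebraMap]
  | ι x => simp [wact_ι]
  | mul a b ha hb => simp only [wact_mul, ha, hb]; noncomm_ring
  | add a b ha hb => simp only [wact_add, ha, hb]; abel

theorem smul_wact (f : R) (δ : CDerEnd R) (ω : Wedge R) : wact (f • δ) ω = f • wact δ ω := by
  induction ω using ExteriorAlgebra.induction with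
  | algebraMap r => simp [wact_algebraMap, Algebra.smul_def]
  | ι x => simp [wact_ι]
  | mul a b ha hb => simp only [wact_mul, ha, hb, smul_add, smul_mul_assoc, mul_smul_comm]
  | add a b ha hb => simp only [wact_add, ha, hb, smul_add]

theorem comm_wact (δ ε : CDerEnd R) (ω : Wedge R) :
    wact (comm δ ε) ω = wact δ (wact ε ω) - wact ε (wact δ ω) := by
  induction ω using ExteriorAlgebra.induction with
  | algebraMap r => simp [wact_algebraMap, comm_anchor_apply]
  | ι x => simp [wact_ι, comm_op_apply]
  | mul a b ha hb => simp only [wact_mul, wact_add, ha, hb]; noncomm_ring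
  | add a b ha hb => simp only [wact_add, ha, hb]; abel

theorem wact_mem (δ : CDerEnd R) {k : ℕ} {ω : Wedge R} (h : ω ∈ ⋀[R]^k (WMod R)) :
    wact δ ω ∈ ⋀[R]^k (WMod R) := by
  induction h using Submodule.pow_induction_on_left' with
  | algebraMap r => rw [wact_algebraMap]; exact SetLike.algebraMap_mem_graded _ _
  | add x y i hx hy ihx ihy => rw [wact_add]; exact add_mem ihx ihy
  | mem_mul m hm i x hx ih =>
    obtain ⟨w, rfl⟩ := hm
    rw [wact_mul, wact_ι, Nat.succ_eq_one_add]
    exact add_mem (SetLike.mul_mem_graded (ι_mem_one _) hx)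
      (SetLike.mul_mem_graded (ι_mem_one _) ih)

theorem comm_skew (δ ε : CDerEnd R) : comm δ ε = - comm ε δ := by
  refine ext' (fun f => ?_) (fun w => ?_)
  · change _ = - (comm ε δ).anchor f
    rw [comm_anchor_apply, comm_anchor_apply, neg_sub]
  · change _ = - (comm ε δ).op w
    rw [comm_op_apply, comm_op_apply, neg_sub]

theorem comm_add (δ ε ζ : CDerEnd R) : comm δ (ε + ζ) = comm δ ε + comm δ ζ := by
  refine ext' (fun f => ?_) (fun w => ?_)
  · simp only [comm_anchor_apply, anchor_add, Derivation.add_apply, map_add]; abel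
  · simp only [comm_op_apply, op_add, LinearMap.add_apply, map_add]; abel

theorem comm_add_left (δ ε ζ : CDerEnd R) : comm (δ + ε) ζ = comm δ ζ + comm ε ζ := by
  rw [comm_skew, comm_add, comm_skew ζ δ, comm_skew ζ ε, neg_add, neg_neg, neg_neg]

theorem comm_smul (δ ε : CDerEnd R) (f : R) :
    comm δ (f • ε) = δ.anchor f • ε + f • comm δ ε := by
  refine ext' (fun g => ?_) (fun w => ?_)
  · simp only [comm_anchor_apply, anchor_add, anchor_rsmul, Derivation.add_apply,
      Derivation.smul_apply, Derivation.leibniz, smul_eq_mul]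
    ring
  · simp only [comm_op_apply, op_add, op_rsmul, LinearMap.add_apply, LinearMap.smul_apply,
      op_smul, smul_sub]
    abel

theorem comm_smul_left (δ ε : CDerEnd R) (f : R) :
    comm (f • δ) ε = f • comm δ ε - ε.anchor f • δ := by
  rw [comm_skew, comm_smul, comm_skew ε δ]; module

theorem jacobi (δ ε ζ : CDerEnd R) :
    comm δ (comm ε ζ) = comm (comm δ ε) ζ + comm ε (comm δ ζ) := by
  refine ext' (fun f => ?_) (fun w => ?_)
  · simp only [comm_anchor_apply, anchor_add, Derivation.add_apply, map_sub]; abel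
  · simp only [comm_op_apply, op_add, LinearMap.add_apply, map_sub]; abel

end CDerEnd

/-- The graded Lie algebra `∧W ⊗ CDerEnd(W)`. -/
abbrev LAlg (R : Type u) [CommRing R] [Algebra ℝ R] : Type u := Wedge R ⊗[R] CDerEnd R

section Bracket
variable {R : Type u} [CommRing R] [Algebra ℝ R]
open CDerEnd

/-- `[ωδ, ω'δ'] = ωω'[δ,δ'] + ωδ(ω')δ' - δ'(ω)ω'δ`. -/
def brTerm (ω : Wedge R) (δ : CDerEnd R) (ω' : Wedge R) (δ' : CDerEnd R) : LAlg R :=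
  (ω * ω') ⊗ₜ comm δ δ' + (ω * wact δ ω') ⊗ₜ δ' - (wact δ' ω * ω') ⊗ₜ δ

/-- The bracket with `ω ⊗ δ`. -/
def brAux (ω : Wedge R) (δ : CDerEnd R) : LAlg R →+ LAlg R :=
  TensorProduct.liftAddHom
    (AddMonoidHom.mk' (fun ω' => AddMonoidHom.mk' (fun δ' => brTerm ω δ ω' δ') (by
        intro a b
        simp only [brTerm, comm_add, add_wact, TensorProduct.tmul_add, add_mul,
          TensorProduct.add_tmul]
        abel)) (by
      intro a b
      ext δ'
      simp only [brTerm, wact_add, mul_add, TensorProduct.add_tmul, AddMonoidHom.mk'_apply,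
        AddMonoidHom.add_apply]
      abel)) (by
    intro r m n
    simp only [brTerm, AddMonoidHom.mk'_apply, comm_smul, smul_wact, wact_smul,
      TensorProduct.tmul_add, mul_add, TensorProduct.add_tmul, ← TensorProduct.smul_tmul,
      mul_smul_comm, smul_mul_assoc]
    abel)

theorem brAux_tmul (ω : Wedge R) (δ : CDerEnd R) (ω' : Wedge R) (δ' : CDerEnd R) :
    brAux ω δ (ω' ⊗ₜ δ') = brTerm ω δ ω' δ' := rfl

theorem hom_ext_tmul {M : Type*} [AddCommGroup M] {f g : LAlg R →+ M}
    (h : ∀ ω δ, f (ω ⊗ₜ δ) = g (ω ⊗ₜ δ)) : f = g := by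
  ext x
  induction x using TensorProduct.induction_on with
  | zero => simp
  | tmul ω δ => exact h ω δ
  | add x y hx hy => rw [map_add, map_add, hx, hy]

/-- Auxiliary additive version of the bracket. -/
def brAux₂ (ω : Wedge R) : CDerEnd R →+ (LAlg R →+ LAlg R) where
  toFun δ := brAux ω δ
  map_zero' := by
    refine hom_ext_tmul fun ω' δ' => ?_
    have h : comm (0 : CDerEnd R) δ' = 0 := by
      have := comm_add_left (0 : CDerEnd R) 0 δ'; simpa using this
    have h' : wact (0 : CDerEnd R) ω' = 0 := by
      have := add_wact (0 : CDerEnd R) 0 ω'; simpa using this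
    simp [brAux_tmul, brTerm, h, h']
  map_add' a b := by
    refine hom_ext_tmul fun ω' δ' => ?_
    simp only [AddMonoidHom.add_apply, brAux_tmul, brTerm, comm_add_left, add_wact,
      TensorProduct.tmul_add, mul_add, TensorProduct.add_tmul]
    abel

/-- Auxiliary additive version of the bracket. -/
def brAux₃ : Wedge R →+ CDerEnd R →+ (LAlg R →+ LAlg R) where
  toFun ω := brAux₂ ω
  map_zero' := by
    ext1 δ
    refine hom_ext_tmul fun ω' δ' => ?_
    change brTerm 0 δ ω' δ' = 0
    simp [brTerm, wact_zero]
  map_add' a b := by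
    ext1 δ
    refine hom_ext_tmul fun ω' δ' => ?_
    change brTerm (a + b) δ ω' δ' = brTerm a δ ω' δ' + brTerm b δ ω' δ'
    simp only [brTerm, wact_add, add_mul, TensorProduct.add_tmul]
    abel

/-- The bracket as a biadditive map. -/
def brHom : LAlg R →+ LAlg R →+ LAlg R :=
  TensorProduct.liftAddHom brAux₃ (by
    intro r m n
    refine hom_ext_tmul fun ω' δ' => ?_
    change brTerm (r • m) n ω' δ' = brTerm m (r • n) ω' δ'
    simp only [brTerm, comm_smul_left, smul_wact, wact_smul,
      TensorProduct.tmul_sub, add_mul, TensorProduct.add_tmul, ← TensorProduct.smul_tmul,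
      mul_smul_comm, smul_mul_assoc]
    abel)

theorem brHom_tmul (ω : Wedge R) (δ : CDerEnd R) (ω' : Wedge R) (δ' : CDerEnd R) :
    brHom (ω ⊗ₜ δ) (ω' ⊗ₜ δ') = brTerm ω δ ω' δ' := rfl

theorem real_smul_tmul (c : ℝ) (ω : Wedge R) (δ : CDerEnd R) :
    c • (ω ⊗ₜ[R] δ : LAlg R) = (c • ω) ⊗ₜ δ := rfl

theorem brHom_smul (c : ℝ) (x y : LAlg R) : brHom x (c • y) = c • brHom x y := by
  induction x using TensorProduct.induction_on with
  | zero => simp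
  | add x y hx hy => rw [map_add, AddMonoidHom.add_apply, hx, hy, AddMonoidHom.add_apply, smul_add]
  | tmul ω δ =>
    induction y using TensorProduct.induction_on with
    | zero => simp
    | add x y hx hy => rw [smul_add, map_add, hx, hy, map_add, smul_add]
    | tmul ω' δ' =>
      rw [real_smul_tmul, brHom_tmul, brHom_tmul, brTerm, brTerm]
      simp only [wact_real, mul_smul_comm, smul_sub, smul_add, real_smul_tmul]

theorem brHom_smul_left (c : ℝ) (x y : LAlg R) : brHom (c • x) y = c • brHom x y := by
  induction x using TensorProduct.induction_on with
  | zero => simp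
  | add x y hx hy => rw [smul_add, map_add, AddMonoidHom.add_apply, hx, hy, map_add,
      AddMonoidHom.add_apply, smul_add]
  | tmul ω δ =>
    induction y using TensorProduct.induction_on with
    | zero => simp
    | add x y hx hy => rw [map_add, hx, hy, map_add, smul_add]
    | tmul ω' δ' =>
      rw [real_smul_tmul, brHom_tmul, brHom_tmul, brTerm, brTerm]
      simp only [wact_real, smul_mul_assoc, smul_sub, smul_add, real_smul_tmul]

/-- The bracket of `∧W ⊗ CDerEnd(W)`. -/
def brL : LAlg R →ₗ[ℝ] LAlg R →ₗ[ℝ] LAlg R :=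
  LinearMap.mk₂ ℝ (fun x y => brHom x y) (fun x y z => by simp)
    (fun c x y => brHom_smul_left c x y) (fun x y z => by simp) (fun c x y => brHom_smul c x y)

theorem brL_tmul (ω : Wedge R) (δ : CDerEnd R) (ω' : Wedge R) (δ' : CDerEnd R) :
    brL (ω ⊗ₜ δ) (ω' ⊗ₜ δ') =
      (ω * ω') ⊗ₜ comm δ δ' + (ω * wact δ ω') ⊗ₜ δ' - (wact δ' ω * ω') ⊗ₜ δ := rfl

/-- The homogeneous part `∧ᵏW ⊗ CDerEnd(W)`, zero when `k < 0`. -/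
def degL (R : Type u) [CommRing R] [Algebra ℝ R] (k : ℤ) : Submodule ℝ (LAlg R) :=
  Submodule.span ℝ {x | ∃ n : ℕ, (n : ℤ) = k ∧ ∃ ω ∈ ⋀[R]^n (WMod R), ∃ δ : CDerEnd R, x = ω ⊗ₜ δ}

theorem tmul_mem_degL {n : ℕ} {k : ℤ} (hk : (n : ℤ) = k) {ω : Wedge R}
    (h : ω ∈ ⋀[R]^n (WMod R)) (δ : CDerEnd R) :
    (ω ⊗ₜ δ : LAlg R) ∈ degL R k := Submodule.subset_span ⟨n, hk, ω, h, δ, rfl⟩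

theorem brL_mem {i j k : ℤ} (h : i + j = k) {x y : LAlg R} (hx : x ∈ degL R i)
    (hy : y ∈ degL R j) : brL x y ∈ degL R k := by
  induction hx using Submodule.span_induction with
  | zero => simp
  | add a b _ _ ha hb => rw [map_add, LinearMap.add_apply]; exact add_mem ha hb
  | smul c a _ ha => rw [map_smul, LinearMap.smul_apply]; exact Submodule.smul_mem _ _ ha
  | mem x hx =>
    obtain ⟨n, hn, ω, hω, δ, rfl⟩ := hx
    induction hy using Submodule.span_induction with
    | zero => simp
    | add a b _ _ ha hb => rw [map_add]; exact add_mem ha hb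
    | smul c a _ ha => rw [map_smul]; exact Submodule.smul_mem _ _ ha
    | mem y hy =>
      obtain ⟨m, hm, ω', hω', δ', rfl⟩ := hy
      have hk : ((n + m : ℕ) : ℤ) = k := by push_cast; omega
      rw [brL_tmul]
      exact sub_mem (add_mem (tmul_mem_degL hk (SetLike.mul_mem_graded hω hω') _)
        (tmul_mem_degL hk (SetLike.mul_mem_graded hω (wact_mem _ hω')) _))
        (tmul_mem_degL hk (SetLike.mul_mem_graded (wact_mem _ hω) hω') _)

theorem pow_neg_one_mul (n : ℕ) (x : Wedge R) : (-1 : Wedge R) ^ n * x = (-1 : ℝ) ^ n • x := by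
  rcases neg_one_pow_eq_or ℝ n with h | h <;> rcases Nat.even_or_odd n with h' | h' <;>
    simp [h'.neg_one_pow]

theorem wedge_comm' {i j : ℕ} {x y : Wedge R}
    (hx : x ∈ ⋀[R]^i (WMod R)) (hy : y ∈ ⋀[R]^j (WMod R)) :
    x * y = (-1 : ℝ) ^ (i * j) • (y * x) := by rw [wedge_comm hx hy, pow_neg_one_mul]

theorem brL_skew {i j : ℤ} {x y : LAlg R} (hx : x ∈ degL R i) (hy : y ∈ degL R j) :
    brL x y = -((-1 : ℝ) ^ (i * j) • brL y x) := by
  induction hx using Submodule.span_induction with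
  | zero => simp
  | add a b _ _ ha hb => simp only [map_add, LinearMap.add_apply, ha, hb, smul_add]; abel
  | smul c a _ ha =>
    simp only [map_smul, LinearMap.smul_apply, ha]; module
  | mem x hx =>
    obtain ⟨i, rfl, ω, hω, δ, rfl⟩ := hx
    induction hy using Submodule.span_induction with
    | zero => simp
    | add a b _ _ ha hb => simp only [map_add, LinearMap.add_apply, ha, hb, smul_add]; abel
    | smul c a _ ha => simp only [map_smul, LinearMap.smul_apply, ha]; module
    | mem y hy =>
      obtain ⟨j, rfl, ω', hω', δ', rfl⟩ := hy
      rw [← Nat.cast_mul, zpow_natCast]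
      rw [brL_tmul, brL_tmul, comm_skew δ' δ, wedge_comm' hω hω',
        wedge_comm' hω (wact_mem δ hω'), wedge_comm' (wact_mem δ' hω) hω']
      simp only [TensorProduct.tmul_neg, ← real_smul_tmul]
      module

theorem brL_jacobi {i j k : ℤ} {x y z : LAlg R} (hx : x ∈ degL R i) (hy : y ∈ degL R j)
    (hz : z ∈ degL R k) :
    brL x (brL y z) = brL (brL x y) z + (-1 : ℝ) ^ (i * j) • brL y (brL x z) := by
  induction hx using Submodule.span_induction with
  | zero => simp
  | add a b _ _ ha hb => simp only [map_add, LinearMap.add_apply, ha, hb, smul_add]; abel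
  | smul c a _ ha => simp only [map_smul, LinearMap.smul_apply, ha, smul_add]; module
  | mem x hx =>
  induction hy using Submodule.span_induction with
  | zero => simp
  | add a b _ _ ha hb => simp only [map_add, LinearMap.add_apply, ha, hb, smul_add]; abel
  | smul c a _ ha => simp only [map_smul, LinearMap.smul_apply, ha, smul_add]; module
  | mem y hy =>
  induction hz using Submodule.span_induction with
  | zero => simp
  | add a b _ _ ha hb => simp only [map_add, ha, hb, smul_add]; abel
  | smul c a _ ha => simp only [map_smul, ha, smul_add]; module
  | mem z hz =>
  obtain ⟨i, rfl, α, hα, A, rfl⟩ := hx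
  obtain ⟨j, rfl, β, hβ, B, rfl⟩ := hy
  obtain ⟨k, rfl, γ, hγ, C, rfl⟩ := hz
  rw [← Nat.cast_mul, zpow_natCast]
  have hs : ∀ u ∈ ⋀[R]^j (WMod R), ∀ v ∈ ⋀[R]^i (WMod R), u * v = (-1 : ℝ) ^ (i * j) • (v * u) :=
    fun u hu v hv => by rw [wedge_comm' hu hv, mul_comm j i]
  have he : (-1 : ℝ) ^ (i * j) * (-1 : ℝ) ^ (i * j) = 1 := by
    rw [← mul_pow]; simp
  generalize (-1 : ℝ) ^ (i * j) = e at hs he ⊢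
  have w := fun (D : CDerEnd R) {n : ℕ} {u : Wedge R} (h : u ∈ ⋀[R]^n (WMod R)) => wact_mem D h
  simp only [brL_tmul, map_add, map_sub, LinearMap.add_apply, LinearMap.sub_apply, wact_mul,
    comm_wact, mul_add, add_mul, sub_mul, mul_sub, TensorProduct.add_tmul, TensorProduct.sub_tmul,
    jacobi A B C, TensorProduct.tmul_add, comm_skew B A, TensorProduct.tmul_neg, ← mul_assoc,
    hs _ hβ _ hα, hs _ hβ _ (w B hα), hs _ hβ _ (w C hα), hs _ hβ _ (w B (w C hα)),
    hs _ (w C hβ) _ hα, hs _ (w A (w C hβ)) _ hα,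
    hs _ (w C (w A hβ)) _ hα, hs _ (w A hβ) _ (w C hα), smul_mul_assoc, ← real_smul_tmul,
    smul_add, smul_sub, smul_neg, smul_smul, he, one_smul]
  abel

end Bracket

end Algebra

section Ideal
variable {R : Type u} [CommRing R] [Algebra ℝ R]
open CDerEnd

/-- The basis `θ₀, θ₁, θ₂, θ₃` of `W`. -/
def th (a : Fin 4) : WMod R := Pi.single a 1

/-- The same as elements of the exterior algebra. -/
def wth (a : Fin 4) : Wedge R := ExteriorAlgebra.ι R (th a)

/-- The `R`-linear endomorphisms that are antisymmetric for the inner product: `so(W)`. -/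
def IsSO (δ : CDerEnd R) : Prop :=
  (∀ f, δ.anchor f = 0) ∧ ∀ v w, confForm (δ.op v) w + confForm v (δ.op w) = 0

/-- Weyl tensors `∑ θ_a θ_b ⊗ A a b ∈ ∧²W ⊗ so(W)`: the coefficients are antisymmetric, and they satisfy
the algebraic Bianchi identity and the trace condition. -/
def IsWeylTensor (A : Fin 4 → Fin 4 → CDerEnd R) : Prop :=
  (∀ a b, IsSO (A a b)) ∧ (∀ a b, A b a = - A a b) ∧
  (∀ w, ∑ a, ∑ b, wth a * wth b * ExteriorAlgebra.ι R ((A a b).op w) = 0) ∧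
  (∀ a, ∑ b, (A a b).op (th b) = 0)

/-- The element `∑ θ_a θ_b ⊗ A a b` of `∧²W ⊗ CDerEnd(W)`. -/
def weylElt (A : Fin 4 → Fin 4 → CDerEnd R) : LAlg R := ∑ a, ∑ b, (wth a * wth b) ⊗ₜ A a b

/-- The ideal `𝓘`: the `∧W`-submodule generated by the Weyl tensors. -/
def weylIdeal (R : Type u) [CommRing R] [Algebra ℝ R] : Submodule (Wedge R) (LAlg R) :=
  Submodule.span (Wedge R) {x | ∃ A, IsWeylTensor A ∧ x = weylElt A}

theorem wedge_smul_tmul (η ω : Wedge R) (δ : CDerEnd R) :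
    η • (ω ⊗ₜ[R] δ : LAlg R) = (η * ω) ⊗ₜ δ := rfl

theorem wth_mul_comm (a b : Fin 4) (x : Wedge R) :
    wth a * wth b * x = x * (wth a * wth b) := by
  induction x using ExteriorAlgebra.induction with
  | algebraMap r => rw [Algebra.commutes]
  | ι w =>
    have h1 : ∀ c, wth c * ExteriorAlgebra.ι R w = - (ExteriorAlgebra.ι R w * wth c) :=
      fun c => eq_neg_of_add_eq_zero_left (ExteriorAlgebra.ι_add_mul_swap _ _)
    rw [mul_assoc, h1, mul_neg, ← mul_assoc, h1, neg_mul, neg_neg, mul_assoc]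
  | mul x y hx hy => rw [← mul_assoc, hx, mul_assoc, hy, mul_assoc]
  | add x y hx hy => rw [mul_add, hx, hy, add_mul]

theorem bianchi_wact {A : Fin 4 → Fin 4 → CDerEnd R} (h : IsWeylTensor A) (ω : Wedge R) :
    ∑ a, ∑ b, wth a * wth b * wact (A a b) ω = 0 := by
  induction ω using ExteriorAlgebra.induction with
  | algebraMap r => simp [wact_algebraMap, (h.1 _ _).1]
  | ι w => simpa only [wact_ι] using h.2.2.1 w
  | mul x y hx hy =>
    have : ∀ a b, wth a * wth b * wact (A a b) (x * y) =
        (wth a * wth b * wact (A a b) x) * y + x * (wth a * wth b * wact (A a b) y) := by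
      intro a b
      rw [wact_mul, mul_add, ← mul_assoc, ← mul_assoc _ x, wth_mul_comm a b x]
      simp only [mul_assoc]
    simp only [this, Finset.sum_add_distrib, ← Finset.sum_mul, ← Finset.mul_sum, hx, hy]
    simp
  | add x y hx hy => simp only [wact_add, mul_add, Finset.sum_add_distrib, hx, hy, add_zero]

theorem isSO_zero : IsSO (0 : CDerEnd R) := ⟨fun _ => rfl, fun v w => by
  change confForm 0 w + confForm v 0 = 0; simp [confForm]⟩

theorem IsSO.add {δ ε : CDerEnd R} (h1 : IsSO δ) (h2 : IsSO ε) : IsSO (δ + ε) := by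
  refine ⟨fun f => by simp [h1.1, h2.1], fun v w => ?_⟩
  have a := h1.2 v w; have b := h2.2 v w
  simp only [op_add, LinearMap.add_apply, confForm, Pi.add_apply] at *
  linear_combination a + b

theorem IsSO.smul {δ : CDerEnd R} (h1 : IsSO δ) (r : R) : IsSO (r • δ) := by
  refine ⟨fun f => by simp [h1.1], fun v w => ?_⟩
  have a := h1.2 v w
  simp only [op_rsmul, LinearMap.smul_apply, confForm, Pi.smul_apply, smul_eq_mul] at *
  linear_combination r * a

theorem IsSO.sum {s : Finset (Fin 4)} {δ : Fin 4 → CDerEnd R} (h : ∀ c, IsSO (δ c)) :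
    IsSO (∑ c ∈ s, δ c) := by
  classical
  induction s using Finset.induction_on with
  | empty => simpa using isSO_zero
  | insert a s ha ih => rw [Finset.sum_insert ha]; exact (h a).add ih

theorem IsSO.comm {ε : CDerEnd R} (h : IsSO ε) (δ : CDerEnd R) : IsSO (comm δ ε) := by
  refine ⟨fun f => by simp [comm_anchor_apply, h.1], fun v w => ?_⟩
  obtain ⟨l, hl⟩ := δ.2.2
  change ∀ v w, δ.anchor _ + _ = confForm (δ.op v) w + confForm v (δ.op w) at hl
  have e1 := congrArg δ.anchor (h.2 v w)
  have a1 := hl (ε.op v) w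
  have a2 := hl v (ε.op w)
  have a3 := h.2 (δ.op v) w
  have a4 := h.2 v (δ.op w)
  have a5 := h.2 v w
  simp only [map_add, map_zero] at e1
  have s1 : ∀ a b c : WMod R, confForm (a - b) c = confForm a c - confForm b c := by
    intros; simp only [confForm, Pi.sub_apply]; ring
  have s2 : ∀ a b c : WMod R, confForm a (b - c) = confForm a b - confForm a c := by
    intros; simp only [confForm, Pi.sub_apply]; ring
  rw [comm_op_apply, comm_op_apply, s1, s2]
  linear_combination e1 - a1 - a2 - a3 - a4 + l * a5

theorem op_sum {s : Finset (Fin 4)} (δ : Fin 4 → CDerEnd R) (w : WMod R) :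
    (∑ c ∈ s, δ c).op w = ∑ c ∈ s, (δ c).op w := by
  classical
  induction s using Finset.induction_on with
  | empty => simp only [Finset.sum_empty]; rfl
  | insert a s ha ih => rw [Finset.sum_insert ha, Finset.sum_insert ha, op_add,
      LinearMap.add_apply, ih]

theorem eq_sum_th (w : WMod R) : w = ∑ c, w c • th c := by
  ext i; simp [th, Pi.single_apply]

theorem IsSO.op_smul {ε : CDerEnd R} (h : IsSO ε) (r : R) (w : WMod R) :
    ε.op (r • w) = r • ε.op w := by rw [CDerEnd.op_smul, h.1, zero_smul, zero_add]

/-- The action `ωδ · η = ωδ(η)` of `∧W ⊗ CDerEnd(W)` on the exterior algebra. -/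
def actW (η : Wedge R) : LAlg R →+ Wedge R :=
  TensorProduct.liftAddHom
    (AddMonoidHom.mk' (fun ω => AddMonoidHom.mk' (fun δ => ω * wact δ η)
        (fun a b => by rw [add_wact, mul_add]))
      (fun a b => by ext δ; exact add_mul _ _ _))
    (fun r m n => by
      simp only [AddMonoidHom.mk'_apply, smul_wact, smul_mul_assoc, mul_smul_comm])

theorem actW_tmul (η ω : Wedge R) (δ : CDerEnd R) : actW η (ω ⊗ₜ[R] δ) = ω * wact δ η := rfl

theorem actW_weylElt (A : Fin 4 → Fin 4 → CDerEnd R) (η : Wedge R) :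
    actW η (weylElt A) = ∑ a, ∑ b, wth a * wth b * wact (A a b) η := by
  simp only [weylElt, map_sum, actW_tmul]

theorem wact_sum (δ : CDerEnd R) (s : Finset (Fin 4)) (f : Fin 4 → Wedge R) :
    wact δ (∑ c ∈ s, f c) = ∑ c ∈ s, wact δ (f c) := by
  classical
  induction s using Finset.induction_on with
  | empty => simpa using wact_zero δ
  | insert a s ha ih => rw [Finset.sum_insert ha, Finset.sum_insert ha, wact_add, ih]

/-- The derivative of a Weyl tensor along `δ`. -/
def weylDer (δ : CDerEnd R) (A : Fin 4 → Fin 4 → CDerEnd R) (a b : Fin 4) : CDerEnd R :=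
  comm δ (A a b) + ∑ c, (δ.op (th c) a • A c b + δ.op (th c) b • A a c)

theorem weylElt_weylDer (δ : CDerEnd R) (A : Fin 4 → Fin 4 → CDerEnd R) :
    weylElt (weylDer δ A) =
      ∑ a, ∑ b, ((wth a * wth b) ⊗ₜ comm δ (A a b) + wact δ (wth a * wth b) ⊗ₜ[R] A a b) := by
  have h : ∀ a, wact δ (wth a) = ∑ c, δ.op (th a) c • wth c := by
    intro a
    rw [wth, wact_ι]
    conv_lhs => rw [eq_sum_th (δ.op (th a))]
    simp only [map_sum, map_smul]; rfl
  simp only [weylElt, weylDer, TensorProduct.tmul_add, Finset.sum_add_distrib, wact_mul, h,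
    TensorProduct.add_tmul, TensorProduct.tmul_sum, Finset.sum_mul, Finset.mul_sum,
    TensorProduct.sum_tmul, smul_mul_assoc, mul_smul_comm, TensorProduct.tmul_smul,
    TensorProduct.smul_tmul']
  congr 2
  · rw [Finset.sum_comm]
    conv_rhs => rw [Finset.sum_comm]
    refine Finset.sum_congr rfl fun b _ => ?_
    rw [Finset.sum_comm]
  · refine Finset.sum_congr rfl fun a _ => ?_
    rw [Finset.sum_comm]

theorem IsWeylTensor.der {A : Fin 4 → Fin 4 → CDerEnd R} (h : IsWeylTensor A) (δ : CDerEnd R) :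
    IsWeylTensor (weylDer δ A) := by
  obtain ⟨h1, h2, h3, h4⟩ := h
  refine ⟨fun a b => ?_, fun a b => ?_, fun w => ?_, fun a => ?_⟩
  · exact ((h1 a b).comm δ).add (IsSO.sum fun c => ((h1 _ _).smul _).add ((h1 _ _).smul _))
  · have : comm δ (A b a) = - comm δ (A a b) := by
      rw [h2 a b];
      have := comm_add δ (A a b) (- A a b)
      have h0 := comm_add δ 0 0
      simp only [add_zero, add_neg_cancel] at this h0
      rw [left_eq_add] at h0
      rw [h0] at this
      exact (neg_eq_of_add_eq_zero_right this.symm).symm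
    rw [weylDer, weylDer, this, neg_add, ← Finset.sum_neg_distrib]
    congr 1
    refine Finset.sum_congr rfl fun c _ => ?_
    rw [h2 a c, h2 c b]; module
  · have e := actW_weylElt (weylDer δ A) (ExteriorAlgebra.ι R w)
    simp only [wact_ι] at e
    rw [← e, weylElt_weylDer]
    have e1 := congrArg (wact δ) (h3 w)
    have e2 := h3 (δ.op w)
    simp only [wact_sum, wact_mul _ (_ * _), wact_zero, wact_ι] at e1
    simp only [map_sum, map_add, actW_tmul, wact_ι, comm_op_apply, map_sub, mul_sub,
      Finset.sum_add_distrib, Finset.sum_sub_distrib] at e1 ⊢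
    rw [e2, sub_zero, add_comm]; exact e1
  · have e1 := congrArg δ.op (h4 a)
    simp only [map_sum, map_zero] at e1
    have e3 : ∀ c, (A a c).op (δ.op (th c)) = ∑ b, δ.op (th c) b • (A a c).op (th b) := by
      intro c
      conv_lhs => rw [eq_sum_th (δ.op (th c)), map_sum]
      exact Finset.sum_congr rfl fun b _ => (h1 a c).op_smul _ _
    simp only [weylDer, op_add, LinearMap.add_apply, op_sum, op_rsmul, LinearMap.smul_apply,
      comm_op_apply, Finset.sum_add_distrib, Finset.sum_sub_distrib, e1, e3]
    rw [Finset.sum_comm (f := fun b c => (δ.op (th c)) a • (A c b).op (th b))]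
    simp only [← Finset.smul_sum, h4, smul_zero, Finset.sum_const_zero, zero_add]
    rw [Finset.sum_comm (f := fun b c => (δ.op (th c)) b • (A a c).op (th b))]
    simp

theorem weyl_mem {A : Fin 4 → Fin 4 → CDerEnd R} (h : IsWeylTensor A) (η : Wedge R) :
    η • weylElt A ∈ weylIdeal R :=
  Submodule.smul_mem _ _ (Submodule.subset_span ⟨A, h, rfl⟩)

theorem smul_weylElt (A : Fin 4 → Fin 4 → CDerEnd R) (η : Wedge R) :
    η • weylElt A = ∑ a, ∑ b, (η * (wth a * wth b)) ⊗ₜ[R] A a b := by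
  simp only [weylElt, Finset.smul_sum, wedge_smul_tmul]

theorem wact_wth_mul_comm (δ : CDerEnd R) (a b : Fin 4) (x : Wedge R) :
    wact δ (wth a * wth b) * x = x * wact δ (wth a * wth b) := by
  have h := congrArg (wact δ) (wth_mul_comm a b x)
  rw [wact_mul _ _ x, wact_mul _ x, wth_mul_comm a b (wact δ x), add_comm] at h
  exact add_left_cancel h

theorem brL_weyl_right (x : LAlg R) {y : LAlg R} (hy : y ∈ weylIdeal R) :
    brL x y ∈ weylIdeal R := by
  induction x using TensorProduct.induction_on with
  | zero => simp
  | add x x' hx hx' => rw [map_add, LinearMap.add_apply]; exact add_mem hx hx'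
  | tmul ω δ =>
    induction hy using Submodule.closure_induction with
    | zero => simp
    | add x y _ _ hx hy => rw [map_add]; exact add_mem hx hy
    | smul_mem η y h =>
      obtain ⟨A, h, rfl⟩ := h
      have : brL (ω ⊗ₜ δ) (η • weylElt A) =
          (ω * wact δ η) • weylElt A + (ω * η) • weylElt (weylDer δ A) := by
        have z := congrArg (fun t => (t * η) ⊗ₜ[R] δ) (bianchi_wact h ω)
        simp only [Finset.sum_mul, TensorProduct.sum_tmul, zero_mul, TensorProduct.zero_tmul] at z
        rw [smul_weylElt, smul_weylElt, weylElt_weylDer]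
        simp only [map_sum, brL_tmul, Finset.smul_sum, smul_add, wedge_smul_tmul, wact_mul _ η,
          mul_add, TensorProduct.add_tmul, Finset.sum_add_distrib, Finset.sum_sub_distrib]
        have z' : ∑ a, ∑ b, (wact (A a b) ω * (η * (wth a * wth b))) ⊗ₜ[R] δ = 0 := by
          rw [← z]
          refine Finset.sum_congr rfl fun a _ => Finset.sum_congr rfl fun b _ => ?_
          rw [← mul_assoc, ← wth_mul_comm, mul_assoc (wth a * wth b)]
        rw [z', sub_zero]
        simp only [mul_assoc]
        abel
      rw [this]
      exact add_mem (weyl_mem h _) (weyl_mem (h.der δ) _)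

theorem brL_weyl_left (x : LAlg R) {y : LAlg R} (hy : y ∈ weylIdeal R) :
    brL y x ∈ weylIdeal R := by
  induction x using TensorProduct.induction_on with
  | zero => simp
  | add x x' hx hx' => rw [map_add]; exact add_mem hx hx'
  | tmul ω δ =>
    induction hy using Submodule.closure_induction with
    | zero => simp
    | add x y _ _ hx hy => rw [map_add, LinearMap.add_apply]; exact add_mem hx hy
    | smul_mem η y h =>
      obtain ⟨A, h, rfl⟩ := h
      have : brL (η • weylElt A) (ω ⊗ₜ δ) =
          - ((wact δ η * ω) • weylElt A + (η * ω) • weylElt (weylDer δ A)) := by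
        have z := congrArg (fun t => (η * t) ⊗ₜ[R] δ) (bianchi_wact h ω)
        simp only [Finset.mul_sum, TensorProduct.sum_tmul, mul_zero, TensorProduct.zero_tmul] at z
        rw [smul_weylElt, smul_weylElt, weylElt_weylDer]
        simp only [map_sum, LinearMap.sum_apply, brL_tmul, Finset.smul_sum, smul_add,
          wedge_smul_tmul, wact_mul _ η, add_mul, TensorProduct.add_tmul, Finset.sum_add_distrib,
          Finset.sum_sub_distrib, mul_assoc, wact_wth_mul_comm, comm_skew (A _ _) δ,
          TensorProduct.tmul_neg, Finset.sum_neg_distrib] at z ⊢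
        rw [z]
        have c : ∀ a b, wth a * (wth b * ω) = ω * (wth a * wth b) := fun a b => by
          rw [← mul_assoc, wth_mul_comm]
        simp only [c]
        abel
      rw [this]
      exact neg_mem (add_mem (weyl_mem h _) (weyl_mem (h.der δ) _))

/-- The underlying space of `𝓔 = 𝓛 / 𝓘`. -/
abbrev EAlg (R : Type u) [CommRing R] [Algebra ℝ R] : Type u :=
  LAlg R ⧸ (weylIdeal R).restrictScalars ℝ

/-- The projection `𝓛 → 𝓔`. -/
def mkE : LAlg R →ₗ[ℝ] EAlg R := ((weylIdeal R).restrictScalars ℝ).mkQ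

theorem mkE_surjective : Function.Surjective (mkE (R := R)) := Submodule.mkQ_surjective _

theorem mkE_eq_zero {x : LAlg R} : mkE x = 0 ↔ x ∈ weylIdeal R :=
  Submodule.Quotient.mk_eq_zero _

/-- The bracket of `𝓛` with `𝓔`. -/
def brEAux (x : LAlg R) : EAlg R →ₗ[ℝ] EAlg R :=
  ((weylIdeal R).restrictScalars ℝ).liftQ (mkE ∘ₗ brL x)
    (fun _ hy => mkE_eq_zero.2 (brL_weyl_right x hy))

theorem brEAux_mk (x y : LAlg R) : brEAux x (mkE y) = mkE (brL x y) := rfl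

/-- The bracket of `𝓛` with `𝓔` as a bilinear map. -/
def brEAux₂ : LAlg R →ₗ[ℝ] EAlg R →ₗ[ℝ] EAlg R where
  toFun := brEAux
  map_add' x y := LinearMap.ext fun z => by
    obtain ⟨z, rfl⟩ := mkE_surjective z
    rw [LinearMap.add_apply, brEAux_mk, brEAux_mk, brEAux_mk, map_add, LinearMap.add_apply,
      map_add]
  map_smul' c y := LinearMap.ext fun z => by
    obtain ⟨z, rfl⟩ := mkE_surjective z
    rw [RingHom.id_apply, LinearMap.smul_apply, brEAux_mk, brEAux_mk, map_smul,
      LinearMap.smul_apply, map_smul]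

/-- The bracket of `𝓔`. -/
def brE : EAlg R →ₗ[ℝ] EAlg R →ₗ[ℝ] EAlg R :=
  ((weylIdeal R).restrictScalars ℝ).liftQ brEAux₂ (fun y hy => LinearMap.ext fun z => by
    obtain ⟨z, rfl⟩ := mkE_surjective z
    exact mkE_eq_zero.2 (brL_weyl_left z hy))

theorem brE_mk (x y : LAlg R) : brE (mkE x) (mkE y) = mkE (brL x y) := rfl

end Ideal

section
variable {R : Type u} [CommRing R] [Algebra ℝ R]
open CDerEnd

theorem actW_real (c : ℝ) (η : Wedge R) (x : LAlg R) : actW (c • η) x = c • actW η x := by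
  induction x using TensorProduct.induction_on with
  | zero => simp
  | tmul ω δ => rw [actW_tmul, actW_tmul, wact_real, mul_smul_comm]
  | add x y hx hy => rw [map_add, map_add, hx, hy, smul_add]

theorem actW_add (η ξ : Wedge R) (x : LAlg R) : actW (η + ξ) x = actW η x + actW ξ x := by
  induction x using TensorProduct.induction_on with
  | zero => simp
  | tmul ω δ => rw [actW_tmul, actW_tmul, actW_tmul, wact_add, mul_add]
  | add x y hx hy => rw [map_add, map_add, map_add, hx, hy]; abel

theorem actW_real_right (c : ℝ) (η : Wedge R) (x : LAlg R) : actW η (c • x) = c • actW η x := by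
  induction x using TensorProduct.induction_on with
  | zero => simp
  | tmul ω δ => rw [real_smul_tmul, actW_tmul, actW_tmul, smul_mul_assoc]
  | add x y hx hy => rw [smul_add, map_add, map_add, hx, hy, smul_add]

/-- The representation of `∧W ⊗ CDerEnd(W)` on `∧W`. -/
def repWL : LAlg R →ₗ[ℝ] Wedge R →ₗ[ℝ] Wedge R :=
  LinearMap.mk₂ ℝ (fun x η => actW η x) (fun _ _ _ => map_add _ _ _)
    (fun c x η => actW_real_right c η x) (fun x η ξ => actW_add η ξ x)
    (fun c x η => actW_real c η x)

theorem repWL_tmul (ω : Wedge R) (δ : CDerEnd R) (η : Wedge R) :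
    repWL (ω ⊗ₜ δ) η = ω * wact δ η := rfl

theorem repWL_weyl {x : LAlg R} (hx : x ∈ weylIdeal R) : repWL x = 0 := by
  refine LinearMap.ext fun η => ?_
  induction hx using Submodule.closure_induction with
  | zero => simp
  | add x y _ _ hx hy => rw [map_add, LinearMap.add_apply, hx, hy, LinearMap.zero_apply, add_zero]
  | smul_mem ξ y h =>
    obtain ⟨A, h, rfl⟩ := h
    rw [smul_weylElt]
    simp only [map_sum, LinearMap.sum_apply, repWL_tmul, mul_assoc ξ, ← Finset.mul_sum,
      bianchi_wact h, mul_zero, LinearMap.zero_apply]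

/-- The representation of `𝓔` on `∧W`, that is, its anchor. -/
def repW : EAlg R →ₗ[ℝ] Wedge R →ₗ[ℝ] Wedge R :=
  ((weylIdeal R).restrictScalars ℝ).liftQ repWL (fun _ hx => repWL_weyl hx)

/-- The module `Ω = ∧⁴W`. -/
abbrev Om (R : Type u) [CommRing R] : Type u := ⋀[R]^4 (WMod R)

/-- The action of `CDerEnd(W)` on `Ω`. -/
def oact (δ : CDerEnd R) (z : Om R) : Om R := ⟨wact δ z.1, wact_mem δ z.2⟩

theorem oact_add (δ : CDerEnd R) (y z : Om R) : oact δ (y + z) = oact δ y + oact δ z :=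
  Subtype.ext (wact_add _ _ _)
theorem oact_smul (δ : CDerEnd R) (f : R) (z : Om R) :
    oact δ (f • z) = δ.anchor f • z + f • oact δ z := Subtype.ext (wact_smul _ _ _)
theorem add_oact (δ ε : CDerEnd R) (z : Om R) : oact (δ + ε) z = oact δ z + oact ε z :=
  Subtype.ext (add_wact _ _ _)
theorem smul_oact (f : R) (δ : CDerEnd R) (z : Om R) : oact (f • δ) z = f • oact δ z :=
  Subtype.ext (smul_wact _ _ _)

/-- The action of `ωδ` on `∧W ⊗ Ω`: `ηz ↦ ωδ(η)z + ωηδ(z)`. -/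
def actOmAux (ω : Wedge R) (δ : CDerEnd R) : Wedge R ⊗[R] Om R →+ Wedge R ⊗[R] Om R :=
  TensorProduct.liftAddHom
    (AddMonoidHom.mk' (fun η => AddMonoidHom.mk'
        (fun z => (ω * wact δ η) ⊗ₜ z + (ω * η) ⊗ₜ oact δ z) (by
          intro a b
          simp only [oact_add, TensorProduct.tmul_add]
          abel)) (by
      intro a b
      ext z
      simp only [wact_add, mul_add, TensorProduct.add_tmul, AddMonoidHom.mk'_apply,
        AddMonoidHom.add_apply]
      abel)) (by
    intro r m n
    simp only [AddMonoidHom.mk'_apply, wact_smul, oact_smul, mul_add, TensorProduct.add_tmul,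
      TensorProduct.tmul_add, ← TensorProduct.smul_tmul, mul_smul_comm]
    abel)

theorem actOmAux_tmul (ω : Wedge R) (δ : CDerEnd R) (η : Wedge R) (z : Om R) :
    actOmAux ω δ (η ⊗ₜ z) = (ω * wact δ η) ⊗ₜ z + (ω * η) ⊗ₜ oact δ z := rfl

theorem homOm_ext {M : Type*} [AddCommGroup M] {f g : Wedge R ⊗[R] Om R →+ M}
    (h : ∀ η z, f (η ⊗ₜ z) = g (η ⊗ₜ z)) : f = g := by
  ext x
  induction x using TensorProduct.induction_on with
  | zero => simp
  | tmul ω δ => exact h ω δ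
  | add x y hx hy => rw [map_add, map_add, hx, hy]

/-- The action on `∧W ⊗ Ω`, additive in `δ`. -/
def actOmAux₂ (ω : Wedge R) : CDerEnd R →+ (Wedge R ⊗[R] Om R →+ Wedge R ⊗[R] Om R) where
  toFun δ := actOmAux ω δ
  map_zero' := by
    have h : actOmAux ω (0 : CDerEnd R) + actOmAux ω 0 = actOmAux ω 0 := by
      refine homOm_ext fun η z => ?_
      rw [AddMonoidHom.add_apply, actOmAux_tmul]
      have e1 := add_wact (0 : CDerEnd R) 0 η
      have e2 := add_oact (0 : CDerEnd R) 0 z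
      simp only [add_zero, left_eq_add] at e1 e2
      simp [e1, e2]
    simpa using h
  map_add' a b := by
    refine homOm_ext fun η z => ?_
    simp only [AddMonoidHom.add_apply, actOmAux_tmul, add_wact, add_oact, TensorProduct.tmul_add,
      mul_add, TensorProduct.add_tmul]
    abel

/-- The action on `∧W ⊗ Ω`, biadditive. -/
def actOmAux₃ : Wedge R →+ CDerEnd R →+ (Wedge R ⊗[R] Om R →+ Wedge R ⊗[R] Om R) where
  toFun ω := actOmAux₂ ω
  map_zero' := by
    ext1 δ
    refine homOm_ext fun η z => ?_
    change actOmAux 0 δ (η ⊗ₜ z) = 0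
    simp [actOmAux_tmul]
  map_add' a b := by
    ext1 δ
    refine homOm_ext fun η z => ?_
    change actOmAux (a + b) δ (η ⊗ₜ z) = actOmAux a δ (η ⊗ₜ z) + actOmAux b δ (η ⊗ₜ z)
    simp only [actOmAux_tmul, add_mul, TensorProduct.add_tmul]
    abel

/-- The action of `∧W ⊗ CDerEnd(W)` on `∧W ⊗ Ω`. -/
def actOm : LAlg R →+ (Wedge R ⊗[R] Om R →+ Wedge R ⊗[R] Om R) :=
  TensorProduct.liftAddHom actOmAux₃ (by
    intro r ω δ
    refine homOm_ext fun η z => ?_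
    change actOmAux (r • ω) δ (η ⊗ₜ z) = actOmAux ω (r • δ) (η ⊗ₜ z)
    simp only [actOmAux_tmul, smul_wact, smul_oact, ← TensorProduct.smul_tmul,
      mul_smul_comm, smul_mul_assoc])

theorem actOm_tmul (ω : Wedge R) (δ : CDerEnd R) (η : Wedge R) (z : Om R) :
    actOm (ω ⊗ₜ δ) (η ⊗ₜ z) = (ω * wact δ η) ⊗ₜ z + (ω * η) ⊗ₜ oact δ z := rfl

theorem real_smul_om (c : ℝ) (ξ : Wedge R) (y : Om R) :
    c • (ξ ⊗ₜ[R] y) = (c • ξ) ⊗ₜ[R] y := rfl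

theorem actOm_real_right (c : ℝ) (x : LAlg R) (ζ : Wedge R ⊗[R] Om R) :
    actOm x (c • ζ) = c • actOm x ζ := by
  induction ζ using TensorProduct.induction_on with
  | zero => simp
  | add y z hy hz => rw [smul_add, map_add, map_add, hy, hz, smul_add]
  | tmul η z =>
    induction x using TensorProduct.induction_on with
    | zero => simp
    | add x y hx hy =>
      rw [map_add, AddMonoidHom.add_apply, hx, hy, AddMonoidHom.add_apply, smul_add]
    | tmul ω δ =>
      rw [real_smul_om, actOm_tmul, actOm_tmul, wact_real, mul_smul_comm, mul_smul_comm,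
        smul_add, real_smul_om, real_smul_om]

theorem actOm_real (c : ℝ) (x : LAlg R) (ζ : Wedge R ⊗[R] Om R) :
    actOm (c • x) ζ = c • actOm x ζ := by
  induction ζ using TensorProduct.induction_on with
  | zero => simp
  | add y z hy hz => rw [map_add, map_add, hy, hz, smul_add]
  | tmul η z =>
    induction x using TensorProduct.induction_on with
    | zero => simp
    | add x y hx hy =>
      rw [smul_add, map_add, AddMonoidHom.add_apply, hx, hy, map_add, AddMonoidHom.add_apply,
        smul_add]
    | tmul ω δ =>
      rw [real_smul_tmul, actOm_tmul, actOm_tmul, smul_mul_assoc, smul_mul_assoc,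
        smul_add, real_smul_om, real_smul_om]

/-- The representation of `∧W ⊗ CDerEnd(W)` on `∧W ⊗ Ω`. -/
def repOmL : LAlg R →ₗ[ℝ] Wedge R ⊗[R] Om R →ₗ[ℝ] Wedge R ⊗[R] Om R :=
  LinearMap.mk₂ ℝ (fun x ζ => actOm x ζ) (fun x y ζ => by rw [map_add, AddMonoidHom.add_apply])
    (fun c x ζ => actOm_real c x ζ) (fun x ζ ξ => map_add _ _ _)
    (fun c x ζ => actOm_real_right c x ζ)

theorem repOmL_tmul (ω : Wedge R) (δ : CDerEnd R) (η : Wedge R) (z : Om R) :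
    repOmL (ω ⊗ₜ δ) (η ⊗ₜ z) = (ω * wact δ η) ⊗ₜ z + (ω * η) ⊗ₜ oact δ z := rfl

theorem so_diag {δ : CDerEnd R} (h : IsSO δ) (a : Fin 4) : δ.op (th a) a = 0 := by
  have e := h.2 (th a) (th a)
  have two : ∀ r : R, r + r = 0 → r = 0 := fun r hr => by
    have h2 : (2 : ℝ) • r = 0 := by rw [two_smul, hr]
    calc r = (2⁻¹ : ℝ) • ((2 : ℝ) • r) := by rw [smul_smul]; norm_num
      _ = 0 := by rw [h2, smul_zero]
  apply two
  fin_cases a <;> simp [confForm, th] at e ⊢ <;>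
    first | linear_combination e | linear_combination -e

theorem so_update {δ : CDerEnd R} (h : IsSO δ) (v : Fin 4 → Fin 4) (hv : Function.Injective v)
    (i : Fin 4) : ExteriorAlgebra.ιMulti R 4
      (Function.update (fun j => (th (v j) : WMod R)) i (δ.op (th (v i)))) = 0 := by
  classical
  rw [eq_sum_th (δ.op (th (v i))), AlternatingMap.map_update_sum]
  refine Finset.sum_eq_zero fun c _ => ?_
  rw [AlternatingMap.map_update_smul]
  obtain ⟨j, rfl⟩ := (Finite.injective_iff_surjective.1 hv) c
  by_cases hj : j = i
  · subst hj; rw [so_diag h, zero_smul]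
  · rw [AlternatingMap.map_eq_zero_of_eq _ _ (i := i) (j := j) _ (Ne.symm hj), smul_zero]
    simp [hj]

/-- `wact δ` as an `R`-linear map, when the anchor vanishes. -/
def wactLin (δ : CDerEnd R) (h : IsSO δ) : Wedge R →ₗ[R] Wedge R where
  toFun := wact δ
  map_add' := wact_add δ
  map_smul' r x := by rw [wact_smul, h.1, zero_smul, zero_add]; rfl

theorem so_oact {δ : CDerEnd R} (h : IsSO δ) (z : Om R) : oact δ z = 0 := by
  refine Subtype.ext ?_
  have key : (wactLin δ h).compAlternatingMap (ExteriorAlgebra.ιMulti R 4) = 0 := by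
    refine Module.Basis.ext_alternating (Pi.basisFun R (Fin 4)) fun v hv => ?_
    have hb : (fun i => Pi.basisFun R (Fin 4) (v i)) = fun i => (th (v i) : WMod R) := by
      funext i; simp [th]
    rw [hb]
    have e0 := so_update h v hv 0
    have e1 := so_update h v hv 1
    have e2 := so_update h v hv 2
    have e3 := so_update h v hv 3
    simp only [ExteriorAlgebra.ιMulti_apply, List.ofFn_succ, List.ofFn_zero, List.prod_cons,
      List.prod_nil, Function.update_apply] at e0 e1 e2 e3
    change wact δ (ExteriorAlgebra.ιMulti R 4 fun i => th (v i)) = 0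
    simp only [ExteriorAlgebra.ιMulti_apply, List.ofFn_succ, List.ofFn_zero, List.prod_cons,
      List.prod_nil, wact_mul, wact_ι, wact_one]
    simp at e0 e1 e2 e3 ⊢
    simp only [mul_add, e0, e1, e2, e3, add_zero]
  have hz : z.1 ∈ Submodule.span R (Set.range (ExteriorAlgebra.ιMulti R 4 (M := WMod R))) := by
    exact (ExteriorAlgebra.ιMulti_span_fixedDegree (R := R) 4 (M := WMod R)).ge z.2
  change wactLin δ h z.1 = 0
  generalize z.1 = y at hz ⊢
  induction hz using Submodule.span_induction with
  | mem x hx => obtain ⟨v, rfl⟩ := hx; exact congrArg (fun f => f v) key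
  | zero => exact map_zero _
  | add x y _ _ hx hy => rw [map_add, hx, hy, add_zero]
  | smul r x _ hx => rw [map_smul, hx, smul_zero]

theorem repOmL_weyl {x : LAlg R} (hx : x ∈ weylIdeal R) : (repOmL x : Wedge R ⊗[R] Om R →ₗ[ℝ] Wedge R ⊗[R] Om R) = 0 := by
  refine LinearMap.ext fun ζ => ?_
  induction ζ using TensorProduct.induction_on with
  | zero => simp
  | add x y hx hy => rw [map_add, hx, hy]; simp
  | tmul η z =>
    induction hx using Submodule.closure_induction with
    | zero => simp
    | add x y _ _ hx hy =>
      rw [map_add, LinearMap.add_apply, hx, hy]; simp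
    | smul_mem ξ y h =>
      obtain ⟨A, h, rfl⟩ := h
      rw [smul_weylElt]
      simp only [map_sum, LinearMap.sum_apply, repOmL_tmul, so_oact (h.1 _ _), mul_assoc ξ,
        TensorProduct.tmul_zero, add_zero, ← TensorProduct.sum_tmul, ← Finset.mul_sum,
        bianchi_wact h, mul_zero, TensorProduct.zero_tmul, LinearMap.zero_apply]

/-- The representation of `𝓔` on `∧W ⊗ Ω`. -/
def repOm : EAlg R →ₗ[ℝ] Wedge R ⊗[R] Om R →ₗ[ℝ] Wedge R ⊗[R] Om R :=
  Submodule.liftQ (R := ℝ) (R₂ := ℝ) (τ₁₂ := RingHom.id ℝ) (M := LAlg R)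
    (M₂ := Wedge R ⊗[R] Om R →ₗ[ℝ] Wedge R ⊗[R] Om R) ((weylIdeal R).restrictScalars ℝ)
    repOmL (fun _ hx => LinearMap.mem_ker.2 (repOmL_weyl (R := R) hx))

end

open CategoryTheory

/-- A real graded Lie algebra. -/
structure GLA : Type (u + 1) where
  V : ℤ → Type u
  [acg : ∀ k, AddCommGroup (V k)]
  [mod : ∀ k, Module ℝ (V k)]
  br : ∀ {i j k : ℤ}, i + j = k → V i →ₗ[ℝ] V j →ₗ[ℝ] V k
  skew : ∀ {i j k : ℤ} (h : i + j = k) (h' : j + i = k) (x : V i) (y : V j),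
    br h x y = -((-1 : ℝ) ^ (i * j) • br h' y x)
  jacobi : ∀ {i j k ij jk ik n : ℤ} (hij : i + j = ij) (hjk : j + k = jk) (hik : i + k = ik)
    (h₁ : i + jk = n) (h₂ : ij + k = n) (h₃ : j + ik = n) (x : V i) (y : V j) (z : V k),
    br h₁ x (br hjk y z) = br h₂ (br hij x y) z + (-1 : ℝ) ^ (i * j) • br h₃ y (br hik x z)

attribute [instance] GLA.acg GLA.mod

namespace GLA

/-- Degree-preserving linear maps that respect the brackets. -/
@[ext]
structure Hom (G H : GLA.{u}) : Type u where
  app : ∀ k, G.V k →ₗ[ℝ] H.V k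
  map_br : ∀ {i j k : ℤ} (h : i + j = k) (x : G.V i) (y : G.V j),
    app k (G.br h x y) = H.br h (app i x) (app j y)

instance : Category GLA.{u} where
  Hom := Hom
  id G := ⟨fun _ => LinearMap.id, fun _ _ _ => rfl⟩
  comp f g := ⟨fun k => g.app k ∘ₗ f.app k, fun h x y => by
    simp only [LinearMap.comp_apply, f.map_br, g.map_br]⟩

/-- The component in degree `k` of a morphism. -/
def ap {G H : GLA.{u}} (f : G ⟶ H) (k : ℤ) : G.V k →ₗ[ℝ] H.V k := Hom.app f k

variable (σ : Type) [DecidableEq σ]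

/-- The bracket of formal power series. -/
def psBr (G : GLA.{u}) {i j k : ℤ} (h : i + j = k) :
    ((σ →₀ ℕ) → G.V i) →ₗ[ℝ] ((σ →₀ ℕ) → G.V j) →ₗ[ℝ] ((σ →₀ ℕ) → G.V k) :=
  LinearMap.mk₂ ℝ (fun x y n => ∑ p ∈ Finset.HasAntidiagonal.antidiagonal n, G.br h (x p.1) (y p.2))
    (fun x x' y => by ext n; simp [Finset.sum_add_distrib])
    (fun c x y => by ext n; simp [Finset.smul_sum])
    (fun x y y' => by ext n; simp [Finset.sum_add_distrib])
    (fun c x y => by ext n; simp [Finset.smul_sum])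

theorem psBr_apply (G : GLA.{u}) {i j k : ℤ} (h : i + j = k) (x : (σ →₀ ℕ) → G.V i)
    (y : (σ →₀ ℕ) → G.V j) (n : σ →₀ ℕ) :
    psBr σ G h x y n = ∑ p ∈ Finset.HasAntidiagonal.antidiagonal n, G.br h (x p.1) (y p.2) := rfl

/-- The graded Lie algebra `𝔤[[s]]` of formal power series in symbols indexed by `σ`. -/
def powerSeries (G : GLA.{u}) : GLA.{u} where
  V k := (σ →₀ ℕ) → G.V k
  br h := psBr σ G h
  skew {i j k} h h' x y := by
    ext n
    simp only [Pi.neg_apply, Pi.smul_apply, psBr_apply, Finset.smul_sum, ← Finset.sum_neg_distrib]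
    rw [Finsupp.sum_antidiagonal_swap n (fun p q => G.br h (x p) (y q))]
    exact Finset.sum_congr rfl fun p _ => G.skew h h' _ _
  jacobi {i j k ij jk ik n} hij hjk hik h₁ h₂ h₃ x y z := by
    ext m
    have e1 : psBr σ G h₂ (psBr σ G hij x y) z m = ∑ p ∈ Finset.HasAntidiagonal.antidiagonal m,
        ∑ q ∈ Finset.HasAntidiagonal.antidiagonal p.2, G.br h₂ (G.br hij (x p.1) (y q.1)) (z q.2) := by
      simp only [psBr_apply, map_sum, LinearMap.sum_apply, Finset.sum_sigma']
      apply Finset.sum_nbij' (fun ⟨⟨_i, j⟩, ⟨k, l⟩⟩ ↦ ⟨(k, l + j), (l, j)⟩)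
        (fun ⟨⟨i, _j⟩, ⟨k, l⟩⟩ ↦ ⟨(i + k, l), (i, k)⟩) <;>
      · simp only [Finset.mem_sigma, Finset.HasAntidiagonal.mem_antidiagonal]
        rintro ⟨⟨a, b⟩, c, d⟩ ⟨h1, h2⟩
        dsimp only at h1 h2 ⊢
        all_goals subst h2
        all_goals first | rfl | (subst h1; simp [add_assoc])
    have e2 : psBr σ G h₃ y (psBr σ G hik x z) m = ∑ p ∈ Finset.HasAntidiagonal.antidiagonal m,
        ∑ q ∈ Finset.HasAntidiagonal.antidiagonal p.2, G.br h₃ (y q.1) (G.br hik (x p.1) (z q.2)) := by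
      simp only [psBr_apply, map_sum, Finset.sum_sigma']
      apply Finset.sum_nbij' (fun ⟨⟨i, _⟩, ⟨k, l⟩⟩ ↦ ⟨(k, i + l), (i, l)⟩)
        (fun ⟨⟨i, _⟩, ⟨k, l⟩⟩ ↦ ⟨(k, i + l), (i, l)⟩) <;>
      · simp only [Finset.mem_sigma, Finset.HasAntidiagonal.mem_antidiagonal]
        rintro ⟨⟨a, b⟩, c, d⟩ ⟨h1, h2⟩
        dsimp only at h1 h2 ⊢
        all_goals subst h2
        all_goals first | rfl | (subst h1; simp [add_left_comm])
    rw [Pi.add_apply, Pi.smul_apply, e1, e2]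
    simp only [psBr_apply, map_sum, Finset.smul_sum, ← Finset.sum_add_distrib]
    exact Finset.sum_congr rfl fun p _ => Finset.sum_congr rfl fun q _ =>
      G.jacobi hij hjk hik h₁ h₂ h₃ _ _ _

theorem ap_psBr {G H : GLA.{u}} (f : G ⟶ H) {i j k : ℤ} (h : i + j = k)
    (x : (σ →₀ ℕ) → G.V i) (y : (σ →₀ ℕ) → G.V j) (n : σ →₀ ℕ) :
    ap f k (psBr σ G h x y n) = psBr σ H h (fun n => ap f i (x n)) (fun n => ap f j (y n)) n := by
  rw [psBr_apply, psBr_apply, map_sum]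
  exact Finset.sum_congr rfl fun p _ => Hom.map_br f h _ _

/-- Coefficientwise application of a morphism. -/
def powerSeriesMap {G H : GLA.{u}} (f : G ⟶ H) : powerSeries σ G ⟶ powerSeries σ H :=
  Hom.mk (G := powerSeries σ G) (H := powerSeries σ H)
    (fun k => (ap f k).compLeft (σ →₀ ℕ)) (fun h x y => funext fun n => ap_psBr σ f h x y n)

end GLA

/-- A filtration of a real graded Lie algebra, indexed by multi-indices `σ → ℕ`. -/
structure IsGLAFiltration {σ : Type} (G : GLA.{u})
    (F : (σ →₀ ℕ) → ∀ k, Submodule ℝ (G.V k)) : Prop where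
  mono : ∀ {m n : σ →₀ ℕ}, m ≤ n → ∀ k, F m k ≤ F n k
  exhaustive : ∃ n, ∀ k, F n k = ⊤
  br_mem : ∀ (m n : σ →₀ ℕ) {i j k : ℤ} (h : i + j = k), ∀ x ∈ F m i, ∀ y ∈ F n j,
    G.br h x y ∈ F (m + n) k

/-- A real filtered graded Lie algebra. -/
structure FiltGLA (σ : Type) : Type (u + 1) where
  toGLA : GLA.{u}
  F : (σ →₀ ℕ) → ∀ k, Submodule ℝ (toGLA.V k)
  isFiltration : IsGLAFiltration toGLA F

namespace FiltGLA
variable {σ : Type}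

/-- Morphisms of graded Lie algebras that respect the filtrations. -/
@[ext]
structure Hom (G H : FiltGLA.{u} σ) : Type u where
  hom : G.toGLA ⟶ H.toGLA
  map_F : ∀ n k, ∀ x ∈ G.F n k, GLA.ap hom k x ∈ H.F n k

instance : Category (FiltGLA.{u} σ) where
  Hom := Hom
  id G := ⟨𝟙 _, fun _ _ _ h => h⟩
  comp f g := ⟨f.hom ≫ g.hom, fun n k x h => g.map_F n k _ (f.map_F n k x h)⟩

/-- The functor that forgets the filtration. -/
def forget (σ : Type) : FiltGLA.{u} σ ⥤ GLA.{u} where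
  obj G := G.toGLA
  map f := Hom.hom f

variable [DecidableEq σ]

/-- The degree `k` part of the Rees algebra: the series `∑ sⁿ xₙ` with `xₙ ∈ Fₙ`. -/
def reesSub (G : FiltGLA.{u} σ) (k : ℤ) : Submodule ℝ ((GLA.powerSeries σ G.toGLA).V k) where
  carrier := {x | ∀ n, x n ∈ G.F n k}
  add_mem' hx hy n := add_mem (hx n) (hy n)
  zero_mem' n := zero_mem _
  smul_mem' c _ hx n := Submodule.smul_mem _ c (hx n)

theorem br_mem_rees (G : FiltGLA.{u} σ) {i j k : ℤ} (h : i + j = k)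
    {x : (GLA.powerSeries σ G.toGLA).V i} {y : (GLA.powerSeries σ G.toGLA).V j}
    (hx : x ∈ reesSub G i) (hy : y ∈ reesSub G j) :
    (GLA.powerSeries σ G.toGLA).br h x y ∈ reesSub G k := by
  intro n
  refine Submodule.sum_mem _ fun p hp => ?_
  rw [← Finset.HasAntidiagonal.mem_antidiagonal.1 hp]
  exact G.isFiltration.br_mem _ _ h _ (hx _) _ (hy _)

/-- The Rees algebra of a filtration. -/
def rees (G : FiltGLA.{u} σ) : GLA.{u} where
  V k := reesSub G k
  br {i j k} h := LinearMap.mk₂ ℝ (fun x y => ⟨_, br_mem_rees G h x.2 y.2⟩)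
    (fun x y z => Subtype.ext (by simp)) (fun c x y => Subtype.ext (by simp))
    (fun x y z => Subtype.ext (by simp)) (fun c x y => Subtype.ext (by simp))
  skew h h' x y := Subtype.ext ((GLA.powerSeries σ G.toGLA).skew h h' x.1 y.1)
  jacobi hij hjk hik h₁ h₂ h₃ x y z :=
    Subtype.ext ((GLA.powerSeries σ G.toGLA).jacobi hij hjk hik h₁ h₂ h₃ x.1 y.1 z.1)

/-- The inclusion of the Rees algebra into the formal power series. -/
def reesIncl (G : FiltGLA.{u} σ) : rees G ⟶ GLA.powerSeries σ G.toGLA :=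
  GLA.Hom.mk (G := rees G) (H := GLA.powerSeries σ G.toGLA)
    (fun k => (reesSub G k).subtype) (fun _ _ _ => rfl)

/-- Multiplication by the symbol `sᵢ` on the Rees algebra. -/
def shift (G : FiltGLA.{u} σ) (i : σ) (k : ℤ) : (rees G).V k →ₗ[ℝ] (rees G).V k where
  toFun x := ⟨fun n => if n i = 0 then 0 else x.1 (n - Finsupp.single i 1), fun n => by
    dsimp only
    split_ifs
    · exact zero_mem _
    · exact G.isFiltration.mono tsub_le_self k (x.2 _)⟩
  map_add' x y := Subtype.ext (by
    funext n
    change (if n i = 0 then 0 else _) =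
      (if n i = 0 then 0 else _) + (if n i = 0 then (0 : G.toGLA.V k) else _)
    split_ifs
    · simp
    · rfl)
  map_smul' c x := Subtype.ext (by
    funext n
    change (if n i = 0 then 0 else _) = c • (if n i = 0 then (0 : G.toGLA.V k) else _)
    split_ifs
    · simp
    · rfl)

theorem shift_apply (G : FiltGLA.{u} σ) (i : σ) (k : ℤ) (x : (rees G).V k) (n : σ →₀ ℕ) :
    (shift G i k x).1 n = if n i = 0 then 0 else x.1 (n - Finsupp.single i 1) := rfl

theorem br_shift_left (G : FiltGLA.{u} σ) (a : σ) {i j k : ℤ} (h : i + j = k) (x : (rees G).V i)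
    (y : (rees G).V j) : (rees G).br h (shift G a i x) y = shift G a k ((rees G).br h x y) := by
  refine Subtype.ext (funext fun n => ?_)
  rw [shift_apply]
  change ∑ p ∈ Finset.HasAntidiagonal.antidiagonal n, G.toGLA.br h ((shift G a i x).1 p.1) (y.1 p.2) =
    if n a = 0 then 0 else ∑ p ∈ Finset.HasAntidiagonal.antidiagonal (n - Finsupp.single a 1),
      G.toGLA.br h (x.1 p.1) (y.1 p.2)
  split_ifs with hn
  · refine Finset.sum_eq_zero fun p hp => ?_
    have : p.1 a + p.2 a = n a := by rw [← Finset.HasAntidiagonal.mem_antidiagonal.1 hp]; rfl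
    rw [shift_apply, if_pos (by omega), map_zero, LinearMap.zero_apply]
  · symm
    have key : ∀ p : σ →₀ ℕ, p + Finsupp.single a 1 - Finsupp.single a 1 = p :=
      fun p => add_tsub_cancel_right p _
    refine Finset.sum_of_injOn (fun p : (σ →₀ ℕ) × (σ →₀ ℕ) => (p.1 + Finsupp.single a 1, p.2)) ?_ ?_ ?_ ?_
    · rintro ⟨p, q⟩ - ⟨p', q'⟩ - e
      simpa using e
    · rintro ⟨p, q⟩ e
      have e := Finset.HasAntidiagonal.mem_antidiagonal.1 e
      refine Finset.mem_coe.2 (Finset.HasAntidiagonal.mem_antidiagonal.2 ?_)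
      dsimp only at e ⊢
      rw [add_right_comm, e, tsub_add_cancel_of_le]
      rw [Finsupp.single_le_iff]; omega
    · rintro ⟨p, q⟩ e he
      rw [shift_apply]
      split_ifs with hp
      · simp
      · exfalso
        apply he
        have e := Finset.HasAntidiagonal.mem_antidiagonal.1 e
        have hp' : Finsupp.single a 1 ≤ p := by rw [Finsupp.single_le_iff]; dsimp only at hp; omega
        refine ⟨(p - Finsupp.single a 1, q), Finset.mem_coe.2 (Finset.HasAntidiagonal.mem_antidiagonal.2 ?_), ?_⟩
        · dsimp only at e ⊢
          rw [← e, tsub_add_eq_add_tsub hp']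
        · dsimp only; rw [tsub_add_cancel_of_le hp']
    · rintro ⟨p, q⟩ e
      dsimp only
      rw [shift_apply, if_neg (by simp), key]

theorem br_shift_right (G : FiltGLA.{u} σ) (a : σ) {i j k : ℤ} (h : i + j = k) (x : (rees G).V i)
    (y : (rees G).V j) : (rees G).br h x (shift G a j y) = shift G a k ((rees G).br h x y) := by
  have h' : j + i = k := by omega
  rw [(rees G).skew h h', br_shift_left, (rees G).skew h h', map_neg, map_smul]

/-- The ideal of the Rees algebra generated by the symbols. -/
def symIdeal (G : FiltGLA.{u} σ) (k : ℤ) : Submodule ℝ ((rees G).V k) :=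
  ⨆ i : σ, LinearMap.range (shift G i k)

theorem br_symIdeal_right (G : FiltGLA.{u} σ) {i j k : ℤ} (h : i + j = k) (x : (rees G).V i)
    {y : (rees G).V j} (hy : y ∈ symIdeal G j) : (rees G).br h x y ∈ symIdeal G k := by
  induction hy using Submodule.iSup_induction' with
  | mem a y hy =>
    obtain ⟨y, rfl⟩ := hy
    rw [br_shift_right]
    exact Submodule.mem_iSup_of_mem a ⟨_, rfl⟩
  | zero => simp
  | add y z _ _ hy hz => rw [map_add]; exact add_mem hy hz

theorem br_symIdeal_left (G : FiltGLA.{u} σ) {i j k : ℤ} (h : i + j = k) {x : (rees G).V i}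
    (y : (rees G).V j) (hx : x ∈ symIdeal G i) : (rees G).br h x y ∈ symIdeal G k := by
  rw [(rees G).skew h (by omega : j + i = k)]
  exact neg_mem (Submodule.smul_mem _ _ (br_symIdeal_right G _ _ hx))

/-- The class in the associated graded. -/
def grMk (G : FiltGLA.{u} σ) (k : ℤ) : (rees G).V k →ₗ[ℝ] (rees G).V k ⧸ symIdeal G k :=
  (symIdeal G k).mkQ

theorem grMk_surjective (G : FiltGLA.{u} σ) (k : ℤ) : Function.Surjective (grMk G k) :=
  Submodule.mkQ_surjective _

theorem grMk_eq_zero (G : FiltGLA.{u} σ) {k : ℤ} {x : (rees G).V k} :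
    grMk G k x = 0 ↔ x ∈ symIdeal G k := Submodule.Quotient.mk_eq_zero _

/-- The bracket of the Rees algebra with its quotient. -/
def grBrAux (G : FiltGLA.{u} σ) {i j k : ℤ} (h : i + j = k) (x : (rees G).V i) :
    ((rees G).V j ⧸ symIdeal G j) →ₗ[ℝ] ((rees G).V k ⧸ symIdeal G k) :=
  (symIdeal G j).liftQ (grMk G k ∘ₗ (rees G).br h x)
    (fun _ hy => (grMk_eq_zero G).2 (br_symIdeal_right G h x hy))

theorem grBrAux_mk (G : FiltGLA.{u} σ) {i j k : ℤ} (h : i + j = k) (x : (rees G).V i)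
    (y : (rees G).V j) : grBrAux G h x (grMk G j y) = grMk G k ((rees G).br h x y) := rfl

/-- The bracket of the Rees algebra with its quotient, as a bilinear map. -/
def grBrAux₂ (G : FiltGLA.{u} σ) {i j k : ℤ} (h : i + j = k) :
    (rees G).V i →ₗ[ℝ] ((rees G).V j ⧸ symIdeal G j) →ₗ[ℝ] ((rees G).V k ⧸ symIdeal G k) where
  toFun := grBrAux G h
  map_add' x y := LinearMap.ext fun z => by
    obtain ⟨z, rfl⟩ := grMk_surjective G _ z
    rw [LinearMap.add_apply, grBrAux_mk, grBrAux_mk, grBrAux_mk, map_add, LinearMap.add_apply,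
      map_add]
  map_smul' c x := LinearMap.ext fun z => by
    obtain ⟨z, rfl⟩ := grMk_surjective G _ z
    rw [RingHom.id_apply, LinearMap.smul_apply, grBrAux_mk, grBrAux_mk, map_smul,
      LinearMap.smul_apply, map_smul]

/-- The bracket of the associated graded. -/
def grBr (G : FiltGLA.{u} σ) {i j k : ℤ} (h : i + j = k) :
    ((rees G).V i ⧸ symIdeal G i) →ₗ[ℝ] ((rees G).V j ⧸ symIdeal G j) →ₗ[ℝ]
      ((rees G).V k ⧸ symIdeal G k) :=
  (symIdeal G i).liftQ (grBrAux₂ G h) (fun x hx => LinearMap.ext fun z => by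
    obtain ⟨z, rfl⟩ := grMk_surjective G _ z
    exact (grMk_eq_zero G).2 (br_symIdeal_left G h z hx))

theorem grBr_mk (G : FiltGLA.{u} σ) {i j k : ℤ} (h : i + j = k) (x : (rees G).V i)
    (y : (rees G).V j) : grBr G h (grMk G i x) (grMk G j y) =
      grMk G k ((rees G).br h x y) := rfl

/-- The associated graded: the Rees algebra modulo the ideal generated by the symbols. -/
def gr (G : FiltGLA.{u} σ) : GLA.{u} where
  V k := (rees G).V k ⧸ symIdeal G k
  br h := grBr G h
  skew {i j k} h h' x y := by
    obtain ⟨x, rfl⟩ := grMk_surjective G _ x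
    obtain ⟨y, rfl⟩ := grMk_surjective G _ y
    rw [grBr_mk, grBr_mk, (rees G).skew h h', map_neg, map_smul]
  jacobi {i j k ij jk ik n} hij hjk hik h₁ h₂ h₃ x y z := by
    obtain ⟨x, rfl⟩ := grMk_surjective G _ x
    obtain ⟨y, rfl⟩ := grMk_surjective G _ y
    obtain ⟨z, rfl⟩ := grMk_surjective G _ z
    simp only [grBr_mk]
    rw [(rees G).jacobi hij hjk hik h₁ h₂ h₃, map_add, map_smul]

/-- The projection from the Rees algebra to the associated graded. -/
def grProj (G : FiltGLA.{u} σ) : rees G ⟶ gr G :=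
  GLA.Hom.mk (G := rees G) (H := gr G) (fun k => grMk G k) (fun _ _ _ => rfl)

end FiltGLA

section
variable {R : Type u} [CommRing R] [Algebra ℝ R]
open CDerEnd

/-- The homogeneous part `𝓔ᵏ`. -/
def degE (R : Type u) [CommRing R] [Algebra ℝ R] (k : ℤ) : Submodule ℝ (EAlg R) :=
  (degL R k).map mkE

theorem brE_mem {i j k : ℤ} (h : i + j = k) {x y : EAlg R} (hx : x ∈ degE R i)
    (hy : y ∈ degE R j) : brE x y ∈ degE R k := by
  obtain ⟨x, hx, rfl⟩ := hx
  obtain ⟨y, hy, rfl⟩ := hy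
  exact ⟨_, brL_mem h hx hy, brE_mk x y⟩

/-- The real graded Lie algebra `𝓔`. -/
def gE (R : Type u) [CommRing R] [Algebra ℝ R] : GLA.{u} where
  V k := degE R k
  br {i j k} h := LinearMap.mk₂ ℝ (fun x y => ⟨brE x.1 y.1, brE_mem h x.2 y.2⟩)
    (fun x y z => Subtype.ext (by simp)) (fun c x y => Subtype.ext (by simp))
    (fun x y z => Subtype.ext (by simp)) (fun c x y => Subtype.ext (by simp))
  skew {i j k} h h' := by
    rintro ⟨_, x, hx, rfl⟩ ⟨_, y, hy, rfl⟩
    refine Subtype.ext ?_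
    simp only [LinearMap.mk₂_apply, brE_mk, Submodule.coe_neg, Submodule.coe_smul]
    rw [brL_skew hx hy, map_neg, map_smul]
  jacobi {i j k ij jk ik n} hij hjk hik h₁ h₂ h₃ := by
    rintro ⟨_, x, hx, rfl⟩ ⟨_, y, hy, rfl⟩ ⟨_, z, hz, rfl⟩
    refine Subtype.ext ?_
    simp only [LinearMap.mk₂_apply, brE_mk, Submodule.coe_add, Submodule.coe_smul]
    rw [brL_jacobi hx hy hz, map_add, map_smul]

/-- The class in `𝓔ᵏ` of `ω ⊗ δ`, where `ω ∈ ∧ᵏW`. -/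
def elt {n : ℕ} (ω : ⋀[R]^n (WMod R)) (δ : CDerEnd R) : (gE R).V n :=
  ⟨mkE (ω.1 ⊗ₜ δ), _, tmul_mem_degL rfl ω.2 δ, rfl⟩

/-- The basis-dependent inclusion `Der(R) ↪ CDerEnd(W)`: the image annihilates the `θ_a`. -/
def CDerEnd.lift (X : Derivation ℝ R R) : CDerEnd R :=
  ⟨(X, LinearMap.pi fun a => X.toLinearMap ∘ₗ LinearMap.proj a),
    fun f w => by ext a; simp [mul_comm, add_comm],
    0, fun v w => by simp [confForm]; ring⟩

/-- An `R`-linear endomorphism as an element of `CDerEnd(W)`. -/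
def CDerEnd.ofEnd (A : WMod R →ₗ[R] WMod R)
    (h : ∃ l : R, ∀ v w, l * confForm v w = confForm (A v) w + confForm v (A w)) : CDerEnd R :=
  ⟨(0, A.restrictScalars ℝ), fun f w => by simp, by simpa using h⟩

/-- `σ₀`, the identity of `W`. -/
def sig0 : CDerEnd R := CDerEnd.ofEnd LinearMap.id ⟨2, fun v w => by simp; ring⟩

/-- `σᵢ`: `θ₀ ↦ θᵢ`, `θᵢ ↦ θ₀`, zero on the other basis elements. -/
def sigB (i : Fin 3) : CDerEnd R :=
  CDerEnd.ofEnd ((LinearMap.proj 0).smulRight (th i.succ) + (LinearMap.proj i.succ).smulRight (th 0))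
    ⟨0, fun v w => by fin_cases i <;> simp [confForm, th]⟩

/-- `σᵢⱼ`: `θⱼ ↦ θᵢ`, `θᵢ ↦ -θⱼ`, zero on the other basis elements (and zero if `i = j`). -/
def sigR (i j : Fin 3) : CDerEnd R :=
  CDerEnd.ofEnd ((LinearMap.proj j.succ).smulRight (th i.succ) -
      (LinearMap.proj i.succ).smulRight (th j.succ))
    ⟨0, fun v w => by
      fin_cases i <;> fin_cases j <;> simp [confForm, th]⟩

/-- The decomposition `W = W₀ ⊕ W₁` for the axis `i`:
`W₀` is spanned by `θ₀` and `θᵢ`, and `W₁` by the other two basis elements. -/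
def par (i : Fin 3) (a : Fin 4) : ZMod 2 := if a = 0 ∨ a = i.succ then 0 else 1

/-- The summand `W_e`. -/
def wPart (R : Type u) [CommRing R] (i : Fin 3) (e : ZMod 2) : Submodule R (WMod R) :=
  Submodule.span R {w | ∃ a, par i a = e ∧ w = Pi.single a 1}

/-- The span of the products of elements of `W` with exactly `k` factors from `W₁` and any number of
factors from `W₀`. -/
def wedgeBi (R : Type u) [CommRing R] (i : Fin 3) (k : ℕ) : Submodule R (Wedge R) :=
  ⨆ m : ℕ, ((wPart R i 0).map (ExteriorAlgebra.ι R)) ^ m * ((wPart R i 1).map (ExteriorAlgebra.ι R)) ^ k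

/-- `F_{◁p}(∧W)`. -/
def wedgeF (R : Type u) [CommRing R] (i : Fin 3) (p : ℕ) : Submodule R (Wedge R) :=
  ⨆ k : ℕ, ⨆ _ : k ≤ p ∧ k % 2 = p % 2, wedgeBi R i k

/-- `F_{◁p}(∧W ⊗ Ω)`. -/
def omegaF (R : Type u) [CommRing R] [Algebra ℝ R] (i : Fin 3) (p : ℕ) :
    Submodule R (Wedge R ⊗[R] Om R) :=
  Submodule.span R {x | ∃ η ∈ wedgeF R i p, ∃ z : Om R, x = η ⊗ₜ z}

/-- The even and odd parts of `∧W`. -/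
def wedgePar (R : Type u) [CommRing R] (i : Fin 3) (e : ZMod 2) : Submodule R (Wedge R) :=
  ⨆ k : ℕ, ⨆ _ : (k : ZMod 2) = e, wedgeBi R i k

/-- `δ ∈ CDerEnd(W)` is even (odd) if it preserves (exchanges) `W₀` and `W₁`. -/
def IsDerPar (i : Fin 3) (e : ZMod 2) (δ : CDerEnd R) : Prop :=
  ∀ c, ∀ w ∈ wPart R i c, δ.op w ∈ wPart R i (c + e)

/-- The `ℤ₂`-grading of `𝓔`. -/
def ePar (R : Type u) [CommRing R] [Algebra ℝ R] (i : Fin 3) (e : ZMod 2) : Submodule ℝ (EAlg R) :=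
  Submodule.span ℝ {x | ∃ a b, a + b = e ∧ ∃ ω ∈ wedgePar R i a, ∃ δ : CDerEnd R,
    IsDerPar i b δ ∧ x = mkE (ω ⊗ₜ δ)}

/-- `F_{◁p}𝓔`, induced by the representation on `∧W` and `∧W ⊗ Ω`. -/
def eF (R : Type u) [CommRing R] [Algebra ℝ R] (i : Fin 3) (p : ℕ) : Submodule ℝ (EAlg R) where
  carrier := {x | x ∈ ePar R i p ∧ ∀ q, (∀ η ∈ wedgeF R i q, repW x η ∈ wedgeF R i (q + p)) ∧
    ∀ ζ ∈ omegaF R i q, repOm x ζ ∈ omegaF R i (q + p)}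
  zero_mem' := ⟨zero_mem _, fun q => ⟨fun η _ => by simp, fun ζ _ => by simp⟩⟩
  add_mem' := fun hx hy => ⟨add_mem hx.1 hy.1, fun q =>
    ⟨fun η h => by
      rw [map_add, LinearMap.add_apply]; exact add_mem ((hx.2 q).1 η h) ((hy.2 q).1 η h),
     fun ζ h => by
      rw [map_add, LinearMap.add_apply]; exact add_mem ((hx.2 q).2 ζ h) ((hy.2 q).2 ζ h)⟩⟩
  smul_mem' := fun c x hx => ⟨Submodule.smul_mem _ c hx.1, fun q =>
    ⟨fun η h => by
      rw [map_smul, LinearMap.smul_apply]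
      exact Submodule.smul_of_tower_mem _ c ((hx.2 q).1 η h),
     fun ζ h => by
      rw [map_smul, LinearMap.smul_apply]
      exact Submodule.smul_of_tower_mem _ c ((hx.2 q).2 ζ h)⟩⟩

/-- `F_p𝓔 = F_{◁p}𝓔 ⊕ F_{◁p-1}𝓔`, where `F_{◁-1}𝓔 = 0`. -/
def eFil (R : Type u) [CommRing R] [Algebra ℝ R] (i : Fin 3) : ℕ → Submodule ℝ (EAlg R)
  | 0 => eF R i 0
  | p + 1 => eF R i (p + 1) ⊔ eF R i p

/-- The degree `k` part of `F_p𝓔`, for the axis `i`. -/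
def bklAxis (R : Type u) [CommRing R] [Algebra ℝ R] (i : Fin 3) (p : ℕ) (k : ℤ) :
    Submodule ℝ ((gE R).V k) :=
  (eFil R i p).comap (degE R k).subtype

/-- The `1`-index BKL filtration for the axis `i`. -/
def bkl1 (R : Type u) [CommRing R] [Algebra ℝ R] (i : Fin 3) (n : Fin 1 →₀ ℕ) (k : ℤ) :
    Submodule ℝ ((gE R).V k) := bklAxis R i (n 0) k

/-- The `2`-index BKL filtration. -/
def bkl2 (R : Type u) [CommRing R] [Algebra ℝ R] (n : Fin 2 →₀ ℕ) (k : ℤ) :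
    Submodule ℝ ((gE R).V k) := bklAxis R 1 (n 0) k ⊓ bklAxis R 2 (n 1) k

/-- The `3`-index BKL filtration. -/
def bkl3 (R : Type u) [CommRing R] [Algebra ℝ R] (n : Fin 3 →₀ ℕ) (k : ℤ) :
    Submodule ℝ ((gE R).V k) := bklAxis R 0 (n 0) k ⊓ bklAxis R 1 (n 1) k ⊓ bklAxis R 2 (n 2) k

end

section
variable {R R' : Type u} [CommRing R] [Algebra ℝ R] [CommRing R'] [Algebra ℝ R']
open CDerEnd

/-- The semilinear isomorphism `∑ f_a θ_a ↦ ∑ c τ(f_a) θ_a`. -/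
def wPull (τ : R' ≃ₐ[ℝ] R) (c : Rˣ) : WMod R' ≃ₗ[ℝ] WMod R where
  toFun w a := c * τ (w a)
  invFun v a := τ.symm (c⁻¹.1 * v a)
  left_inv w := by ext a; simp
  right_inv w := by ext a; simp
  map_add' v w := by ext a; simp [mul_add]
  map_smul' r w := by ext a; simp

theorem wPull_smul (τ : R' ≃ₐ[ℝ] R) (c : Rˣ) (f : R') (w : WMod R') :
    wPull τ c (f • w) = τ f • wPull τ c w := by
  ext a; simp [wPull, mul_left_comm]

theorem wPull_symm_smul (τ : R' ≃ₐ[ℝ] R) (c : Rˣ) (f : R) (v : WMod R) :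
    (wPull τ c).symm (f • v) = τ.symm f • (wPull τ c).symm v := by
  apply (wPull τ c).injective
  rw [wPull_smul]; simp

theorem confForm_wPull (τ : R' ≃ₐ[ℝ] R) (c : Rˣ) (v w : WMod R') :
    confForm (wPull τ c v) (wPull τ c w) = c * c * τ (confForm v w) := by
  simp [confForm, wPull]; ring

/-- The vector field `τ ∘ X ∘ τ⁻¹`. -/
def vecPull (τ : R' ≃ₐ[ℝ] R) (X : Derivation ℝ R' R') : Derivation ℝ R R :=
  Derivation.mk' (τ.toLinearMap ∘ₗ X.toLinearMap ∘ₗ τ.symm.toLinearMap) (fun f g => by simp)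

theorem vecPull_apply (τ : R' ≃ₐ[ℝ] R) (X : Derivation ℝ R' R') (f : R) :
    vecPull τ X f = τ (X (τ.symm f)) := rfl

/-- The element `Ψ ∘ δ ∘ Ψ⁻¹`, where `Ψ` is the semilinear isomorphism `wPull`. -/
def derPull (τ : R' ≃ₐ[ℝ] R) (c : Rˣ) (δ : CDerEnd R') : CDerEnd R :=
  ⟨(vecPull τ δ.anchor, (wPull τ c).toLinearMap ∘ₗ δ.op ∘ₗ (wPull τ c).symm.toLinearMap),
    fun f w => by
      simp [wPull_smul, wPull_symm_smul, CDerEnd.op_smul, vecPull_apply], by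
      obtain ⟨l, hl⟩ := δ.2.2
      change ∀ v w, δ.anchor _ + _ = confForm (δ.op v) w + confForm v (δ.op w) at hl
      refine ⟨τ l - 2 * c⁻¹.1 * vecPull τ δ.anchor c, fun v w => ?_⟩
      obtain ⟨v, rfl⟩ := (wPull τ c).surjective v
      obtain ⟨w, rfl⟩ := (wPull τ c).surjective w
      have e := congrArg τ (hl v w)
      have u := c.mul_inv
      simp only [LinearMap.comp_apply, LinearEquiv.coe_coe, LinearEquiv.symm_apply_apply,
        confForm_wPull, Derivation.leibniz, smul_eq_mul]
      have h2 : vecPull τ δ.anchor (τ (confForm v w)) = τ (δ.anchor (confForm v w)) := by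
        simp [vecPull_apply]
      rw [h2]
      rw [map_add, map_add, map_mul] at e
      linear_combination c.1 * c.1 * e - 2 * c.1 * vecPull τ δ.anchor c * τ (confForm v w) * u⟩

/-- The algebra `∧W` as an `R'`-algebra through `τ`. -/
def TwWedge (_τ : R' ≃ₐ[ℝ] R) : Type u := Wedge R

instance (τ : R' ≃ₐ[ℝ] R) : Ring (TwWedge τ) := inferInstanceAs (Ring (Wedge R))

instance (τ : R' ≃ₐ[ℝ] R) : Algebra R' (TwWedge τ) :=
  RingHom.toAlgebra' (R := R') (S := TwWedge τ)
    ((algebraMap R (Wedge R)).comp (τ : R' →+* R)) (fun r x => Algebra.commutes (A := Wedge R) (τ r) x)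

theorem smul_twWedge (τ : R' ≃ₐ[ℝ] R) (f : R') (x : TwWedge τ) :
    f • x = (τ f • (show Wedge R from x) : Wedge R) := by
  rw [Algebra.smul_def, Algebra.smul_def]; rfl

/-- The unital ring homomorphism `∧W' → ∧W` that extends `τ` and `wPull`. -/
def wedgePull (τ : R' ≃ₐ[ℝ] R) (c : Rˣ) : Wedge R' →+* Wedge R :=
  ((ExteriorAlgebra.lift R' (A := TwWedge τ)
    ⟨{ toFun := fun w => ExteriorAlgebra.ι R (wPull τ c w)
       map_add' := fun v w => by rw [map_add, map_add]; rfl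
       map_smul' := fun f w => by
         rw [wPull_smul, map_smul]; exact (smul_twWedge τ f _).symm },
      fun w => ExteriorAlgebra.ι_sq_zero _⟩ : Wedge R' →ₐ[R'] TwWedge τ) : Wedge R' →+* TwWedge τ)

theorem wedgePull_algebraMap (τ : R' ≃ₐ[ℝ] R) (c : Rˣ) (f : R') :
    wedgePull τ c (algebraMap R' _ f) = algebraMap R _ (τ f) :=
  AlgHom.commutes (B := TwWedge τ) _ f

theorem wedgePull_ι (τ : R' ≃ₐ[ℝ] R) (c : Rˣ) (w : WMod R') :
    wedgePull τ c (ExteriorAlgebra.ι R' w) = ExteriorAlgebra.ι R (wPull τ c w) :=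
  ExteriorAlgebra.lift_ι_apply R' (A := TwWedge τ) _ _ w

theorem wedgePull_mem (τ : R' ≃ₐ[ℝ] R) (c : Rˣ) {n : ℕ} {ω : Wedge R'} (h : ω ∈ ⋀[R']^n (WMod R')) :
    wedgePull τ c ω ∈ ⋀[R]^n (WMod R) := by
  induction h using Submodule.pow_induction_on_left' with
  | algebraMap r =>
    rw [wedgePull_algebraMap]; exact Submodule.algebraMap_mem _
  | add x y i hx hy ihx ihy => rw [map_add]; exact add_mem ihx ihy
  | mem_mul m hm i x hx ih =>
    obtain ⟨v, rfl⟩ := hm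
    rw [map_mul, wedgePull_ι]
    have e : i.succ = 1 + i := by omega
    rw [e]
    exact SetLike.mul_mem_graded (ι_mem_one _) ih

/-- The restriction of `wedgePull` to `∧ⁿW'`. -/
def wedgePullN (τ : R' ≃ₐ[ℝ] R) (c : Rˣ) {n : ℕ} (ω : ⋀[R']^n (WMod R')) : ⋀[R]^n (WMod R) :=
  ⟨wedgePull τ c ω.1, wedgePull_mem τ c ω.2⟩

end

section Geometry
open scoped Manifold ContDiff

/-- Euclidean three-space. -/
abbrev E3 : Type := EuclideanSpace ℝ (Fin 3)

/-- The base manifold `ℝ × S` of an object, encoded by a manifold `S` diffeomorphic to `ℝ³`. -/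
structure Base : Type (u + 1) where
  S : Type u
  [top : TopologicalSpace S]
  [charted : ChartedSpace E3 S]
  [mfd : IsManifold 𝓘(ℝ, E3) ∞ S]
  diffeo : Nonempty (S ≃ₘ⟮𝓘(ℝ, E3), 𝓘(ℝ, E3)⟯ E3)

attribute [instance] Base.top Base.charted Base.mfd

namespace Base

/-- The real algebra of smooth functions on `S`. -/
abbrev CS (B : Base.{u}) : Type u := C^∞⟮𝓘(ℝ, E3), B.S; 𝓘(ℝ, ℝ), ℝ⟯

/-- The real algebra `C^∞` of smooth functions on `ℝ × S`. -/
abbrev CM (B : Base.{u}) : Type u := C^∞⟮𝓘(ℝ, ℝ).prod 𝓘(ℝ, E3), ℝ × B.S; 𝓘(ℝ, ℝ), ℝ⟯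

variable (B : Base.{u})

/-- The function `t` on `ℝ × S`. -/
def t : B.CM := ⟨Prod.fst, contMDiff_fst⟩

/-- The pullback of functions along `ℝ × S → S`. -/
def pr : B.CS →ₐ[ℝ] B.CM where
  toFun g := ⟨fun p => g p.2, g.2.comp contMDiff_snd⟩
  map_zero' := rfl
  map_one' := rfl
  map_add' _ _ := rfl
  map_mul' _ _ := rfl
  commutes' _ := rfl

theorem contMDiff_dt (f : B.CM) :
    ContMDiff (𝓘(ℝ, ℝ).prod 𝓘(ℝ, E3)) 𝓘(ℝ, ℝ) ∞
      (fun p : ℝ × B.S => deriv (fun s => f (s, p.2)) p.1) := by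
  intro p₀
  have h := ContMDiffAt.mfderiv_apply (I := 𝓘(ℝ, ℝ)) (I' := 𝓘(ℝ, ℝ))
    (J := 𝓘(ℝ, ℝ).prod 𝓘(ℝ, E3)) (J' := 𝓘(ℝ, ℝ).prod 𝓘(ℝ, E3)) (x₀ := p₀)
    (m := ∞) (n := ∞)
    (fun (p : ℝ × B.S) (s : ℝ) => f (s, p.2)) (fun p => p.1) (fun p => p) (fun _ => (1 : ℝ))
    ?_ contMDiffAt_fst contMDiffAt_id contMDiffAt_const (by simp)
  · refine h.congr_of_eventuallyEq (Filter.Eventually.of_forall fun p => ?_)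
    have e := congrFun (inTangentCoordinates_model_space (I := 𝓘(ℝ, ℝ)) (I' := 𝓘(ℝ, ℝ))
      (fun p : ℝ × B.S => p.1) (fun p => f (p.1, p.2))
      (fun x => mfderiv 𝓘(ℝ, ℝ) 𝓘(ℝ, ℝ) (fun s => f (s, x.2)) x.1) p₀) p
    refine Eq.trans ?_ (congrArg (fun L : ℝ →L[ℝ] ℝ => L 1) e).symm
    change _ = (mfderiv 𝓘(ℝ, ℝ) 𝓘(ℝ, ℝ) (fun s => f (s, p.2)) p.1 : ℝ →L[ℝ] ℝ) 1
    rw [mfderiv_eq_fderiv]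
    exact (fderiv_apply_one_eq_deriv (f := fun s => f (s, p.2)) (x := p.1)).symm
  · exact (f.2.comp (contMDiff_snd.prodMk (contMDiff_snd.comp contMDiff_fst))).contMDiffAt

theorem hasDerivAt_dt (f : B.CM) (p : ℝ × B.S) :
    HasDerivAt (fun s => f (s, p.2)) (deriv (fun s => f (s, p.2)) p.1) p.1 := by
  have h : ContMDiff 𝓘(ℝ, ℝ) 𝓘(ℝ, ℝ) ∞ (fun s => f (s, p.2)) :=
    f.2.comp (contMDiff_id.prodMk contMDiff_const)
  exact ((h.contDiff.differentiable (by simp)) _).hasDerivAt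

/-- The partial derivative `D₀ = ∂/∂t`. -/
def D0 : Derivation ℝ B.CM B.CM :=
  Derivation.mk'
    { toFun := fun f => ⟨fun p => deriv (fun s => f (s, p.2)) p.1, B.contMDiff_dt f⟩
      map_add' := fun f g => by
        ext p
        exact ((B.hasDerivAt_dt f p).add (B.hasDerivAt_dt g p)).deriv
      map_smul' := fun c f => by
        ext p
        exact ((B.hasDerivAt_dt f p).const_mul c).deriv }
    (fun f g => by
      ext p
      refine ((B.hasDerivAt_dt f p).mul (B.hasDerivAt_dt g p)).deriv.trans ?_
      exact (add_comm _ _).trans (congrArg (f p * deriv (fun s => g (s, p.2)) p.1 + ·)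
        (mul_comm _ _)))

/-- `Y` extends `X ∈ Der(C^∞(S))` to `ℝ × S` by `Y(t) = 0`. -/
def IsExt (X : Derivation ℝ B.CS B.CS) (Y : Derivation ℝ B.CM B.CM) : Prop :=
  Y B.t = 0 ∧ ∀ g, Y (B.pr g) = B.pr (X g)

/-- A morphism: smooth functions `a, b, c` on `S` with `a, c > 0`, and a diffeomorphism `φ`. -/
@[ext]
structure Hom (B B' : Base.{u}) : Type u where
  a : B.CS
  b : B.CS
  c : B.CS
  a_pos : ∀ x, 0 < a x
  c_pos : ∀ x, 0 < c x
  φ : B.S ≃ₘ⟮𝓘(ℝ, E3), 𝓘(ℝ, E3)⟯ B'.S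

/-- The pullback of functions along a diffeomorphism. -/
def pb {B B' : Base.{u}} (φ : B.S ≃ₘ⟮𝓘(ℝ, E3), 𝓘(ℝ, E3)⟯ B'.S) (g : B'.CS) : B.CS :=
  ⟨fun x => g (φ x), g.2.comp φ.contMDiff⟩

/-- The reciprocal of a positive function. -/
def recip {B : Base.{u}} (a : B.CS) (h : ∀ x, 0 < a x) : B.CS :=
  ⟨fun x => (a x)⁻¹, ContMDiff.inv₀ a.2 (fun x => (h x).ne')⟩

theorem cs_mul {B : Base.{u}} (f g : B.CS) (x : B.S) : (f * g) x = f x * g x := rfl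
theorem cs_add {B : Base.{u}} (f g : B.CS) (x : B.S) : (f + g) x = f x + g x := rfl
theorem cs_neg {B : Base.{u}} (f : B.CS) (x : B.S) : (-f) x = -(f x) := rfl
theorem cs_one {B : Base.{u}} (x : B.S) : (1 : B.CS) x = 1 := rfl
theorem cs_zero {B : Base.{u}} (x : B.S) : (0 : B.CS) x = 0 := rfl
theorem pb_apply {B B' : Base.{u}} (φ : B.S ≃ₘ⟮𝓘(ℝ, E3), 𝓘(ℝ, E3)⟯ B'.S) (g : B'.CS) (x : B.S) :
    pb φ g x = g (φ x) := rfl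
theorem recip_apply {B : Base.{u}} (a : B.CS) (h : ∀ x, 0 < a x) (x : B.S) :
    recip a h x = (a x)⁻¹ := rfl

instance : Groupoid Base.{u} where
  Hom := Hom
  id B := ⟨1, 0, 1, fun _ => one_pos, fun _ => one_pos, Diffeomorph.refl _ _ _⟩
  comp f g := ⟨f.a * pb f.φ g.a, pb f.φ g.a * f.b + pb f.φ g.b, f.c * pb f.φ g.c,
    fun x => mul_pos (f.a_pos x) (g.a_pos _), fun x => mul_pos (f.c_pos x) (g.c_pos _),
    f.φ.trans g.φ⟩
  inv f := ⟨pb f.φ.symm (recip f.a f.a_pos), pb f.φ.symm (-(recip f.a f.a_pos * f.b)),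
    pb f.φ.symm (recip f.c f.c_pos), fun x => inv_pos.2 (f.a_pos _), fun x => inv_pos.2 (f.c_pos _),
    f.φ.symm⟩
  id_comp f := by
    refine Hom.ext ?_ ?_ ?_ ?_ <;> ext x <;>
      simp [cs_mul, cs_add, cs_one, cs_zero, pb_apply]
  comp_id f := by
    refine Hom.ext ?_ ?_ ?_ ?_ <;> ext x <;>
      simp [cs_mul, cs_add, cs_one, cs_zero, pb_apply]
  assoc f g h := by
    refine Hom.ext (mul_assoc _ _ _) ?_ (mul_assoc _ _ _) rfl
    ext x
    simp only [cs_mul, cs_add, pb_apply, Diffeomorph.coe_trans, Function.comp_apply]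
    ring
  inv_comp f := by
    refine Hom.ext ?_ ?_ ?_ ?_ <;> ext x <;>
      simp [cs_mul, cs_add, cs_neg, cs_one, cs_zero, pb_apply, recip_apply, (f.a_pos _).ne',
        (f.c_pos _).ne']
  comp_inv f := by
    refine Hom.ext ?_ ?_ ?_ ?_ <;> ext x <;>
      simp [cs_mul, cs_add, cs_neg, cs_one, cs_zero, pb_apply, recip_apply, (f.a_pos _).ne',
        (f.c_pos _).ne']

theorem comp_a {B B' B'' : Base.{u}} (f : B ⟶ B') (g : B' ⟶ B'') (x : B.S) :
    Hom.a (f ≫ g) x = Hom.a f x * Hom.a g (Hom.φ f x) := rfl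

variable {B} {B' : Base.{u}}

/-- The diffeomorphism `Φ(t, x) = (a(x)t + b(x), φ(x))`. -/
def Phi (f : B ⟶ B') : (ℝ × B.S) ≃ₘ⟮𝓘(ℝ, ℝ).prod 𝓘(ℝ, E3), 𝓘(ℝ, ℝ).prod 𝓘(ℝ, E3)⟯ (ℝ × B'.S) where
  toFun p := (Hom.a f p.2 * p.1 + Hom.b f p.2, Hom.φ f p.2)
  invFun p := ((Hom.a f ((Hom.φ f).symm p.2))⁻¹ * (p.1 - Hom.b f ((Hom.φ f).symm p.2)),
    (Hom.φ f).symm p.2)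
  left_inv p := by
    have := (Hom.a_pos f p.2).ne'
    refine Prod.ext ?_ (by simp)
    simp [this]
  right_inv p := by
    have := (Hom.a_pos f ((Hom.φ f).symm p.2)).ne'
    refine Prod.ext ?_ (by simp)
    simp [this]
  contMDiff_toFun := by
    have ha := (Hom.a f).2.comp (contMDiff_snd (I := 𝓘(ℝ, ℝ)) (M := ℝ) (J := 𝓘(ℝ, E3)) (N := B.S) (n := ∞))
    have hb := (Hom.b f).2.comp (contMDiff_snd (I := 𝓘(ℝ, ℝ)) (M := ℝ) (J := 𝓘(ℝ, E3)) (N := B.S) (n := ∞))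
    exact ((ha.mul contMDiff_fst).add hb).prodMk ((Hom.φ f).contMDiff.comp contMDiff_snd)
  contMDiff_invFun := by
    have hs := (Hom.φ f).symm.contMDiff.comp
      (contMDiff_snd (I := 𝓘(ℝ, ℝ)) (M := ℝ) (J := 𝓘(ℝ, E3)) (N := B'.S) (n := ∞))
    have ha := (recip (Hom.a f) (Hom.a_pos f)).2.comp hs
    have hb := (Hom.b f).2.comp hs
    exact (ha.mul (contMDiff_fst.sub hb)).prodMk hs

/-- The pullback `Φ^*` of functions. -/
def tau (f : B ⟶ B') : B'.CM ≃ₐ[ℝ] B.CM where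
  toFun g := ⟨fun p => g (Phi f p), g.2.comp (Phi f).contMDiff⟩
  invFun g := ⟨fun p => g ((Phi f).symm p), g.2.comp (Phi f).symm.contMDiff⟩
  left_inv g := by ext p; exact congrArg g ((Phi f).apply_symm_apply p)
  right_inv g := by ext p; exact congrArg g ((Phi f).symm_apply_apply p)
  map_mul' _ _ := rfl
  map_add' _ _ := rfl
  commutes' _ := rfl

/-- The function `c`, as a unit of the algebra of smooth functions on `ℝ × S`. -/
def cUnit (f : B ⟶ B') : B.CMˣ where
  val := B.pr (Hom.c f)
  inv := B.pr (recip (Hom.c f) (Hom.c_pos f))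
  val_inv := by
    rw [← map_mul, ← map_one B.pr]
    exact congrArg B.pr (by ext x; exact mul_inv_cancel₀ (Hom.c_pos f x).ne')
  inv_val := by
    rw [← map_mul, ← map_one B.pr]
    exact congrArg B.pr (by ext x; exact inv_mul_cancel₀ (Hom.c_pos f x).ne')

end Base

end Geometry

section Final

/-- A functor with prescribed action on objects. -/
structure FunctorOn {C D : Type*} [Category C] [Category D] (obj : C → D) where
  map : ∀ {X Y : C}, (X ⟶ Y) → (obj X ⟶ obj Y)
  map_id : ∀ X, map (𝟙 X) = 𝟙 (obj X)
  map_comp : ∀ {X Y Z : C} (f : X ⟶ Y) (g : Y ⟶ Z), map (f ≫ g) = map f ≫ map g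

/-- The real graded Lie algebra `𝓔` of an object. -/
abbrev Base.gE (B : Base.{u}) : GLA.{u} := BKL.gE B.CM

/-- The map `W' → W`, `∑ f_a θ_a ↦ ∑ c (f_a ∘ Φ) θ_a`, of a morphism. -/
def Base.Psi {B B' : Base.{u}} (f : B ⟶ B') : WMod B'.CM ≃ₗ[ℝ] WMod B.CM :=
  wPull (Base.tau f) (Base.cUnit f)

/-- The map `∧ⁿW' → ∧ⁿW` induced by `Psi`. -/
def Base.wedgeMap {B B' : Base.{u}} (f : B ⟶ B') {n : ℕ} (ω : ⋀[B'.CM]^n (WMod B'.CM)) :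
    ⋀[B.CM]^n (WMod B.CM) :=
  wedgePullN (Base.tau f) (Base.cUnit f) ω

/-- The map `δ ↦ Ψ ∘ δ ∘ Ψ⁻¹`, `CDerEnd(W') → CDerEnd(W)`, induced by `Psi`. -/
def Base.derMap {B B' : Base.{u}} (f : B ⟶ B') (δ : CDerEnd B'.CM) : CDerEnd B.CM :=
  derPull (Base.tau f) (Base.cUnit f) δ

/-- `D₀` as an element of `CDerEnd(W)`. -/
def Base.D0hat (B : Base.{u}) : CDerEnd B.CM := CDerEnd.lift B.D0

/-- `u` maps `G` to `H` as filtered algebras as follows: the isomorphism of formal power series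
induced by `u` restricts to an isomorphism of Rees algebras, which induces an isomorphism of
associated gradeds. -/
def InducesIsos {σ : Type} [DecidableEq σ] (G H : FiltGLA.{u} σ) (u : G.toGLA ⟶ H.toGLA) : Prop :=
  IsIso (GLA.powerSeriesMap σ u) ∧
  ∃ (p : FiltGLA.rees G ≅ FiltGLA.rees H) (q : FiltGLA.gr G ≅ FiltGLA.gr H),
    p.hom ≫ FiltGLA.reesIncl H = FiltGLA.reesIncl G ≫ GLA.powerSeriesMap σ u ∧
    p.hom ≫ FiltGLA.grProj H = FiltGLA.grProj G ≫ q.hom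

end Final

end BKL

end

open BKL CategoryTheory

noncomputable section

namespace BKL

open CDerEnd

/-! Everything that goes into `𝓔` is natural under semilinear conformal isomorphisms. Let `τ : R' ≃
R` be an isomorphism of function algebras and `Ψ : W' → W` a bijection over `τ` that rescales the
form by an invertible function. Then `Ψ` extends to a ring homomorphism `λ` of exterior algebras and
acts on `CDerEnd` by conjugation. The two are compatible (`wedge_wact`), so `ω ⊗ δ ↦ λ(ω) ⊗ ΨδΨ⁻¹`
respects brackets, and it carries Weyl tensors to Weyl tensors (`isWeylTensor`), hence descends to
`𝓔`. A morphism of the groupoid gives `τ = Φ^*` and `Ψ = cΦ^*`, and functoriality of `𝓔` reduces to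
the composition rules of `Φ` and `Ψ`.

The factors `c_a` of `DiagIso` may differ as long as their squares agree. This admits a second
example besides the morphisms: the reflection `refl₁` that is `1` on `W₀` and `-1` on `W₁`. Since
`2` is invertible, every `ℤ₂`-grading in play is the eigenspace decomposition of this reflection
(`mem_wPart`, `isDerPar_iff`, `mem_wedgePar`, `mem_ePar`), so parity statements become equations
between maps.

The BKL spaces are multiplicative because `𝓔` acts on `∧W` and `∧W ⊗ Ω` by graded commutators
(`repW_brE`, `repOm_brE`), and shifts of filtration degree add under composition. They are
exhaustive because `W₁` has rank two: for `p ≥ 1` the space `F_{◁p}(∧W)` is the whole part of parity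
`p` (`wedgePar_le_wedgeF`), so only parity is left to check. On `∧W ⊗ Ω` this also needs that odd
derivations annihilate `Ω` (`isSO_of_odd`). Hence `F_2 = 𝓔` (`eFil_two`). The filtrations are
invariant because a diagonal `Ψ` and its inverse both preserve `W₀` and `W₁` (`E_mem_eF`). Rees
algebras and associated gradeds are functors of filtered algebras, so they turn isomorphisms into
isomorphisms.

For the explicit formulas, a derivation of `C^∞(ℝ × S)` is determined by its values on `t` and on
functions pulled back from `S` (`derivation_ext`). As `S` has global coordinates, this follows from
Hadamard's lemma. The transported vector fields are then identified by testing on these functions,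
and conjugation with the factor `c` adds the term in `σ₀` (`derPull_lift`). -/

/-- Data of a semilinear conformal isomorphism `W' → W`, `∑ f_a θ_a ↦ ∑ c_a τ(f_a) θ_a`. -/
structure DiagIso (R' R : Type u) [CommRing R] [Algebra ℝ R] [CommRing R'] [Algebra ℝ R'] where
  τ : R' ≃ₐ[ℝ] R
  c : Fin 4 → Rˣ
  sq : ∀ a, (c a : R) * c a = c 0 * c 0

/-! ### Naturality of `𝓔` under diagonal semilinear conformal isomorphisms. -/

namespace DiagIso

variable {R R' R'' : Type u} [CommRing R] [Algebra ℝ R] [CommRing R'] [Algebra ℝ R']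
  [CommRing R''] [Algebra ℝ R'']

/-- The semilinear isomorphism `∑ f_a θ_a ↦ ∑ c_a τ(f_a) θ_a`. -/
def W (d : DiagIso R' R) : WMod R' ≃ₗ[ℝ] WMod R where
  toFun w a := d.c a * d.τ (w a)
  invFun v a := d.τ.symm ((d.c a)⁻¹.1 * v a)
  left_inv w := by ext a; simp
  right_inv w := by ext a; simp
  map_add' v w := by ext a; simp [mul_add]
  map_smul' r w := by ext a; simp

variable (d : DiagIso R' R)

theorem W_apply (w : WMod R') (a : Fin 4) : d.W w a = d.c a * d.τ (w a) := rfl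

theorem W_smul (f : R') (w : WMod R') : d.W (f • w) = d.τ f • d.W w := by
  ext a; simp [W_apply, mul_left_comm]

theorem W_symm_smul (f : R) (v : WMod R) :
    d.W.symm (f • v) = d.τ.symm f • d.W.symm v := by
  apply d.W.injective
  rw [W_smul]; simp

theorem W_th (a : Fin 4) : d.W (th a) = (d.c a : R) • th a := by
  ext b
  by_cases h : b = a
  · subst h; simp [W_apply, th]
  · simp [W_apply, th, h]

theorem W_symm_th (a : Fin 4) : d.W.symm (th a) = d.τ.symm ((d.c a)⁻¹.1) • th a := by
  apply d.W.injective
  rw [W_smul, W_th, smul_smul]; simp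

theorem confForm_W (v w : WMod R') :
    confForm (d.W v) (d.W w) = d.c 0 * d.c 0 * d.τ (confForm v w) := by
  simp only [confForm, W_apply, map_add, map_neg, map_mul]
  linear_combination (d.τ (v 1) * d.τ (w 1)) * d.sq 1 + (d.τ (v 2) * d.τ (w 2)) * d.sq 2 +
    (d.τ (v 3) * d.τ (w 3)) * d.sq 3

/-- The element `Ψ ∘ δ ∘ Ψ⁻¹`. -/
def der (δ : CDerEnd R') : CDerEnd R :=
  ⟨(vecPull d.τ δ.anchor, d.W.toLinearMap ∘ₗ δ.op ∘ₗ d.W.symm.toLinearMap),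
    fun f w => by
      simp [W_smul, W_symm_smul, CDerEnd.op_smul, vecPull_apply], by
      obtain ⟨l, hl⟩ := δ.2.2
      change ∀ v w, δ.anchor _ + _ = confForm (δ.op v) w + confForm v (δ.op w) at hl
      -- The form is rescaled by `c₀²`; its derivative `2c₀X(c₀)` has to be compensated in the
      -- conformal factor, relative to `c₀²`.
      refine ⟨d.τ l - 2 * (d.c 0)⁻¹.1 * vecPull d.τ δ.anchor (d.c 0), fun v w => ?_⟩
      obtain ⟨v, rfl⟩ := d.W.surjective v
      obtain ⟨w, rfl⟩ := d.W.surjective w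
      have e := congrArg d.τ (hl v w)
      have u := (d.c 0).mul_inv
      simp only [LinearMap.comp_apply, LinearEquiv.coe_coe, LinearEquiv.symm_apply_apply,
        confForm_W, Derivation.leibniz, smul_eq_mul]
      have h2 : vecPull d.τ δ.anchor (d.τ (confForm v w)) = d.τ (δ.anchor (confForm v w)) := by
        simp [vecPull_apply]
      rw [h2]
      rw [map_add, map_add, map_mul] at e
      linear_combination (d.c 0).1 * (d.c 0).1 * e
        - 2 * (d.c 0).1 * vecPull d.τ δ.anchor (d.c 0) * d.τ (confForm v w) * u⟩

theorem der_op (δ : CDerEnd R') (w : WMod R) : (d.der δ).op w = d.W (δ.op (d.W.symm w)) := rfl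

theorem der_anchor (δ : CDerEnd R') (f : R) : (d.der δ).anchor f = d.τ (δ.anchor (d.τ.symm f)) := rfl

theorem der_op_W (δ : CDerEnd R') (w : WMod R') : (d.der δ).op (d.W w) = d.W (δ.op w) := by
  rw [der_op, LinearEquiv.symm_apply_apply]

theorem der_anchor_τ (δ : CDerEnd R') (f : R') : (d.der δ).anchor (d.τ f) = d.τ (δ.anchor f) := by
  rw [der_anchor, AlgEquiv.symm_apply_apply]

theorem der_add (δ ε : CDerEnd R') : d.der (δ + ε) = d.der δ + d.der ε :=
  CDerEnd.ext' (fun f => by simp [der_anchor]) (fun w => by simp [der_op])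

theorem der_smul (f : R') (δ : CDerEnd R') : d.der (f • δ) = d.τ f • d.der δ :=
  CDerEnd.ext' (fun g => by simp [der_anchor]) (fun w => by simp [der_op, W_smul])

theorem der_comm (δ ε : CDerEnd R') : d.der (comm δ ε) = comm (d.der δ) (d.der ε) :=
  CDerEnd.ext' (fun g => by simp [der_anchor, comm_anchor_apply])
    (fun w => by simp [der_op, comm_op_apply])

/-- The unital ring homomorphism `∧W' → ∧W` that extends `τ` and `Ψ`. -/
def wedge : Wedge R' →+* Wedge R :=
  ((ExteriorAlgebra.lift R' (A := TwWedge d.τ)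
    ⟨{ toFun := fun w => ExteriorAlgebra.ι R (d.W w)
       map_add' := fun v w => by rw [map_add, map_add]; rfl
       map_smul' := fun f w => by
         rw [W_smul, map_smul]; exact (smul_twWedge d.τ f _).symm },
      fun w => ExteriorAlgebra.ι_sq_zero _⟩ : Wedge R' →ₐ[R'] TwWedge d.τ) : Wedge R' →+* TwWedge d.τ)

theorem wedge_algebraMap (f : R') :
    d.wedge (algebraMap R' _ f) = algebraMap R _ (d.τ f) :=
  AlgHom.commutes (B := TwWedge d.τ) _ f

theorem wedge_ι (w : WMod R') :
    d.wedge (ExteriorAlgebra.ι R' w) = ExteriorAlgebra.ι R (d.W w) :=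
  ExteriorAlgebra.lift_ι_apply R' (A := TwWedge d.τ) _ _ w

theorem wedge_smul (f : R') (x : Wedge R') : d.wedge (f • x) = d.τ f • d.wedge x := by
  rw [Algebra.smul_def, map_mul, wedge_algebraMap, Algebra.smul_def]

theorem wedge_real (r : ℝ) (x : Wedge R') : d.wedge (r • x) = r • d.wedge x := by
  have h : ∀ (S : Type u) [CommRing S] [Algebra ℝ S] (y : Wedge S),
      r • y = (algebraMap ℝ S r) • y := fun S _ _ y => by rw [algebraMap_smul]
  rw [h R', wedge_smul, h R, AlgEquiv.commutes]

theorem wedge_mem {n : ℕ} {ω : Wedge R'} (h : ω ∈ ⋀[R']^n (WMod R')) :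
    d.wedge ω ∈ ⋀[R]^n (WMod R) := by
  induction h using Submodule.pow_induction_on_left' with
  | algebraMap r =>
    rw [wedge_algebraMap]; exact Submodule.algebraMap_mem _
  | add x y i hx hy ihx ihy => rw [map_add]; exact add_mem ihx ihy
  | mem_mul m hm i x hx ih =>
    obtain ⟨v, rfl⟩ := hm
    rw [map_mul, wedge_ι]
    have e : i.succ = 1 + i := by omega
    rw [e]
    exact SetLike.mul_mem_graded (ι_mem_one _) ih

/-- Both sides obey the Leibniz rule along `λ`, so agreement on functions and on `W'`, which
generate, suffices. -/
theorem wedge_wact (δ : CDerEnd R') (ω : Wedge R') :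
    d.wedge (wact δ ω) = wact (d.der δ) (d.wedge ω) := by
  induction ω using ExteriorAlgebra.induction with
  | algebraMap r => simp only [wact_algebraMap, wedge_algebraMap, der_anchor_τ]
  | ι x => simp only [wact_ι, wedge_ι, der_op_W]
  | mul a b ha hb => simp only [wact_mul, map_add, map_mul, ha, hb]
  | add a b ha hb => simp only [wact_add, map_add, ha, hb]

/-- The map `ω ⊗ δ ↦ λ(ω) ⊗ ΨδΨ⁻¹`. -/
def L : LAlg R' →ₗ[ℝ] LAlg R :=
  let φ : LAlg R' →+ LAlg R := TensorProduct.liftAddHom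
    (AddMonoidHom.mk' (fun ω => AddMonoidHom.mk' (fun δ => d.wedge ω ⊗ₜ d.der δ)
        (fun a b => by rw [der_add, TensorProduct.tmul_add]))
      (fun a b => by ext δ; simp [TensorProduct.add_tmul]))
    (fun r m n => by
      simp only [AddMonoidHom.mk'_apply, wedge_smul, der_smul, TensorProduct.smul_tmul])
  { φ with
    map_smul' := fun r x => by
      change φ (r • x) = r • φ x
      induction x using TensorProduct.induction_on with
      | zero => simp
      | tmul ω δ =>
        rw [real_smul_tmul]
        change d.wedge (r • ω) ⊗ₜ[R] d.der δ = r • (d.wedge ω ⊗ₜ[R] d.der δ)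
        rw [wedge_real, real_smul_tmul]
      | add x y hx hy => rw [smul_add, map_add, hx, hy, map_add, smul_add] }

theorem L_tmul (ω : Wedge R') (δ : CDerEnd R') : d.L (ω ⊗ₜ δ) = d.wedge ω ⊗ₜ d.der δ := rfl

theorem L_brL (x y : LAlg R') : d.L (brL x y) = brL (d.L x) (d.L y) := by
  induction x using TensorProduct.induction_on with
  | zero => simp
  | add x y hx hy => simp only [map_add, LinearMap.add_apply, hx, hy]
  | tmul ω δ =>
    induction y using TensorProduct.induction_on with
    | zero => simp
    | add x y hx hy => simp only [map_add, hx, hy]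
    | tmul ω' δ' => simp only [brL_tmul, map_add, map_sub, L_tmul, map_mul, wedge_wact, der_comm]

theorem L_wedge_smul (η : Wedge R') (x : LAlg R') : d.L (η • x) = d.wedge η • d.L x := by
  induction x using TensorProduct.induction_on with
  | zero => simp
  | add x y hx hy => simp only [smul_add, map_add, hx, hy]
  | tmul ω δ => rw [wedge_smul_tmul, L_tmul, L_tmul, wedge_smul_tmul, map_mul]

theorem isSO_der {δ : CDerEnd R'} (h : IsSO δ) : IsSO (d.der δ) := by
  refine ⟨fun f => by rw [der_anchor, h.1, map_zero], fun v w => ?_⟩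
  obtain ⟨v, rfl⟩ := d.W.surjective v
  obtain ⟨w, rfl⟩ := d.W.surjective w
  rw [der_op_W, der_op_W, confForm_W, confForm_W, ← mul_add, ← map_add, h.2, map_zero, mul_zero]

theorem wedge_wth (a : Fin 4) : d.wedge (wth a) = (d.c a : R) • wth a := by
  rw [wth, wedge_ι, W_th, map_smul]; rfl

/-- The image of a Weyl tensor. -/
def weyl (A : Fin 4 → Fin 4 → CDerEnd R') (a b : Fin 4) : CDerEnd R :=
  ((d.c a : R) * d.c b) • d.der (A a b)

theorem wedge_wth_mul (a b : Fin 4) :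
    d.wedge (wth a * wth b) = ((d.c a : R) * d.c b) • (wth a * wth b) := by
  rw [map_mul, wedge_wth, wedge_wth, smul_mul_assoc, mul_smul_comm, smul_smul]

theorem L_weylElt (A : Fin 4 → Fin 4 → CDerEnd R') : d.L (weylElt A) = weylElt (d.weyl A) := by
  simp only [weylElt, map_sum, L_tmul, wedge_wth_mul, weyl, TensorProduct.smul_tmul]

/-- The factors `c_a c_b` produced by `λ(θ_aθ_b)` are moved into the coefficients. The Bianchi
identity is then the image under `λ` of the old one, and the trace condition is the image under `Ψ`.
-/
theorem isWeylTensor {A : Fin 4 → Fin 4 → CDerEnd R'} (h : IsWeylTensor A) :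
    IsWeylTensor (d.weyl A) := by
  obtain ⟨h1, h2, h3, h4⟩ := h
  refine ⟨fun a b => (d.isSO_der (h1 a b)).smul _, fun a b => ?_, fun w => ?_, fun a => ?_⟩
  · have : d.der (-A a b) = - d.der (A a b) :=
      CDerEnd.ext' (fun f => by
          change d.τ (-(A a b).anchor (d.τ.symm f)) = -(d.τ ((A a b).anchor (d.τ.symm f)))
          rw [map_neg])
        (fun w => by
          change d.W (-(A a b).op (d.W.symm w)) = -(d.W ((A a b).op (d.W.symm w)))
          rw [map_neg])
    rw [weyl, weyl, h2 a b, this, smul_neg, mul_comm]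
  · obtain ⟨w, rfl⟩ := d.W.surjective w
    have e := congrArg d.wedge (h3 w)
    simp only [map_sum, map_mul d.wedge (_ * _), wedge_ι, wedge_wth_mul, map_zero] at e
    simp only [weyl, op_rsmul, LinearMap.smul_apply, der_op_W, map_smul, mul_smul_comm]
    simpa only [smul_mul_assoc] using e
  · have e := congrArg d.W (h4 a)
    simp only [map_sum, map_zero] at e
    -- `Ψ⁻¹` divides `θ_b` by `c_b`, which cancels the factor `c_b` of the coefficient; the
    -- remaining `c_a` does not depend on the summation index.
    have key : ∀ b, (d.weyl A a b).op (th b) = (d.c a : R) • d.W ((A a b).op (th b)) := by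
      intro b
      rw [weyl, op_rsmul, LinearMap.smul_apply, der_op, W_symm_th, (h1 a b).op_smul, W_smul,
        smul_smul]
      congr 1
      simp [mul_assoc]
    simp only [key, ← Finset.smul_sum, e, smul_zero]

theorem L_weyl {x : LAlg R'} (hx : x ∈ weylIdeal R') : d.L x ∈ weylIdeal R := by
  induction hx using Submodule.closure_induction with
  | zero => simp
  | add x y _ _ hx hy => rw [map_add]; exact add_mem hx hy
  | smul_mem η y h =>
    obtain ⟨A, h, rfl⟩ := h
    rw [L_wedge_smul, L_weylElt]
    exact weyl_mem (d.isWeylTensor h) _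

/-- The map induced on `𝓔`. -/
def E : EAlg R' →ₗ[ℝ] EAlg R :=
  ((weylIdeal R').restrictScalars ℝ).liftQ (mkE ∘ₗ d.L) (fun _ hx => mkE_eq_zero.2 (d.L_weyl hx))

theorem E_mk (x : LAlg R') : d.E (mkE x) = mkE (d.L x) := rfl

theorem E_brE (x y : EAlg R') : d.E (brE x y) = brE (d.E x) (d.E y) := by
  obtain ⟨x, rfl⟩ := mkE_surjective x
  obtain ⟨y, rfl⟩ := mkE_surjective y
  simp only [brE_mk, E_mk, L_brL]

theorem L_mem {k : ℤ} {x : LAlg R'} (hx : x ∈ degL R' k) : d.L x ∈ degL R k := by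
  induction hx using Submodule.span_induction with
  | zero => simp
  | add a b _ _ ha hb => rw [map_add]; exact add_mem ha hb
  | smul c a _ ha => rw [map_smul]; exact Submodule.smul_mem _ _ ha
  | mem x hx =>
    obtain ⟨n, hn, ω, hω, δ, rfl⟩ := hx
    rw [L_tmul]; exact tmul_mem_degL hn (d.wedge_mem hω) _

theorem E_mem {k : ℤ} {x : EAlg R'} (hx : x ∈ degE R' k) : d.E x ∈ degE R k := by
  obtain ⟨x, hx, rfl⟩ := hx
  exact ⟨_, d.L_mem hx, rfl⟩

theorem repW_mk (x : LAlg R) : repW (mkE x) = repWL x := rfl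
theorem repOm_mk (x : LAlg R) : repOm (mkE x) = repOmL x := rfl

theorem wedge_repW (x : EAlg R') (η : Wedge R') :
    d.wedge (repW x η) = repW (d.E x) (d.wedge η) := by
  obtain ⟨x, rfl⟩ := mkE_surjective x
  rw [E_mk, repW_mk, repW_mk]
  induction x using TensorProduct.induction_on with
  | zero => simp
  | add x y hx hy => simp only [map_add, LinearMap.add_apply, hx, hy]
  | tmul ω δ => rw [L_tmul, repWL_tmul, repWL_tmul, map_mul, wedge_wact]

/-- The map induced on `Ω`. -/
def omega (z : Om R') : Om R := ⟨d.wedge z.1, d.wedge_mem z.2⟩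

theorem omega_add (y z : Om R') : d.omega (y + z) = d.omega y + d.omega z :=
  Subtype.ext (map_add d.wedge _ _)
theorem omega_smul (f : R') (z : Om R') : d.omega (f • z) = d.τ f • d.omega z :=
  Subtype.ext (d.wedge_smul _ _)
theorem omega_oact (δ : CDerEnd R') (z : Om R') : d.omega (oact δ z) = oact (d.der δ) (d.omega z) :=
  Subtype.ext (d.wedge_wact _ _)

/-- The map induced on `∧W ⊗ Ω`. -/
def om : Wedge R' ⊗[R'] Om R' →+ Wedge R ⊗[R] Om R :=
  TensorProduct.liftAddHom
    (AddMonoidHom.mk' (fun ω => AddMonoidHom.mk' (fun z => d.wedge ω ⊗ₜ d.omega z)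
        (fun a b => by rw [omega_add, TensorProduct.tmul_add]))
      (fun a b => by ext δ; simp [TensorProduct.add_tmul]))
    (fun r m n => by
      simp only [AddMonoidHom.mk'_apply, wedge_smul, omega_smul, TensorProduct.smul_tmul])

theorem om_tmul (η : Wedge R') (z : Om R') : d.om (η ⊗ₜ z) = d.wedge η ⊗ₜ d.omega z := rfl

theorem om_repOm (x : EAlg R') (ζ : Wedge R' ⊗[R'] Om R') :
    d.om (repOm x ζ) = repOm (d.E x) (d.om ζ) := by
  obtain ⟨x, rfl⟩ := mkE_surjective x
  rw [E_mk, repOm_mk, repOm_mk]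
  induction ζ using TensorProduct.induction_on with
  | zero => simp
  | add x y hx hy => simp only [map_add, hx, hy]
  | tmul η z =>
    induction x using TensorProduct.induction_on with
    | zero => simp
    | add x y hx hy => simp only [map_add, LinearMap.add_apply, hx, hy]
    | tmul ω δ => simp only [L_tmul, repOmL_tmul, om_tmul, map_add, map_mul, wedge_wact, omega_oact]

/-- The inverse. -/
def symm : DiagIso R R' where
  τ := d.τ.symm
  c a := Units.map (d.τ.symm : R →* R') (d.c a)⁻¹
  sq a := by
    have h : d.c a * d.c a = d.c 0 * d.c 0 := Units.ext (d.sq a)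
    rw [← Units.val_mul, ← Units.val_mul, ← map_mul, ← map_mul, ← mul_inv, ← mul_inv, h]

theorem symm_W (w : WMod R) : d.symm.W w = d.W.symm w := by
  ext a
  change d.τ.symm ((d.c a)⁻¹.1) * d.τ.symm (w a) = d.τ.symm ((d.c a)⁻¹.1 * w a)
  rw [map_mul]

/-- `d` is the composition of `d₁` and `d₂`. -/
def IsComp (d : DiagIso R'' R) (d₁ : DiagIso R'' R') (d₂ : DiagIso R' R) : Prop :=
  (∀ f, d.τ f = d₂.τ (d₁.τ f)) ∧ ∀ w, d.W w = d₂.W (d₁.W w)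

section Comp
variable {d : DiagIso R'' R} {d₁ : DiagIso R'' R'} {d₂ : DiagIso R' R}

/-- All induced maps are determined by `τ` and `Ψ`, so a pointwise comparison of these two is
enough. The same lemmas serve for composition in the groupoid, for `d.symm`, and for the reflection
being an involution. -/
theorem IsComp.wedge (h : IsComp d d₁ d₂) (ω : Wedge R'') : d.wedge ω = d₂.wedge (d₁.wedge ω) := by
  induction ω using ExteriorAlgebra.induction with
  | algebraMap r => simp only [wedge_algebraMap, h.1]
  | ι x => simp only [wedge_ι, h.2]
  | mul a b ha hb => simp only [map_mul, ha, hb]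
  | add a b ha hb => simp only [map_add, ha, hb]

theorem IsComp.der (h : IsComp d d₁ d₂) (δ : CDerEnd R'') : d.der δ = d₂.der (d₁.der δ) := by
  refine CDerEnd.ext' (fun f => ?_) (fun w => ?_)
  · obtain ⟨f, rfl⟩ := d.τ.surjective f
    rw [der_anchor_τ, h.1, h.1, der_anchor_τ, der_anchor_τ]
  · obtain ⟨w, rfl⟩ := d.W.surjective w
    rw [der_op_W, h.2, h.2, der_op_W, der_op_W]

theorem IsComp.E (h : IsComp d d₁ d₂) (x : EAlg R'') : d.E x = d₂.E (d₁.E x) := by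
  obtain ⟨x, rfl⟩ := mkE_surjective x
  rw [E_mk, E_mk, E_mk]
  congr 1
  induction x using TensorProduct.induction_on with
  | zero => simp
  | add x y hx hy => simp only [map_add, hx, hy]
  | tmul ω δ => simp only [L_tmul, h.wedge, h.der]

theorem IsComp.om (h : IsComp d d₁ d₂) (x : Wedge R'' ⊗[R''] Om R'') :
    d.om x = d₂.om (d₁.om x) := by
  induction x using TensorProduct.induction_on with
  | zero => simp
  | add x y hx hy => simp only [map_add, hx, hy]
  | tmul ω z =>
    rw [om_tmul, om_tmul, om_tmul, h.wedge]
    congr 1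
    exact Subtype.ext (h.wedge _)
end Comp

/-- `d` is the identity. -/
def IsId (d : DiagIso R R) : Prop := (∀ f, d.τ f = f) ∧ ∀ w, d.W w = w

section Id
variable {d : DiagIso R R}

theorem IsId.wedge (h : IsId d) (ω : Wedge R) : d.wedge ω = ω := by
  induction ω using ExteriorAlgebra.induction with
  | algebraMap r => simp only [wedge_algebraMap, h.1]
  | ι x => simp only [wedge_ι, h.2]
  | mul a b ha hb => simp only [map_mul, ha, hb]
  | add a b ha hb => simp only [map_add, ha, hb]

theorem IsId.der (h : IsId d) (δ : CDerEnd R) : d.der δ = δ := by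
  refine CDerEnd.ext' (fun f => ?_) (fun w => ?_)
  · have := d.der_anchor_τ δ f; rwa [h.1, h.1] at this
  · have := d.der_op_W δ w; rwa [h.2, h.2] at this

theorem IsId.E (h : IsId d) (x : EAlg R) : d.E x = x := by
  obtain ⟨x, rfl⟩ := mkE_surjective x
  rw [E_mk]
  congr 1
  induction x using TensorProduct.induction_on with
  | zero => simp
  | add x y hx hy => simp only [map_add, hx, hy]
  | tmul ω δ => simp only [L_tmul, h.wedge, h.der]

theorem IsId.om (h : IsId d) (x : Wedge R ⊗[R] Om R) : d.om x = x := by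
  induction x using TensorProduct.induction_on with
  | zero => simp
  | add x y hx hy => simp only [map_add, hx, hy]
  | tmul ω z =>
    rw [om_tmul, h.wedge]
    congr 1
    exact Subtype.ext (h.wedge _)
end Id

variable (R) in
/-- The identity. -/
def refl : DiagIso R R where
  τ := AlgEquiv.refl
  c _ := 1
  sq _ := rfl

theorem isId_refl : IsId (refl R) := ⟨fun _ => rfl, fun w => by ext a; simp [W_apply, refl]⟩

theorem isComp_symm_self : IsComp (refl R) d.symm d :=
  ⟨fun f => (d.τ.apply_symm_apply f).symm, fun w => by rw [isId_refl.2, symm_W]; simp⟩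

/-- Together with `om_symm` this allows an arbitrary element of the target to be written as an
image, which is how conditions that quantify over all `η` or `ζ` are transported. -/
theorem wedge_symm (ω : Wedge R) : d.wedge (d.symm.wedge ω) = ω := by
  rw [← d.isComp_symm_self.wedge, isId_refl.wedge]

theorem om_symm (ζ : Wedge R ⊗[R] Om R) : d.om (d.symm.om ζ) = ζ := by
  rw [← d.isComp_symm_self.om, isId_refl.om]

/-- The morphism of graded Lie algebras induced on `𝓔`. -/
def gla : gE R' ⟶ gE R :=
  GLA.Hom.mk (G := gE R') (H := gE R) (fun _ => d.E.restrict fun _ hx => d.E_mem hx)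
    (fun _ _ _ => Subtype.ext (d.E_brE _ _))

theorem gla_id {d : DiagIso R R} (h : IsId d) : d.gla = 𝟙 (gE R) :=
  GLA.Hom.ext (funext fun _ => LinearMap.ext fun _ => Subtype.ext (h.E _))

theorem gla_comp {d : DiagIso R'' R} {d₁ : DiagIso R'' R'} {d₂ : DiagIso R' R}
    (h : IsComp d d₁ d₂) : d.gla = d₁.gla ≫ d₂.gla :=
  GLA.Hom.ext (funext fun _ => LinearMap.ext fun _ => Subtype.ext (h.E _))

/-- The semilinear conformal isomorphism with constant coefficients. -/
def ofConst (τ : R' ≃ₐ[ℝ] R) (c : Rˣ) : DiagIso R' R := ⟨τ, fun _ => c, fun _ => rfl⟩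

end DiagIso

/-! ### Parities as eigenspaces of a reflection. -/

open CDerEnd DiagIso

/-- The sign of a parity. -/
def sg (e : ZMod 2) : ℤ := if e = 0 then 1 else -1

theorem sg_cases (e : ZMod 2) : (e = 0 ∧ sg e = 1) ∨ (e = 1 ∧ sg e = -1) := by
  fin_cases e
  · exact Or.inl ⟨rfl, rfl⟩
  · exact Or.inr ⟨rfl, rfl⟩

theorem sg_add (a b : ZMod 2) : sg (a + b) = sg a * sg b := by
  revert a b; decide

theorem sg_mul_self (a : ZMod 2) : sg a * sg a = 1 := by
  revert a; decide

/-- Split `x` along `A 0` and `A 1`: the component of the wrong parity equals its own negative, so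
it vanishes in the absence of 2-torsion. No directness of the decomposition is assumed. -/
theorem eigen_mem {M : Type*} [AddCommGroup M] (h2 : ∀ x : M, x + x = 0 → x = 0) (J : M →+ M)
    (A : ZMod 2 → AddSubgroup M) (hA : ∀ e, ∀ x ∈ A e, J x = sg e • x)
    (htop : ∀ x, ∃ y ∈ A 0, ∃ z ∈ A 1, x = y + z) {e : ZMod 2} {x : M} (hx : J x = sg e • x) :
    x ∈ A e := by
  obtain ⟨y, hy, z, hz, rfl⟩ := htop x
  rw [map_add, hA _ _ hy, hA _ _ hz] at hx
  rcases sg_cases e with ⟨rfl, h⟩ | ⟨rfl, h⟩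
  · have : z + z = 0 := by
      simp [sg] at hx
      rw [neg_eq_iff_add_eq_zero] at hx; exact hx
    rw [h2 z this, add_zero]; exact hy
  · have : y + y = 0 := by
      simp [sg] at hx
      rw [eq_neg_iff_add_eq_zero] at hx; exact hx
    rw [h2 y this, zero_add]; exact hz

section
variable {R : Type u} [CommRing R] [Algebra ℝ R]

variable (R) in
/-- One half. -/
def half : R := algebraMap ℝ R 2⁻¹

theorem half_add_half : half R + half R = 1 := by
  rw [half, ← map_add, ← map_one (algebraMap ℝ R)]; norm_num

theorem half_smul {M : Type*} [AddCommGroup M] [Module R M] (x : M) :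
    half R • x + half R • x = x := by
  rw [← add_smul, half_add_half, one_smul]

variable (R) in
theorem two_torsion {M : Type*} [AddCommGroup M] [Module R M] (x : M) (h : x + x = 0) : x = 0 := by
  have := congrArg (half R • ·) h
  simpa only [smul_add, half_smul, smul_zero] using this

variable (R) in
/-- The reflection of `W` that is `1` on `W₀` and `-1` on `W₁`. -/
def refl₁ (i : Fin 3) : DiagIso R R where
  τ := AlgEquiv.refl
  c a := if par i a = 0 then 1 else -1
  sq a := by split_ifs <;> simp

variable (i : Fin 3)

theorem refl₁_W_apply (w : WMod R) (a : Fin 4) : (refl₁ R i).W w a = sg (par i a) • w a := by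
  rw [W_apply]
  rcases sg_cases (par i a) with ⟨h, h'⟩ | ⟨h, h'⟩ <;> simp [refl₁, h, sg]

theorem refl₁_W_smul (f : R) (w : WMod R) : (refl₁ R i).W (f • w) = f • (refl₁ R i).W w :=
  W_smul _ f w

theorem isComp_refl₁ : IsComp (DiagIso.refl R) (refl₁ R i) (refl₁ R i) := by
  refine ⟨fun f => rfl, fun w => ?_⟩
  ext a
  rw [isId_refl.2, refl₁_W_apply, refl₁_W_apply, smul_smul, sg_mul_self, one_smul]

theorem refl₁_der_der (δ : CDerEnd R) : (refl₁ R i).der ((refl₁ R i).der δ) = δ := by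
  rw [← (isComp_refl₁ i).der, isId_refl.der]
theorem refl₁_wPart {e : ZMod 2} {w : WMod R} (h : w ∈ wPart R i e) :
    (refl₁ R i).W w = sg e • w := by
  induction h using Submodule.span_induction with
  | mem x hx =>
    obtain ⟨a, rfl, rfl⟩ := hx
    ext b
    rw [refl₁_W_apply, Pi.smul_apply]
    by_cases h : b = a
    · rw [h]
    · simp [h]
  | zero => simp
  | add x y _ _ hx hy => rw [map_add, hx, hy, smul_add]
  | smul r x _ hx => rw [refl₁_W_smul, hx, smul_comm]

theorem exists_wPart (w : WMod R) : ∃ y ∈ wPart R i 0, ∃ z ∈ wPart R i 1, w = y + z := by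
  have : w ∈ wPart R i 0 ⊔ wPart R i 1 := by
    rw [eq_sum_th w]
    refine Submodule.sum_mem _ fun a _ => Submodule.smul_mem _ _ ?_
    rcases sg_cases (par i a) with ⟨h, -⟩ | ⟨h, -⟩
    · exact Submodule.mem_sup_left (Submodule.subset_span ⟨a, h, rfl⟩)
    · exact Submodule.mem_sup_right (Submodule.subset_span ⟨a, h, rfl⟩)
  obtain ⟨y, hy, z, hz, e⟩ := Submodule.mem_sup.1 this
  exact ⟨y, hy, z, hz, e.symm⟩

/-- Membership in a span becomes an equation, which is inherited under every map that commutes with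
the reflection. The later characterizations of parity have the same purpose. -/
theorem mem_wPart {e : ZMod 2} {w : WMod R} : w ∈ wPart R i e ↔ (refl₁ R i).W w = sg e • w :=
  ⟨refl₁_wPart i, fun h => eigen_mem (two_torsion R) ((refl₁ R i).W : WMod R ≃+ WMod R).toAddMonoidHom
    (fun e => (wPart R i e).toAddSubgroup) (fun _ _ => refl₁_wPart i) (exists_wPart i) h⟩

/-- The Leibniz rule for `fθ₀` recovers the anchor from the operator, so elements of `CDerEnd(W)`
can be compared on `W` alone. -/
theorem anchor_eq_of_op (δ : CDerEnd R) (f : R) :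
    δ.anchor f = δ.op (f • th 0) 0 - f * δ.op (th 0) 0 := by
  rw [CDerEnd.op_smul]; simp [th]

theorem ext_op {δ ε : CDerEnd R} (h : ∀ w, δ.op w = ε.op w) : δ = ε :=
  CDerEnd.ext' (fun f => by rw [anchor_eq_of_op, anchor_eq_of_op, h, h]) h

theorem op_neg (δ : CDerEnd R) (w : WMod R) : (-δ).op w = - δ.op w := rfl
theorem anchor_neg (δ : CDerEnd R) (f : R) : (-δ).anchor f = - δ.anchor f := rfl

theorem op_sg (e : ZMod 2) (δ : CDerEnd R) (w : WMod R) : (sg e • δ).op w = sg e • δ.op w := by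
  rcases sg_cases e with ⟨-, h⟩ | ⟨-, h⟩ <;> simp [h, op_neg]

theorem isDerPar_iff {e : ZMod 2} {δ : CDerEnd R} :
    IsDerPar i e δ ↔ (refl₁ R i).der δ = sg e • δ := by
  constructor
  · intro h
    have key : ∀ c, ∀ w ∈ wPart R i c, ((refl₁ R i).der δ).op w = sg e • δ.op w := by
      intro c w hw
      have h1 := (refl₁ R i).der_op_W δ w
      rw [refl₁_wPart i hw, refl₁_wPart i (h c w hw), map_zsmul, sg_add] at h1
      -- Both sides of `h1` carry the sign of `c`; this sign is its own inverse, so multiplying by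
      -- it leaves only the sign of `e`.
      have h2 := congrArg (sg c • ·) h1
      simpa only [smul_smul, ← mul_assoc, sg_mul_self, one_smul, one_mul] using h2
    refine ext_op fun w => ?_
    obtain ⟨y, hy, z, hz, rfl⟩ := exists_wPart i w
    rw [op_sg, map_add, map_add, key _ _ hy, key _ _ hz, smul_add]
  · intro h c w hw
    rw [mem_wPart] at hw ⊢
    have h1 := (refl₁ R i).der_op_W δ w
    rw [hw, h, op_sg, map_zsmul, smul_smul] at h1
    rw [← h1, sg_add, mul_comm]

theorem exists_isDerPar (δ : CDerEnd R) :
    ∃ y z, IsDerPar i 0 y ∧ IsDerPar i 1 z ∧ δ = y + z := by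
  have hs : ∀ x : CDerEnd R, (refl₁ R i).der (half R • x) = half R • (refl₁ R i).der x :=
    fun x => der_smul _ _ x
  have hn : ∀ x : CDerEnd R, (refl₁ R i).der (-x) = - (refl₁ R i).der x := fun x => by
    have := der_smul (refl₁ R i) (-1) x
    simpa using this
  refine ⟨half R • (δ + (refl₁ R i).der δ), half R • (δ + -(refl₁ R i).der δ), ?_, ?_, ?_⟩
  · rw [isDerPar_iff, hs, der_add, refl₁_der_der, add_comm, sg, if_pos rfl, one_smul]
  · rw [isDerPar_iff, hs, der_add, hn, refl₁_der_der, sg, if_neg (by decide), neg_one_zsmul,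
      ← smul_neg, neg_add, neg_neg, add_comm]
  · rw [smul_add, smul_add, smul_neg]
    conv_lhs => rw [← half_smul (R := R) δ]
    abel

/-- The reflection is `R`-linear, so conjugation fixes the anchor, while oddness negates it: the
anchor is zero. Oddness also sends `θ₀` into `W₁`, so the conformal condition at `(θ₀, θ₀)` forces
`l = 0`. This is needed because antisymmetric maps act as zero on `Ω` (`so_oact`). -/
theorem isSO_of_odd {δ : CDerEnd R} (h : IsDerPar i 1 δ) : IsSO δ := by
  have h' := (isDerPar_iff i).1 h
  have ha : ∀ f, δ.anchor f = 0 := fun f => by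
    have e : ((refl₁ R i).der δ).anchor f = δ.anchor f := rfl
    rw [h', sg, if_neg (by decide), neg_one_zsmul, anchor_neg] at e
    exact two_torsion R _ (by rw [← neg_eq_iff_add_eq_zero]; exact e)
  obtain ⟨l, hl⟩ := δ.2.2
  change ∀ v w, δ.anchor _ + _ = confForm (δ.op v) w + confForm v (δ.op w) at hl
  have h0 : δ.op (th 0) 0 = 0 := by
    have m : (th 0 : WMod R) ∈ wPart R i 0 := Submodule.subset_span ⟨0, by simp [par], rfl⟩
    have e := congrFun ((mem_wPart i).1 (h 0 _ m)) 0
    rw [refl₁_W_apply] at e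
    simp [sg, par] at e
    exact two_torsion R _ (by rwa [eq_neg_iff_add_eq_zero] at e)
  have hl0 : l = 0 := by
    have e := hl (th 0) (th 0)
    simp [confForm, th, ha] at e
    rw [show (Pi.single 0 1 : WMod R) = th 0 from rfl, h0] at e
    simpa using e
  exact ⟨ha, fun v w => by rw [← hl, ha, hl0]; simp⟩

/-- The eigenspaces of the reflection on the exterior algebra. -/
def wedgeEig (R : Type u) [CommRing R] [Algebra ℝ R] (i : Fin 3) (e : ZMod 2) :
    Submodule R (Wedge R) where
  carrier := {ω | (refl₁ R i).wedge ω = sg e • ω}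
  add_mem' hx hy := by
    simp only [Set.mem_ofPred_eq, map_add, smul_add] at *; rw [hx, hy]
  zero_mem' := by simp
  smul_mem' r x hx := by
    simp only [Set.mem_ofPred_eq] at *
    rw [wedge_smul, hx, smul_comm]; rfl

theorem mem_wedgeEig {e : ZMod 2} {ω : Wedge R} :
    ω ∈ wedgeEig R i e ↔ (refl₁ R i).wedge ω = sg e • ω := Iff.rfl

theorem mul_mem_wedgeEig {a b : ZMod 2} {x y : Wedge R} (hx : x ∈ wedgeEig R i a)
    (hy : y ∈ wedgeEig R i b) : x * y ∈ wedgeEig R i (a + b) := by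
  rw [mem_wedgeEig] at *
  rw [map_mul, hx, hy, sg_add, smul_mul_smul_comm]

theorem wedgeEig_mul_le (a b : ZMod 2) :
    wedgeEig R i a * wedgeEig R i b ≤ wedgeEig R i (a + b) :=
  Submodule.mul_le.2 fun _ hx _ hy => mul_mem_wedgeEig i hx hy

theorem wedgeEig_one_le : (1 : Submodule R (Wedge R)) ≤ wedgeEig R i 0 := by
  rw [Submodule.one_le, mem_wedgeEig, map_one, sg, if_pos rfl, one_smul]

theorem map_wPart_le (e : ZMod 2) :
    (wPart R i e).map (ExteriorAlgebra.ι R) ≤ wedgeEig R i e := by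
  rintro _ ⟨w, hw, rfl⟩
  rw [mem_wedgeEig, wedge_ι, refl₁_wPart i hw, map_zsmul]

/-- The reflection is multiplicative and contributes one sign for each of the `k` factors from `W₁`.
-/
theorem wedgeBi_le (k : ℕ) : wedgeBi R i k ≤ wedgeEig R i k := by
  refine iSup_le fun m => ?_
  have h0 : ∀ m : ℕ, ((wPart R i 0).map (ExteriorAlgebra.ι R)) ^ m ≤ wedgeEig R i 0 := by
    intro m
    induction m with
    | zero => exact wedgeEig_one_le i
    | succ m ih =>
      rw [pow_succ]
      exact (mul_le_mul' ih (map_wPart_le i 0)).trans (wedgeEig_mul_le i 0 0)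
  have h1 : ∀ k : ℕ, ((wPart R i 1).map (ExteriorAlgebra.ι R)) ^ k ≤ wedgeEig R i k := by
    intro k
    induction k with
    | zero => rw [Nat.cast_zero]; exact wedgeEig_one_le i
    | succ m ih =>
      rw [pow_succ, Nat.cast_succ]
      exact (mul_le_mul' ih (map_wPart_le i 1)).trans (wedgeEig_mul_le i m 1)
  exact (mul_le_mul' (h0 m) (h1 k)).trans (by simpa using wedgeEig_mul_le i 0 (k : ZMod 2))

theorem wedgePar_le (e : ZMod 2) : wedgePar R i e ≤ wedgeEig R i e :=
  iSup₂_le fun k hk => hk ▸ wedgeBi_le i k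

/-- Vectors anticommute, and a submodule does not see the sign. Hence factors from `W₀` and `W₁` may
be reordered freely in products of submodules. -/
theorem commute_wPart (a b : ZMod 2) : Commute ((wPart R i a).map (ExteriorAlgebra.ι R))
    ((wPart R i b).map (ExteriorAlgebra.ι R)) := by
  have : ∀ a b : ZMod 2, (wPart R i a).map (ExteriorAlgebra.ι R) *
      (wPart R i b).map (ExteriorAlgebra.ι R) ≤ (wPart R i b).map (ExteriorAlgebra.ι R) *
      (wPart R i a).map (ExteriorAlgebra.ι R) := by
    intro a b
    refine Submodule.mul_le.2 ?_
    rintro _ ⟨v, hv, rfl⟩ _ ⟨w, hw, rfl⟩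
    rw [eq_neg_of_add_eq_zero_left (ExteriorAlgebra.ι_add_mul_swap v w)]
    exact neg_mem (Submodule.mul_mem_mul ⟨w, hw, rfl⟩ ⟨v, hv, rfl⟩)
  exact le_antisymm (this a b) (this b a)

theorem wedgeBi_mul_le (k l : ℕ) : wedgeBi R i k * wedgeBi R i l ≤ wedgeBi R i (k + l) := by
  simp only [wedgeBi, Submodule.iSup_mul, Submodule.mul_iSup]
  refine iSup_le fun m => iSup_le fun n => ?_
  refine le_trans (le_of_eq ?_) (le_iSup _ (n + m))
  rw [((commute_wPart (R := R) i 1 0).pow_pow _ _).mul_mul_mul_comm, pow_add, pow_add]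

/-- The supremum contains the functions and both summands of `W`, and `wedgeBi_mul_le` makes it
closed under products. -/
theorem iSup_wedgeBi : ⨆ k, wedgeBi R i k = ⊤ := by
  refine eq_top_iff.2 fun ω _ => ?_
  have h0 : (1 : Wedge R) ∈ wedgeBi R i 0 :=
    Submodule.mem_iSup_of_mem 0 (by
      rw [pow_zero, pow_zero, one_mul]; exact Submodule.one_le.1 le_rfl)
  induction ω using ExteriorAlgebra.induction with
  | algebraMap r =>
    rw [Algebra.algebraMap_eq_smul_one]
    exact Submodule.smul_mem _ _ (Submodule.mem_iSup_of_mem 0 h0)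
  | ι x =>
    obtain ⟨y, hy, z, hz, rfl⟩ := exists_wPart i x
    rw [map_add]
    refine add_mem (Submodule.mem_iSup_of_mem 0 (Submodule.mem_iSup_of_mem 1 ?_))
      (Submodule.mem_iSup_of_mem 1 (Submodule.mem_iSup_of_mem 0 ?_))
    · rw [pow_one, pow_zero, mul_one]; exact ⟨y, hy, rfl⟩
    · rw [pow_one, pow_zero, one_mul]; exact ⟨z, hz, rfl⟩
  | add x y hx hy => exact add_mem (hx trivial) (hy trivial)
  | mul x y hx hy =>
    have h := Submodule.mul_mem_mul (hx trivial) (hy trivial)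
    have h' : (⨆ k, wedgeBi R i k) * (⨆ k, wedgeBi R i k) ≤ ⨆ k, wedgeBi R i k := by
      conv_lhs => simp only [Submodule.iSup_mul, Submodule.mul_iSup]
      exact iSup_le fun m => iSup_le fun n => (wedgeBi_mul_le i _ _).trans (le_iSup _ _)
    exact h' h

theorem exists_wedgePar (ω : Wedge R) :
    ∃ y ∈ wedgePar R i 0, ∃ z ∈ wedgePar R i 1, ω = y + z := by
  have : ω ∈ wedgePar R i 0 ⊔ wedgePar R i 1 := by
    suffices h : (⨆ k, wedgeBi R i k) ≤ wedgePar R i 0 ⊔ wedgePar R i 1 from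
      h ((iSup_wedgeBi i).ge trivial)
    refine iSup_le fun k => ?_
    rcases sg_cases (k : ZMod 2) with ⟨h, -⟩ | ⟨h, -⟩
    · exact le_sup_of_le_left (le_iSup₂_of_le k h le_rfl)
    · exact le_sup_of_le_right (le_iSup₂_of_le k h le_rfl)
  obtain ⟨y, hy, z, hz, e⟩ := Submodule.mem_sup.1 this
  exact ⟨y, hy, z, hz, e.symm⟩

theorem mem_wedgePar {e : ZMod 2} {ω : Wedge R} :
    ω ∈ wedgePar R i e ↔ (refl₁ R i).wedge ω = sg e • ω :=
  ⟨fun h => wedgePar_le i e h, fun h => eigen_mem (two_torsion R) (refl₁ R i).wedge.toAddMonoidHom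
    (fun e => (wedgePar R i e).toAddSubgroup) (fun e _ h => wedgePar_le i e h)
    (exists_wedgePar i) h⟩

theorem mul_mem_wedgePar {a b : ZMod 2} {x y : Wedge R} (hx : x ∈ wedgePar R i a)
    (hy : y ∈ wedgePar R i b) : x * y ∈ wedgePar R i (a + b) := by
  rw [mem_wedgePar] at *; exact mul_mem_wedgeEig i hx hy

theorem wact_sg (e : ZMod 2) (δ : CDerEnd R) (ω : Wedge R) : wact δ (sg e • ω) = sg e • wact δ ω := by
  rcases sg_cases e with ⟨-, h⟩ | ⟨-, h⟩
  · simp [h]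
  · have := wact_sub δ 0 ω
    rw [wact_zero, zero_sub, zero_sub] at this
    simp [h, this]

theorem sg_wact (e : ZMod 2) (δ : CDerEnd R) (ω : Wedge R) : wact (sg e • δ) ω = sg e • wact δ ω := by
  rcases sg_cases e with ⟨-, h⟩ | ⟨-, h⟩
  · simp [h]
  · have := smul_wact (-1) δ ω
    simpa [h] using this

theorem wact_mem_wedgePar {a b : ZMod 2} {δ : CDerEnd R} {ω : Wedge R} (hδ : IsDerPar i b δ)
    (hω : ω ∈ wedgePar R i a) : wact δ ω ∈ wedgePar R i (a + b) := by
  rw [isDerPar_iff] at hδ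
  rw [mem_wedgePar] at *
  rw [wedge_wact, hδ, hω, wact_sg, sg_wact, smul_smul, sg_add]

theorem wedgeF_le_wedgePar (p : ℕ) : wedgeF R i p ≤ wedgePar R i p :=
  iSup₂_le fun k hk => le_iSup₂_of_le k ((ZMod.natCast_eq_natCast_iff' _ _ _).2 hk.2) le_rfl

theorem wedgeF_mono (p : ℕ) : wedgeF R i p ≤ wedgeF R i (p + 2) :=
  iSup₂_le fun k hk => le_iSup₂_of_le k ⟨by omega, by omega⟩ le_rfl

/-- `W₁` has rank two, so three of its basis elements always include a repetition. -/
theorem map_wPart_one_pow_three : ((wPart R i 1).map (ExteriorAlgebra.ι R)) ^ 3 = ⊥ := by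
  rw [wPart, Submodule.map_span, pow_succ, pow_two, Submodule.span_mul_span, Submodule.span_mul_span,
    Submodule.span_eq_bot]
  rintro _ ⟨_, ⟨_, ⟨_, ⟨a, ha, rfl⟩, rfl⟩, _, ⟨_, ⟨b, hb, rfl⟩, rfl⟩, rfl⟩, _,
    ⟨_, ⟨c, hc, rfl⟩, rfl⟩, rfl⟩
  -- Pigeonhole for three indices in a set of two, checked for each axis.
  have h : a = b ∨ b = c ∨ a = c := by
    revert i a b c; decide
  dsimp only
  rcases h with rfl | rfl | rfl
  · rw [ExteriorAlgebra.ι_sq_zero, zero_mul]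
  · rw [mul_assoc, ExteriorAlgebra.ι_sq_zero, mul_zero]
  · rw [mul_assoc, eq_neg_of_add_eq_zero_left (ExteriorAlgebra.ι_add_mul_swap _ _), mul_neg,
      ← mul_assoc, ExteriorAlgebra.ι_sq_zero, zero_mul, neg_zero]

/-- For `p ≥ 1` the degree bound is automatic, so the filtration carries no information beyond
parity. Only `p = 0` is restrictive: there, degree two in `W₁` is even but excluded. -/
theorem wedgePar_le_wedgeF {p : ℕ} (hp : 1 ≤ p) : wedgePar R i p ≤ wedgeF R i p := by
  refine iSup₂_le fun k hk => ?_
  have hk := (ZMod.natCast_eq_natCast_iff' _ _ _).1 hk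
  by_cases h : k ≤ p
  · exact le_iSup₂_of_le k ⟨h, hk⟩ le_rfl
  -- A degree `k > p ≥ 1` of the same parity as `p` is at least `p + 2 ≥ 3`, where `W₁` contributes
  -- nothing.
  · obtain ⟨l, rfl⟩ : ∃ l, k = 3 + l := ⟨k - 3, by omega⟩
    refine iSup_le fun m => ?_
    rw [pow_add, map_wPart_one_pow_three]
    simp

end

/-! ### The BKL filtrations are filtrations. -/

section
variable {R : Type u} [CommRing R] [Algebra ℝ R] (i : Fin 3)

theorem L_refl₁_tmul {a b : ZMod 2} {ω : Wedge R} {δ : CDerEnd R} (hω : ω ∈ wedgePar R i a)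
    (hδ : IsDerPar i b δ) : (refl₁ R i).L (ω ⊗ₜ δ) = sg (a + b) • (ω ⊗ₜ[R] δ : LAlg R) := by
  rw [L_tmul, (mem_wedgePar i).1 hω, (isDerPar_iff i).1 hδ, sg_add]
  rcases sg_cases a with ⟨-, ha⟩ | ⟨-, ha⟩ <;> rcases sg_cases b with ⟨-, hb⟩ | ⟨-, hb⟩ <;>
    simp [ha, hb, TensorProduct.neg_tmul, TensorProduct.tmul_neg]

theorem exists_ePar (x : EAlg R) : ∃ y ∈ ePar R i 0, ∃ z ∈ ePar R i 1, x = y + z := by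
  have key : ∀ a b : ZMod 2, ∀ ω ∈ wedgePar R i a, ∀ δ : CDerEnd R, IsDerPar i b δ →
      mkE (ω ⊗ₜ δ) ∈ ePar R i 0 ⊔ ePar R i 1 := by
    intro a b ω hω δ hδ
    have h : mkE (ω ⊗ₜ δ) ∈ ePar R i (a + b) :=
      Submodule.subset_span ⟨a, b, rfl, ω, hω, δ, hδ, rfl⟩
    rcases sg_cases (a + b) with ⟨e, -⟩ | ⟨e, -⟩ <;> rw [e] at h
    · exact Submodule.mem_sup_left h
    · exact Submodule.mem_sup_right h
  have : x ∈ ePar R i 0 ⊔ ePar R i 1 := by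
    obtain ⟨x, rfl⟩ := mkE_surjective x
    induction x using TensorProduct.induction_on with
    | zero => simp
    | add x y hx hy => rw [map_add]; exact add_mem hx hy
    | tmul ω δ =>
      obtain ⟨y, hy, z, hz, rfl⟩ := exists_wedgePar i ω
      obtain ⟨δ, ε, hδ, hε, rfl⟩ := exists_isDerPar i δ
      simp only [TensorProduct.add_tmul, TensorProduct.tmul_add, map_add]
      exact add_mem (add_mem (key _ _ _ hy _ hδ) (key _ _ _ hz _ hδ))
        (add_mem (key _ _ _ hy _ hε) (key _ _ _ hz _ hε))
  obtain ⟨y, hy, z, hz, e⟩ := Submodule.mem_sup.1 this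
  exact ⟨y, hy, z, hz, e.symm⟩

theorem refl₁_ePar {e : ZMod 2} {x : EAlg R} (h : x ∈ ePar R i e) :
    (refl₁ R i).E x = sg e • x := by
  induction h using Submodule.span_induction with
  | mem x hx =>
    obtain ⟨a, b, rfl, ω, hω, δ, hδ, rfl⟩ := hx
    rw [E_mk, L_refl₁_tmul i hω hδ, map_zsmul]
  | zero => simp
  | add x y _ _ hx hy => rw [map_add, hx, hy, smul_add]
  | smul r x _ hx => rw [map_smul, hx, smul_comm]

/-- The reflection maps the Weyl ideal into itself and so acts on the quotient. Compatibility of the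
parity with bracket and action then follows from naturality, without choosing representatives. -/
theorem mem_ePar {e : ZMod 2} {x : EAlg R} : x ∈ ePar R i e ↔ (refl₁ R i).E x = sg e • x :=
  ⟨refl₁_ePar i, fun h => eigen_mem (two_torsion ℝ) (refl₁ R i).E.toAddMonoidHom
    (fun e => (ePar R i e).toAddSubgroup) (fun _ _ => refl₁_ePar i) (exists_ePar i) h⟩

theorem brE_mem_ePar {a b : ZMod 2} {x y : EAlg R} (hx : x ∈ ePar R i a) (hy : y ∈ ePar R i b) :
    brE x y ∈ ePar R i (a + b) := by
  rw [mem_ePar] at *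
  rw [E_brE, hx, hy, map_zsmul, map_zsmul, LinearMap.smul_apply, smul_smul, sg_add, mul_comm]

theorem repW_mem_wedgePar {a b : ZMod 2} {x : EAlg R} {η : Wedge R} (hx : x ∈ ePar R i a)
    (hη : η ∈ wedgePar R i b) : repW x η ∈ wedgePar R i (b + a) := by
  rw [mem_ePar] at hx
  rw [mem_wedgePar] at *
  rw [wedge_repW, hx, hη, map_zsmul, map_zsmul, LinearMap.smul_apply, smul_smul, sg_add]

theorem tmul_mem_omegaF {p : ℕ} (hp : 1 ≤ p) {η : Wedge R} (h : η ∈ wedgePar R i p) (z : Om R) :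
    η ⊗ₜ z ∈ omegaF R i p :=
  Submodule.subset_span ⟨η, wedgePar_le_wedgeF i hp h, z, rfl⟩

/-- The generating set is already stable under multiplication by functions, so additive induction
suffices. This matters because the maps to which it is applied are not `R`-linear. -/
theorem omegaF_induction {q : ℕ} {P : Wedge R ⊗[R] Om R → Prop} {ζ : Wedge R ⊗[R] Om R}
    (h : ζ ∈ omegaF R i q) (h0 : P 0) (hadd : ∀ x y, P x → P y → P (x + y))
    (ht : ∀ η ∈ wedgeF R i q, ∀ z, P (η ⊗ₜ z)) : P ζ := by
  induction h using Submodule.closure_induction with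
  | zero => exact h0
  | add x y _ _ hx hy => exact hadd _ _ hx hy
  | smul_mem r y hy =>
    obtain ⟨η, hη, z, rfl⟩ := hy
    rw [TensorProduct.smul_tmul']
    exact ht _ (Submodule.smul_mem _ _ hη) _

/-- As `q + p ≥ 1`, only the parity of the `∧W` factor has to be checked. The term `ωδ(η)z` always
has the right one. The term `ωηδ(z)` has it when `δ` is even, and vanishes when `δ` is odd. -/
theorem repOm_mem_omegaF {p q : ℕ} (hp : 1 ≤ p) {x : EAlg R} (hx : x ∈ ePar R i p)
    {ζ : Wedge R ⊗[R] Om R} (hζ : ζ ∈ omegaF R i q) : repOm x ζ ∈ omegaF R i (q + p) := by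
  refine omegaF_induction i (P := fun ζ => repOm x ζ ∈ omegaF R i (q + p)) hζ (by simp) (fun x y hx hy => by rw [map_add]; exact add_mem hx hy)
    fun η hη z => ?_
  induction hx using Submodule.span_induction with
  | zero => simp
  | add x y _ _ hx hy => rw [map_add, LinearMap.add_apply]; exact add_mem hx hy
  | smul r x _ hx =>
    rw [map_smul, LinearMap.smul_apply]
    exact Submodule.smul_of_tower_mem _ r hx
  | mem x hx =>
    obtain ⟨a, b, hab, ω, hω, δ, hδ, rfl⟩ := hx
    rw [repOm_mk, repOmL_tmul]
    have hη := wedgeF_le_wedgePar i q hη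
    refine add_mem (tmul_mem_omegaF i (by omega) ?_ _) ?_
    · have := mul_mem_wedgePar i hω (wact_mem_wedgePar i hδ hη)
      rwa [add_left_comm, hab, ← Nat.cast_add] at this
    · rcases sg_cases b with ⟨rfl, -⟩ | ⟨rfl, -⟩
      · refine tmul_mem_omegaF i (by omega) ?_ _
        have := mul_mem_wedgePar i hω hη
        rw [add_zero] at hab
        rwa [hab, add_comm, ← Nat.cast_add] at this
      -- Here `ωη` has parity `q + p + 1`, so the term is harmless only because `δ(z) = 0`.
      · rw [so_oact (isSO_of_odd i hδ), TensorProduct.tmul_zero]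
        exact zero_mem _

/-- For `p ≥ 1` every target index `q + p` is at least one, where the filtration of the modules is
just parity. -/
theorem ePar_le_eF {p : ℕ} (hp : 1 ≤ p) : ePar R i p ≤ eF R i p := fun _ hx =>
  ⟨hx, fun q => ⟨fun η hη => wedgePar_le_wedgeF i (by omega) (by
      have := repW_mem_wedgePar i hx (wedgeF_le_wedgePar i q hη)
      rwa [← Nat.cast_add] at this),
    fun _ hζ => repOm_mem_omegaF i hp hx hζ⟩⟩

/-- The summands `F_{◁2}` and `F_{◁1}` contain all even and all odd elements, so the filtrations
exhaust `𝓔` at index two. -/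
theorem eFil_two : eFil R i 2 = ⊤ := by
  refine eq_top_iff.2 fun x _ => ?_
  obtain ⟨y, hy, z, hz, rfl⟩ := exists_ePar i x
  refine add_mem (Submodule.mem_sup_left (ePar_le_eF i (by norm_num) ?_))
    (Submodule.mem_sup_right (ePar_le_eF i le_rfl ?_))
  -- The index `2` is `0` modulo 2.
  · exact hy
  · rw [Nat.cast_one]; exact hz

theorem omegaF_mono (p : ℕ) : omegaF R i p ≤ omegaF R i (p + 2) :=
  Submodule.span_mono fun _ ⟨η, hη, z, e⟩ => ⟨η, wedgeF_mono i p hη, z, e⟩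

theorem eF_mono (p : ℕ) : eF R i p ≤ eF R i (p + 2) := fun x hx =>
  ⟨by
    have : ((p + 2 : ℕ) : ZMod 2) = p := by push_cast; exact add_eq_left.2 rfl
    rw [this]; exact hx.1,
   fun q => ⟨fun η h => wedgeF_mono i (q + p) ((hx.2 q).1 η h),
    fun ζ h => omegaF_mono i (q + p) ((hx.2 q).2 ζ h)⟩⟩

theorem eF_le_eFil (p : ℕ) : eF R i p ≤ eFil R i p := by
  cases p with
  | zero => exact le_rfl
  | succ p => exact le_sup_left

theorem eF_le_eFil_succ (p : ℕ) : eF R i p ≤ eFil R i (p + 1) := le_sup_right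

/-- `F_{◁p}` grows only in steps of two, since the parity is fixed. Passing from `F_p` to `F_{p+1}`,
the upper summand becomes the lower one, and the lower one is enlarged by a step of two. -/
theorem eFil_le_succ (p : ℕ) : eFil R i p ≤ eFil R i (p + 1) := by
  cases p with
  | zero => exact eF_le_eFil_succ i 0
  | succ p => exact sup_le (eF_le_eFil_succ i _) ((eF_mono i p).trans (eF_le_eFil i (p + 2)))

theorem eFil_mono : Monotone (eFil R i) := monotone_nat_of_le_succ (eFil_le_succ i)

/-- The action is a representation of graded Lie algebras. Homogeneity is required because the sign
depends on both degrees. -/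
theorem repW_brE {k l : ℤ} {x y : EAlg R} (hx : x ∈ degE R k) (hy : y ∈ degE R l) (η : Wedge R) :
    repW (brE x y) η = repW x (repW y η) - (-1 : ℝ) ^ (k * l) • repW y (repW x η) := by
  obtain ⟨x, hx, rfl⟩ := hx
  obtain ⟨y, hy, rfl⟩ := hy
  rw [brE_mk, repW_mk, repW_mk, repW_mk]
  induction hx using Submodule.span_induction with
  | zero => simp
  | add a b _ _ ha hb => simp only [map_add, LinearMap.add_apply, ha, hb, smul_add]; abel
  | smul c a _ ha => simp only [map_smul, LinearMap.smul_apply, ha]; module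
  | mem x hx =>
    obtain ⟨k, rfl, ω, hω, δ, rfl⟩ := hx
    induction hy using Submodule.span_induction with
    | zero => simp
    | add a b _ _ ha hb => simp only [map_add, LinearMap.add_apply, ha, hb, smul_add]; abel
    | smul c a _ ha => simp only [map_smul, LinearMap.smul_apply, ha]; module
    | mem y hy =>
      obtain ⟨l, rfl, ω', hω', δ', rfl⟩ := hy
      rw [← Nat.cast_mul, zpow_natCast]
      simp only [brL_tmul, map_add, map_sub, LinearMap.add_apply, LinearMap.sub_apply, repWL_tmul,
        comm_wact, wact_mul, mul_add, mul_sub, ← mul_assoc, smul_add]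
      -- The composition in the opposite order produces `ω'` in front. Graded commutativity moves it
      -- back and supplies the sign that matches the bracket.
      rw [wedge_comm' hω hω', wedge_comm' (wact_mem δ' hω) hω']
      simp only [smul_mul_assoc]
      abel

theorem repOm_brE {k l : ℤ} {x y : EAlg R} (hx : x ∈ degE R k) (hy : y ∈ degE R l)
    (ζ : Wedge R ⊗[R] Om R) :
    repOm (brE x y) ζ = repOm x (repOm y ζ) - (-1 : ℝ) ^ (k * l) • repOm y (repOm x ζ) := by
  obtain ⟨x, hx, rfl⟩ := hx
  obtain ⟨y, hy, rfl⟩ := hy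
  rw [brE_mk, repOm_mk, repOm_mk, repOm_mk]
  induction ζ using TensorProduct.induction_on with
  | zero => simp
  | add a b ha hb => simp only [map_add, ha, hb, smul_add]; abel
  | tmul η z =>
  induction hx using Submodule.span_induction with
  | zero => simp
  | add a b _ _ ha hb => simp only [map_add, LinearMap.add_apply, ha, hb, smul_add]; abel
  | smul c a _ ha => simp only [map_smul, LinearMap.smul_apply, ha]; module
  | mem x hx =>
    obtain ⟨k, rfl, ω, hω, δ, rfl⟩ := hx
    induction hy using Submodule.span_induction with
    | zero => simp
    | add a b _ _ ha hb => simp only [map_add, LinearMap.add_apply, ha, hb, smul_add]; abel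
    | smul c a _ ha => simp only [map_smul, LinearMap.smul_apply, ha]; module
    | mem y hy =>
      obtain ⟨l, rfl, ω', hω', δ', rfl⟩ := hy
      rw [← Nat.cast_mul, zpow_natCast]
      have ho : oact (comm δ δ') z = oact δ (oact δ' z) - oact δ' (oact δ z) :=
        Subtype.ext (comm_wact _ _ _)
      simp only [brL_tmul, map_add, map_sub, LinearMap.add_apply, LinearMap.sub_apply, repOmL_tmul,
        comm_wact, wact_mul, mul_add, mul_sub, ← mul_assoc, smul_add, ho, TensorProduct.add_tmul,
        TensorProduct.sub_tmul, TensorProduct.tmul_sub, real_smul_om]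
      rw [wedge_comm' hω hω', wedge_comm' (wact_mem δ' hω) hω']
      simp only [smul_mul_assoc]
      abel

/-- Operators that raise the index by `p` and by `q` compose to ones that raise it by `p + q`, in
either order; the bracket acts as a combination of the two compositions. -/
theorem eF_brE {k l : ℤ} {p q : ℕ} {x y : EAlg R} (hx : x ∈ degE R k) (hy : y ∈ degE R l)
    (hx' : x ∈ eF R i p) (hy' : y ∈ eF R i q) : brE x y ∈ eF R i (p + q) := by
  refine ⟨?_, fun n => ⟨fun η h => ?_, fun ζ h => ?_⟩⟩
  · rw [Nat.cast_add]; exact brE_mem_ePar i hx'.1 hy'.1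
  · rw [repW_brE hx hy]
    have h1 := (hx'.2 _).1 _ ((hy'.2 _).1 _ h)
    have h2 := (hy'.2 _).1 _ ((hx'.2 _).1 _ h)
    rw [add_assoc, add_comm q p] at h1
    rw [add_assoc] at h2
    exact sub_mem h1 (Submodule.smul_of_tower_mem _ _ h2)
  · rw [repOm_brE hx hy]
    have h1 := (hx'.2 _).2 _ ((hy'.2 _).2 _ h)
    have h2 := (hy'.2 _).2 _ ((hx'.2 _).2 _ h)
    rw [add_assoc, add_comm q p] at h1
    rw [add_assoc] at h2
    exact sub_mem h1 (Submodule.smul_of_tower_mem _ _ h2)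

/-- The definition of `F_p` gives two summands but does not say that they are homogeneous when their
sum is. This is needed for `eF_brE`. The alternative `z = 0` stands for `F_{◁-1} = 0`. -/
theorem eFil_split {p : ℕ} {k : ℤ} {x : EAlg R} (hx : x ∈ degE R k) (h : x ∈ eFil R i p) :
    ∃ y z, x = y + z ∧ y ∈ degE R k ∧ z ∈ degE R k ∧ y ∈ eF R i p ∧
      (z = 0 ∨ ∃ q, p = q + 1 ∧ z ∈ eF R i q) := by
  cases p with
  | zero => exact ⟨x, 0, (add_zero x).symm, hx, zero_mem _, h, Or.inl rfl⟩
  | succ p =>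
    obtain ⟨y, hy, z, hz, rfl⟩ := Submodule.mem_sup.1 h
    -- The two summands have opposite parity, so `y` is the projection of the sum onto an eigenspace
    -- of the reflection, and the reflection preserves degree.
    have e : y = (2⁻¹ : ℝ) • ((y + z) + sg ((p + 1 : ℕ) : ZMod 2) • (refl₁ R i).E (y + z)) := by
      have h1 : sg ((p + 1 : ℕ) : ZMod 2) = -sg (p : ZMod 2) := by
        rw [Nat.cast_add, sg_add, Nat.cast_one, show sg 1 = -1 from rfl, mul_neg_one]
      rw [map_add, (mem_ePar i).1 hy.1, (mem_ePar i).1 hz.1, h1]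
      rcases sg_cases (p : ZMod 2) with ⟨-, hs⟩ | ⟨-, hs⟩ <;> rw [hs] <;> module
    have hy' : y ∈ degE R k := by
      rw [e]
      exact Submodule.smul_mem _ _ (add_mem hx (Submodule.smul_of_tower_mem _ _ (E_mem _ hx)))
    exact ⟨y, z, rfl, hy', by simpa using sub_mem hx hy', hy, Or.inr ⟨p, rfl, hz⟩⟩

theorem eFil_brE {k l : ℤ} {p q : ℕ} {x y : EAlg R} (hx : x ∈ degE R k) (hy : y ∈ degE R l)
    (hx' : x ∈ eFil R i p) (hy' : y ∈ eFil R i q) : brE x y ∈ eFil R i (p + q) := by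
  obtain ⟨x, v, rfl, kx, kv, h, h'⟩ := eFil_split i hx hx'
  obtain ⟨y, w, rfl, ky, kw, g, g'⟩ := eFil_split i hy hy'
  simp only [map_add, LinearMap.add_apply]
  refine add_mem (add_mem ?_ ?_) (add_mem ?_ ?_)
  · exact eF_le_eFil i _ (eF_brE i kx ky h g)
  · rcases h' with rfl | ⟨p, rfl, h'⟩
    · simp
    · rw [add_right_comm]; exact eF_le_eFil_succ i _ (eF_brE i kv ky h' g)
  · rcases g' with rfl | ⟨q, rfl, g'⟩
    · simp
    · exact eF_le_eFil_succ i _ (eF_brE i kx kw h g')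
  · rcases h' with rfl | ⟨p, rfl, h'⟩
    · simp
    · rcases g' with rfl | ⟨q, rfl, g'⟩
      · simp
      -- The bracket of the two lower summands lies in `F_{◁(p+q)}`, two steps below the target and
      -- of the same parity.
      · have e : p + 1 + (q + 1) = p + q + 2 := by omega
        rw [e]
        exact eF_le_eFil i _ (eF_mono i _ (eF_brE i kv kw h' g'))

variable (R)

theorem bklAxis_mono {p q : ℕ} (h : p ≤ q) (k : ℤ) : bklAxis R i p k ≤ bklAxis R i q k :=
  Submodule.comap_mono (eFil_mono i h)

theorem bklAxis_two (k : ℤ) : bklAxis R i 2 k = ⊤ := 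
  eq_top_iff.2 fun _ _ => (eFil_two i).ge trivial

theorem bklAxis_br (p q : ℕ) {j k l : ℤ} (h : j + k = l) {x : (gE R).V j} {y : (gE R).V k}
    (hx : x ∈ bklAxis R i p j) (hy : y ∈ bklAxis R i q k) :
    (gE R).br h x y ∈ bklAxis R i (p + q) l :=
  eFil_brE i x.2 y.2 hx hy

theorem isGLAFiltration_bkl1 : IsGLAFiltration (gE R) (bkl1 R i) where
  mono h k := bklAxis_mono R i (h 0) k
  exhaustive := ⟨Finsupp.single 0 2, fun k => by simp [bkl1, bklAxis_two]⟩
  br_mem m n _ _ _ h _ hx _ hy := bklAxis_br R i (m 0) (n 0) h hx hy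

theorem isGLAFiltration_bkl2 : IsGLAFiltration (gE R) (bkl2 R) where
  mono h k := inf_le_inf (bklAxis_mono R 1 (h 0) k) (bklAxis_mono R 2 (h 1) k)
  exhaustive := ⟨Finsupp.equivFunOnFinite.symm fun _ => 2, fun k => by simp [bkl2, bklAxis_two]⟩
  br_mem m n _ _ _ h _ hx _ hy := ⟨bklAxis_br R 1 (m 0) (n 0) h hx.1 hy.1,
    bklAxis_br R 2 (m 1) (n 1) h hx.2 hy.2⟩

theorem isGLAFiltration_bkl3 : IsGLAFiltration (gE R) (bkl3 R) where
  mono h k := inf_le_inf (inf_le_inf (bklAxis_mono R 0 (h 0) k) (bklAxis_mono R 1 (h 1) k))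
    (bklAxis_mono R 2 (h 2) k)
  exhaustive := ⟨Finsupp.equivFunOnFinite.symm fun _ => 2, fun k => by simp [bkl3, bklAxis_two]⟩
  br_mem m n _ _ _ h _ hx _ hy := ⟨⟨bklAxis_br R 0 (m 0) (n 0) h hx.1.1 hy.1.1,
    bklAxis_br R 1 (m 1) (n 1) h hx.1.2 hy.1.2⟩, bklAxis_br R 2 (m 2) (n 2) h hx.2 hy.2⟩

end

/-! ### Invariance of the BKL filtrations under diagonal isomorphisms. -/

section
variable {R R' : Type u} [CommRing R] [Algebra ℝ R] [CommRing R'] [Algebra ℝ R']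
  (d : DiagIso R' R) (i : Fin 3)

/-- Because `Ψ` is diagonal, it commutes with the sign changes of the coordinates; a general
conformal isomorphism would mix `W₀` and `W₁`. -/
theorem W_mem_wPart {e : ZMod 2} {w : WMod R'} (h : w ∈ wPart R' i e) : d.W w ∈ wPart R i e := by
  rw [mem_wPart] at *
  ext a
  have := congrFun h a
  rw [refl₁_W_apply, Pi.smul_apply] at this
  rw [refl₁_W_apply, Pi.smul_apply, W_apply, ← mul_smul_comm, ← map_zsmul, this, map_zsmul,
    mul_smul_comm]

theorem refl₁_W_comm (h : WMod R') : (refl₁ R i).W (d.W h) = d.W ((refl₁ R' i).W h) := by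
  ext a
  rw [refl₁_W_apply, W_apply, W_apply, refl₁_W_apply, map_zsmul, mul_smul_comm]

theorem wedge_refl₁ (ω : Wedge R') :
    (refl₁ R i).wedge (d.wedge ω) = d.wedge ((refl₁ R' i).wedge ω) := by
  induction ω using ExteriorAlgebra.induction with
  | algebraMap r => simp only [wedge_algebraMap]; rfl
  | ι x => simp only [wedge_ι, refl₁_W_comm]
  | mul a b ha hb => simp only [map_mul, ha, hb]
  | add a b ha hb => simp only [map_add, ha, hb]

theorem wedge_mem_wedgePar {e : ZMod 2} {ω : Wedge R'} (h : ω ∈ wedgePar R' i e) :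
    d.wedge ω ∈ wedgePar R i e := by
  rw [mem_wedgePar] at *
  rw [wedge_refl₁, h, map_zsmul]

theorem der_isDerPar {e : ZMod 2} {δ : CDerEnd R'} (h : IsDerPar i e δ) :
    IsDerPar i e (d.der δ) := by
  intro c w hw
  have h1 : d.W.symm w ∈ wPart R' i c := by
    rw [← symm_W]; exact W_mem_wPart _ _ hw
  rw [der_op]
  exact W_mem_wPart _ _ (h c _ h1)

theorem E_mem_ePar {e : ZMod 2} {x : EAlg R'} (h : x ∈ ePar R' i e) : d.E x ∈ ePar R i e := by
  induction h using Submodule.span_induction with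
  | mem x hx =>
    obtain ⟨a, b, hab, ω, hω, δ, hδ, rfl⟩ := hx
    exact Submodule.subset_span ⟨a, b, hab, _, wedge_mem_wedgePar d i hω, _, der_isDerPar d i hδ, rfl⟩
  | zero => simp
  | add x y _ _ hx hy => rw [map_add]; exact add_mem hx hy
  | smul r x _ hx => rw [map_smul]; exact Submodule.smul_mem _ _ hx

/-- The preimage of a submodule under `∧W' → ∧W`. -/
def wedgeComap (M : Submodule R (Wedge R)) : Submodule R' (Wedge R') where
  carrier := {ω | d.wedge ω ∈ M}
  add_mem' hx hy := by
    simp only [Set.mem_ofPred_eq, map_add] at *; exact add_mem hx hy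
  zero_mem' := by simp
  smul_mem' r x hx := by
    simp only [Set.mem_ofPred_eq, wedge_smul] at *; exact Submodule.smul_mem _ _ hx

theorem mem_wedgeComap {M : Submodule R (Wedge R)} {ω : Wedge R'} :
    ω ∈ wedgeComap d M ↔ d.wedge ω ∈ M := Iff.rfl

theorem wedgeComap_mul_le (M N : Submodule R (Wedge R)) :
    wedgeComap d M * wedgeComap d N ≤ wedgeComap d (M * N) :=
  Submodule.mul_le.2 fun x hx y hy => by
    rw [mem_wedgeComap, map_mul]; exact Submodule.mul_mem_mul hx hy

theorem pow_le_wedgeComap (e : ZMod 2) (m : ℕ) : ((wPart R' i e).map (ExteriorAlgebra.ι R')) ^ m ≤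
    wedgeComap d (((wPart R i e).map (ExteriorAlgebra.ι R)) ^ m) := by
  induction m with
  | zero =>
    rw [pow_zero, pow_zero, Submodule.one_le, mem_wedgeComap, map_one]
    exact Submodule.one_le.1 le_rfl
  | succ m ih =>
    rw [pow_succ, pow_succ]
    refine (mul_le_mul' ih ?_).trans (wedgeComap_mul_le d _ _)
    rintro _ ⟨w, hw, rfl⟩
    rw [mem_wedgeComap, wedge_ι]
    exact ⟨_, W_mem_wPart d i hw, rfl⟩

theorem wedgeBi_le_comap (k : ℕ) : wedgeBi R' i k ≤ wedgeComap d (wedgeBi R i k) :=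
  iSup_le fun m => (mul_le_mul' (pow_le_wedgeComap d i 0 m) (pow_le_wedgeComap d i 1 k)).trans
    ((wedgeComap_mul_le d _ _).trans fun _ hx => Submodule.mem_iSup_of_mem m hx)

theorem wedge_mem_wedgeF {p : ℕ} {ω : Wedge R'} (h : ω ∈ wedgeF R' i p) :
    d.wedge ω ∈ wedgeF R i p := by
  suffices hs : wedgeF R' i p ≤ wedgeComap d (wedgeF R i p) from hs h
  refine iSup₂_le fun k hk => (wedgeBi_le_comap d i k).trans fun x hx => ?_
  exact (le_iSup₂_of_le (f := fun k _ => wedgeBi R i k) k hk le_rfl : _ ≤ wedgeF R i p) hx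

theorem om_mem_omegaF {p : ℕ} {ζ : Wedge R' ⊗[R'] Om R'} (h : ζ ∈ omegaF R' i p) :
    d.om ζ ∈ omegaF R i p :=
  omegaF_induction i (P := fun ζ => d.om ζ ∈ omegaF R i p) h (by simp) (fun x y hx hy => by rw [map_add]; exact add_mem hx hy)
    fun _ hη z => Submodule.subset_span ⟨_, wedge_mem_wedgeF d i hη, d.omega z, rfl⟩

/-- The condition tests all elements of the target modules. Each is pulled back along the inverse,
which is again diagonal and preserves the filtration; there the hypothesis applies, and the result
is pushed forward. -/
theorem E_mem_eF {p : ℕ} {x : EAlg R'} (h : x ∈ eF R' i p) : d.E x ∈ eF R i p := by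
  refine ⟨E_mem_ePar d i h.1, fun q => ⟨fun η hη => ?_, fun ζ hζ => ?_⟩⟩
  · rw [← d.wedge_symm η, ← wedge_repW]
    exact wedge_mem_wedgeF d i ((h.2 q).1 _ (wedge_mem_wedgeF _ i hη))
  · rw [← d.om_symm ζ, ← om_repOm]
    exact om_mem_omegaF d i ((h.2 q).2 _ (om_mem_omegaF _ i hζ))

theorem E_mem_eFil {p : ℕ} {x : EAlg R'} (h : x ∈ eFil R' i p) : d.E x ∈ eFil R i p := by
  cases p with
  | zero => exact E_mem_eF d i h
  | succ p =>
    obtain ⟨y, hy, z, hz, rfl⟩ := Submodule.mem_sup.1 h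
    rw [map_add]
    exact add_mem (Submodule.mem_sup_left (E_mem_eF d i hy))
      (Submodule.mem_sup_right (E_mem_eF d i hz))

theorem gla_mem_bklAxis {p : ℕ} {k : ℤ} {x : (gE R').V k} (h : x ∈ bklAxis R' i p k) :
    GLA.ap d.gla k x ∈ bklAxis R i p k := E_mem_eFil d i h

theorem gla_mem_bkl1 (n : Fin 1 →₀ ℕ) (k : ℤ) (x : (gE R').V k) (h : x ∈ bkl1 R' i n k) :
    GLA.ap d.gla k x ∈ bkl1 R i n k := gla_mem_bklAxis d i h

theorem gla_mem_bkl2 (n : Fin 2 →₀ ℕ) (k : ℤ) (x : (gE R').V k) (h : x ∈ bkl2 R' n k) :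
    GLA.ap d.gla k x ∈ bkl2 R n k := ⟨gla_mem_bklAxis d 1 h.1, gla_mem_bklAxis d 2 h.2⟩

theorem gla_mem_bkl3 (n : Fin 3 →₀ ℕ) (k : ℤ) (x : (gE R').V k) (h : x ∈ bkl3 R' n k) :
    GLA.ap d.gla k x ∈ bkl3 R n k :=
  ⟨⟨gla_mem_bklAxis d 0 h.1.1, gla_mem_bklAxis d 1 h.1.2⟩, gla_mem_bklAxis d 2 h.2⟩

end

/-! ### Functoriality of Rees algebras and associated gradeds. -/

section
variable {σ : Type} [DecidableEq σ]

namespace FiltGLA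

/-- The map of Rees algebras induced by a morphism. -/
def reesMap {G H : FiltGLA.{u} σ} (f : G ⟶ H) : rees G ⟶ rees H :=
  GLA.Hom.mk (G := rees G) (H := rees H)
    (fun k => (GLA.ap (GLA.powerSeriesMap σ f.hom) k).restrict
      fun _ hx n => f.map_F n k _ (hx n))
    (fun h x y => Subtype.ext
      (GLA.Hom.map_br (GLA.powerSeriesMap σ f.hom) h x.1 y.1))

theorem reesMap_coe {G H : FiltGLA.{u} σ} (f : G ⟶ H) {k : ℤ} (x : (rees G).V k) (n : σ →₀ ℕ) :
    (GLA.ap (reesMap f) k x).1 n = GLA.ap f.hom k (x.1 n) := rfl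

/-- The induced map acts on each coefficient separately, and multiplication by a symbol only
relocates coefficients. This makes the map descend modulo the symbols. -/
theorem reesMap_shift {G H : FiltGLA.{u} σ} (f : G ⟶ H) (i : σ) (k : ℤ) (x : (rees G).V k) :
    GLA.ap (reesMap f) k (shift G i k x) = shift H i k (GLA.ap (reesMap f) k x) := by
  refine Subtype.ext (funext fun n => ?_)
  rw [reesMap_coe, shift_apply, shift_apply, reesMap_coe]
  split_ifs
  · exact map_zero _
  · rfl

theorem reesMap_symIdeal {G H : FiltGLA.{u} σ} (f : G ⟶ H) (k : ℤ) :
    symIdeal G k ≤ (symIdeal H k).comap (GLA.ap (reesMap f) k) := by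
  refine iSup_le fun i => ?_
  rintro _ ⟨x, rfl⟩
  rw [Submodule.mem_comap, reesMap_shift]
  exact Submodule.mem_iSup_of_mem i ⟨_, rfl⟩

/-- The map of associated gradeds induced by a morphism. -/
def grMap {G H : FiltGLA.{u} σ} (f : G ⟶ H) : gr G ⟶ gr H :=
  GLA.Hom.mk (G := gr G) (H := gr H)
    (fun k => (symIdeal G k).mapQ (symIdeal H k) (GLA.ap (reesMap f) k) (reesMap_symIdeal f k))
    (fun {i j k} h x y => by
      obtain ⟨x, rfl⟩ := grMk_surjective G _ x
      obtain ⟨y, rfl⟩ := grMk_surjective G _ y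
      exact congrArg (grMk H k) (GLA.Hom.map_br (reesMap f) h x y))

theorem reesMap_id (G : FiltGLA.{u} σ) : reesMap (𝟙 G) = 𝟙 _ := rfl

theorem reesMap_comp {G H K : FiltGLA.{u} σ} (f : G ⟶ H) (g : H ⟶ K) :
    reesMap (f ≫ g) = reesMap f ≫ reesMap g := rfl

theorem grMap_id (G : FiltGLA.{u} σ) : grMap (𝟙 G) = 𝟙 _ :=
  GLA.Hom.ext (funext fun k => LinearMap.ext fun x => by
    obtain ⟨x, rfl⟩ := grMk_surjective G _ x
    rfl)

theorem grMap_comp {G H K : FiltGLA.{u} σ} (f : G ⟶ H) (g : H ⟶ K) :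
    grMap (f ≫ g) = grMap f ≫ grMap g :=
  GLA.Hom.ext (funext fun k => LinearMap.ext fun x => by
    obtain ⟨x, rfl⟩ := grMk_surjective G _ x
    rfl)

/-- The inverse is required to respect the filtration as well; its images under the three
constructions are then the inverses. The two compatibility squares hold by definition. -/
theorem inducesIsos {G H : FiltGLA.{u} σ} (u : G ≅ H) : InducesIsos G H u.hom.hom := by
  refine ⟨⟨GLA.powerSeriesMap σ u.inv.hom, ?_, ?_⟩,
    ⟨reesMap u.hom, reesMap u.inv, ?_, ?_⟩, ⟨grMap u.hom, grMap u.inv, ?_, ?_⟩, rfl, rfl⟩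
  · exact congrArg (fun f : G ⟶ G => GLA.powerSeriesMap σ f.hom) u.hom_inv_id
  · exact congrArg (fun f : H ⟶ H => GLA.powerSeriesMap σ f.hom) u.inv_hom_id
  · rw [← reesMap_comp, u.hom_inv_id, reesMap_id]
  · rw [← reesMap_comp, u.inv_hom_id, reesMap_id]
  · rw [← grMap_comp, u.hom_inv_id, grMap_id]
  · rw [← grMap_comp, u.inv_hom_id, grMap_id]

end FiltGLA
end

/-! ### Hadamard's lemma. -/

section Hadamard
open scoped ContDiff Topology
open MeasureTheory

theorem hasFDerivAt_integral_unit {E F : Type} [NormedAddCommGroup E] [NormedSpace ℝ E] [ProperSpace E]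
    [NormedAddCommGroup F] [NormedSpace ℝ F] {G : E × ℝ → F} (hG : ContDiff ℝ 1 G) (x : E) :
    HasFDerivAt (fun x => ∫ s in (0 : ℝ)..1, G (x, s))
      (∫ s in (0 : ℝ)..1, (fderiv ℝ G (x, s)).comp (ContinuousLinearMap.inl ℝ E ℝ)) x := by
  have hc : Continuous fun p : E × ℝ => (fderiv ℝ G p).comp (ContinuousLinearMap.inl ℝ E ℝ) :=
    (hG.continuous_fderiv (by norm_num)).clm_comp continuous_const
  -- Compactness of the ball times `[0,1]` gives a constant that dominates the derivative of the
  -- integrand, as differentiation under the integral requires.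
  obtain ⟨C, hC⟩ := ((isCompact_closedBall x 1).prod
    (isCompact_Icc (a := (0 : ℝ)) (b := 1))).exists_bound_of_continuousOn hc.continuousOn
  have hsec : ∀ y : E, Continuous fun s : ℝ => (y, s) := fun y => by fun_prop
  refine intervalIntegral.hasFDerivAt_integral_of_dominated_of_fderiv_le
    (F := fun y s => G (y, s))
    (F' := fun y s => (fderiv ℝ G (y, s)).comp (ContinuousLinearMap.inl ℝ E ℝ))
    (bound := fun _ => C)
    (Metric.closedBall_mem_nhds x one_pos) (Filter.Eventually.of_forall fun y => ?_) ?_ ?_ ?_ ?_ ?_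
  · exact (hG.continuous.comp (hsec y)).aestronglyMeasurable
  · exact (hG.continuous.comp (hsec x)).intervalIntegrable _ _
  · exact (hc.comp (hsec x)).aestronglyMeasurable
  · refine Filter.Eventually.of_forall fun s hs y hy => hC (y, s) ⟨hy, ?_⟩
    rw [Set.uIoc_of_le zero_le_one] at hs
    exact ⟨hs.1.le, hs.2⟩
  · exact intervalIntegrable_const
  · refine Filter.Eventually.of_forall fun s _ y _ => ?_
    exact ((hG.differentiable (by norm_num)) (y, s)).hasFDerivAt.comp y
      (hasFDerivAt_prodMk_left y s)

/-- The derivative of the integral is an integral of the same kind with values in a space of linear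
maps, so the induction runs over all target spaces `F` at once. -/
theorem contDiff_nat_integral_unit {E : Type} [NormedAddCommGroup E] [NormedSpace ℝ E] [ProperSpace E]
    (n : ℕ) : ∀ {F : Type} [NormedAddCommGroup F] [NormedSpace ℝ F] {G : E × ℝ → F},
    ContDiff ℝ n G → ContDiff ℝ n (fun x => ∫ s in (0 : ℝ)..1, G (x, s)) := by
  induction n with
  | zero =>
    intro F _ _ G hG
    rw [Nat.cast_zero, contDiff_zero] at *
    exact intervalIntegral.continuous_parametric_intervalIntegral_of_continuous'
      (f := fun x s => G (x, s)) hG 0 1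
  | succ n ih =>
    intro F _ _ G hG
    rw [Nat.cast_succ] at *
    rw [contDiff_succ_iff_hasFDerivAt]
    exact ⟨_, ih ((hG.fderiv_right le_rfl).clm_comp contDiff_const),
      hasFDerivAt_integral_unit (hG.of_le (by simp))⟩

theorem contDiff_integral_unit {E F : Type} [NormedAddCommGroup E] [NormedSpace ℝ E] [ProperSpace E]
    [NormedAddCommGroup F] [NormedSpace ℝ F] {G : E × ℝ → F} (hG : ContDiff ℝ ∞ G) :
    ContDiff ℝ ∞ (fun x => ∫ s in (0 : ℝ)..1, G (x, s)) :=
  contDiff_infty.2 fun n => contDiff_nat_integral_unit n (contDiff_infty.1 hG n)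

/-- Hadamard's lemma. -/
theorem exists_hadamard {E : Type} [NormedAddCommGroup E] [NormedSpace ℝ E] [ProperSpace E]
    {f : E → ℝ} (hf : ContDiff ℝ ∞ f) (p : E) :
    ∃ g : E → E →L[ℝ] ℝ, ContDiff ℝ ∞ g ∧ ∀ x, f x = f p + g x (x - p) := by
  have hc : ContDiff ℝ ∞ fun y : E × ℝ => fderiv ℝ f (p + y.2 • (y.1 - p)) :=
    (hf.fderiv_right (m := ∞) (by simp)).comp (by fun_prop)
  refine ⟨fun x => ∫ s in (0 : ℝ)..1, fderiv ℝ f (p + s • (x - p)), contDiff_integral_unit hc,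
    fun x => ?_⟩
  have hci : Continuous fun s : ℝ => fderiv ℝ f (p + s • (x - p)) :=
    hc.continuous.comp (by fun_prop : Continuous fun s : ℝ => (x, s))
  rw [ContinuousLinearMap.intervalIntegral_apply (hci.intervalIntegrable _ _)]
  have hd : ∀ s : ℝ, HasDerivAt (fun s : ℝ => f (p + s • (x - p)))
      (fderiv ℝ f (p + s • (x - p)) (x - p)) s := by
    intro s
    have h1 : HasDerivAt (fun s : ℝ => p + s • (x - p)) (x - p) s := by
      simpa using ((hasDerivAt_id s).smul_const (x - p)).const_add p
    exact ((hf.differentiable (by simp)) _).hasFDerivAt.comp_hasDerivAt s h1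
  rw [intervalIntegral.integral_eq_sub_of_hasDerivAt (fun s _ => hd s)
    ((hci.clm_apply continuous_const).intervalIntegrable _ _)]
  simp

end Hadamard

/-! ### Derivations of smooth functions on `ℝ × S`. -/

namespace Base
open scoped Manifold ContDiff

variable (B : Base.{u})

/-- A diffeomorphism onto Euclidean space. -/
def psi : B.S ≃ₘ⟮𝓘(ℝ, E3), 𝓘(ℝ, E3)⟯ E3 := Classical.choice B.diffeo

/-- A function on `ℝ × S` in coordinates. -/
def toE (f : B.CM) (y : ℝ × E3) : ℝ := f (y.1, B.psi.symm y.2)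

theorem contDiff_toE (f : B.CM) : ContDiff ℝ ∞ (B.toE f) := by
  have h1 : ContMDiff 𝓘(ℝ, ℝ × E3) 𝓘(ℝ, ℝ) ∞ (Prod.fst : ℝ × E3 → ℝ) := contDiff_fst.contMDiff
  have h2 : ContMDiff 𝓘(ℝ, ℝ × E3) 𝓘(ℝ, E3) ∞ (Prod.snd : ℝ × E3 → E3) := contDiff_snd.contMDiff
  exact (f.2.comp (h1.prodMk (B.psi.symm.contMDiff.comp h2))).contDiff

/-- A smooth function of the coordinates as a function on `ℝ × S`. -/
def ofE (g : ℝ × E3 → ℝ) (hg : ContDiff ℝ ∞ g) : B.CM :=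
  ⟨fun p => g (p.1, B.psi p.2), hg.contMDiff.comp
    (contMDiff_fst.prodMk_space (B.psi.contMDiff.comp contMDiff_snd))⟩

theorem toE_apply (f : B.CM) (p : ℝ × B.S) : B.toE f (p.1, B.psi p.2) = f p := by
  simp [toE]

/-- The coordinate functions on `S`. -/
def coord (i : Fin 3) : B.CS :=
  ⟨fun x => B.psi x i, ((EuclideanSpace.proj (𝕜 := ℝ) i : E3 →L[ℝ] ℝ).contDiff.contMDiff).comp
    B.psi.contMDiff⟩

/-- Evaluation at a point of `ℝ × S`. -/
def ev (p : ℝ × B.S) : B.CM →ₐ[ℝ] ℝ where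
  toFun f := f p
  map_zero' := rfl
  map_one' := rfl
  map_add' _ _ := rfl
  map_mul' _ _ := rfl
  commutes' _ := rfl

/-- Evaluation at a point of `S`. -/
def evS (x : B.S) : B.CS →ₐ[ℝ] ℝ where
  toFun f := f x
  map_zero' := rfl
  map_one' := rfl
  map_add' _ _ := rfl
  map_mul' _ _ := rfl
  commutes' _ := rfl

/-- Restriction to a level of `t`. -/
def res (t₀ : ℝ) : B.CM →ₐ[ℝ] B.CS where
  toFun f := ⟨fun x => f (t₀, x), f.2.comp (contMDiff_const.prodMk contMDiff_id)⟩
  map_zero' := rfl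
  map_one' := rfl
  map_add' _ _ := rfl
  map_mul' _ _ := rfl
  commutes' _ := rfl

variable {B}

theorem cm_ext {f g : B.CM} (h : ∀ p, B.ev p f = B.ev p g) : f = g :=
  ContMDiffMap.ext h

theorem ev_pr (p : ℝ × B.S) (g : B.CS) : B.ev p (B.pr g) = B.evS p.2 g := rfl
theorem evS_res (t₀ : ℝ) (x : B.S) (g : B.CM) : B.evS x (B.res t₀ g) = B.ev (t₀, x) g := rfl
theorem res_pr (t₀ : ℝ) (g : B.CS) : B.res t₀ (B.pr g) = g := rfl
theorem res_t (t₀ : ℝ) : B.res t₀ B.t = algebraMap ℝ _ t₀ := rfl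
theorem ev_t (p : ℝ × B.S) : B.ev p B.t = p.1 := rfl

theorem euclid_eq_sum (v : E3) : v = ∑ i, v i • EuclideanSpace.single i (1 : ℝ) := by
  ext j; simp [Finset.sum_apply, Pi.single_apply]

/-- Hadamard's lemma on `ℝ × S`. -/
theorem exists_eq_add_sum (f : B.CM) (p : ℝ × B.S) : ∃ (h₀ : B.CM) (h : Fin 3 → B.CM),
    f = algebraMap ℝ _ (B.ev p f) + (B.t - algebraMap ℝ _ p.1) * h₀ +
      ∑ i, (B.pr (B.coord i) - algebraMap ℝ _ (B.evS p.2 (B.coord i))) * h i := by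
  obtain ⟨g, hg, e⟩ := exists_hadamard (B.contDiff_toE f) (p.1, B.psi p.2)
  refine ⟨B.ofE (fun y => g y (1, 0)) (hg.clm_apply contDiff_const), fun i =>
    B.ofE (fun y => g y (0, EuclideanSpace.single i 1)) (hg.clm_apply contDiff_const),
    cm_ext fun q => ?_⟩
  have e := e (q.1, B.psi q.2)
  rw [toE_apply, toE_apply] at e
  have hv : ((q.1, B.psi q.2) - (p.1, B.psi p.2) : ℝ × E3) = (q.1 - p.1) • ((1, 0) : ℝ × E3) +
      ∑ i, (B.psi q.2 i - B.psi p.2 i) • ((0, EuclideanSpace.single i 1) : ℝ × E3) := by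
    refine Prod.ext ?_ ?_
    · simp [Prod.fst_sum]
    · have := euclid_eq_sum (B.psi q.2 - B.psi p.2)
      simpa [Prod.snd_sum] using this
  rw [hv, map_add, map_smul, map_sum] at e
  simp only [map_smul, smul_eq_mul] at e
  simp only [map_add, map_mul, map_sub, map_sum, AlgHom.commutes, ev_t, ev_pr]
  exact e.trans (add_assoc _ _ _).symm

/-- The coordinate vector fields tangent to `S`. -/
def partialS (i : Fin 3) : Derivation ℝ B.CM B.CM :=
  Derivation.mk'
    { toFun := fun f => B.ofE (fun y => fderiv ℝ (B.toE f) y (0, EuclideanSpace.single i 1))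
        (((B.contDiff_toE f).fderiv_right (m := ∞) (by simp)).clm_apply contDiff_const)
      map_add' := fun f g => by
        ext p
        have h := ((B.contDiff_toE f).differentiable (by simp) (p.1, B.psi p.2)).hasFDerivAt.add
          ((B.contDiff_toE g).differentiable (by simp) (p.1, B.psi p.2)).hasFDerivAt
        exact congrArg (fun L : ℝ × E3 →L[ℝ] ℝ => L (0, EuclideanSpace.single i 1)) h.fderiv
      map_smul' := fun c f => by
        ext p
        have h := ((B.contDiff_toE f).differentiable (by simp)
          (p.1, B.psi p.2)).hasFDerivAt.const_smul c
        exact congrArg (fun L : ℝ × E3 →L[ℝ] ℝ => L (0, EuclideanSpace.single i 1)) h.fderiv }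
    (fun f g => by
      ext p
      have h := ((B.contDiff_toE f).differentiable (by simp) (p.1, B.psi p.2)).hasFDerivAt.mul
        ((B.contDiff_toE g).differentiable (by simp) (p.1, B.psi p.2)).hasFDerivAt
      have h' := congrArg (fun L : ℝ × E3 →L[ℝ] ℝ => L (0, EuclideanSpace.single i 1)) h.fderiv
      refine Eq.trans h' ?_
      rw [toE_apply, toE_apply]
      rfl)

theorem partialS_apply (i : Fin 3) (f : B.CM) (p : ℝ × B.S) : B.ev p (partialS i f) =
    fderiv ℝ (B.toE f) (p.1, B.psi p.2) (0, EuclideanSpace.single i 1) := rfl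

theorem partialS_t (i : Fin 3) : partialS i B.t = 0 := by
  refine cm_ext fun p => ?_
  rw [partialS_apply, map_zero]
  have h : HasFDerivAt (B.toE B.t) (ContinuousLinearMap.fst ℝ ℝ E3) (p.1, B.psi p.2) :=
    hasFDerivAt_fst
  rw [h.fderiv]; rfl

theorem partialS_coord (i j : Fin 3) :
    partialS i (B.pr (B.coord j)) = if i = j then 1 else 0 := by
  refine cm_ext fun p => ?_
  rw [partialS_apply]
  have e : B.toE (B.pr (B.coord j)) =
      ((EuclideanSpace.proj (𝕜 := ℝ) j : E3 →L[ℝ] ℝ).comp (ContinuousLinearMap.snd ℝ ℝ E3)) := by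
    funext y
    change B.psi (B.psi.symm y.2) j = y.2 j
    rw [Diffeomorph.apply_symm_apply]
  rw [e, ContinuousLinearMap.fderiv]
  split_ifs with h
  · subst h; simp
  · simp [Ne.symm h]

/-- Expand `f` at `p`. After the Leibniz rule the terms containing derivatives of the coefficients
are multiplied by functions that vanish at `p`, and the others contain `Z` of a coordinate. -/
theorem derivation_eq_zero {Z : Derivation ℝ B.CM B.CM} (ht : Z B.t = 0)
    (hc : ∀ i, Z (B.pr (B.coord i)) = 0) : Z = 0 := by
  refine Derivation.ext fun f => cm_ext fun p => ?_
  obtain ⟨h₀, h, e⟩ := exists_eq_add_sum f p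
  rw [e]
  simp [Derivation.leibniz, ht, hc, ev_t, ev_pr]

theorem derivation_ext {Y Z : Derivation ℝ B.CM B.CM} (ht : Y B.t = Z B.t)
    (hc : ∀ g, Y (B.pr g) = Z (B.pr g)) : Y = Z :=
  sub_eq_zero.1 (derivation_eq_zero (by simp [ht]) fun i => by simp [hc])

theorem exists_isExt (X : Derivation ℝ B.CS B.CS) : ∃ Y, B.IsExt X Y := by
  -- The extension has, at every time, the components `X(xᵢ)` in the coordinates of `S` and no
  -- component along `t`.
  refine ⟨∑ i, B.pr (X (B.coord i)) • partialS i, ?_, fun g => cm_ext fun p => ?_⟩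
  · simp [Fin.sum_univ_three, partialS_t]
  · obtain ⟨h₀, h, e⟩ := exists_eq_add_sum (B.pr g) p
    have e1 : ∀ i, B.ev p (partialS i (B.pr g)) = B.ev p (h i) := by
      intro i
      rw [e]
      simp [Derivation.leibniz, partialS_t, partialS_coord, ev_t, ev_pr, Finset.sum_add_distrib]
    -- Restriction to the slice through `p` removes the term with `t` and turns the expansion of `g`
    -- into an identity on `S`, to which `X` can be applied.
    have e2 : B.evS p.2 (X g) = ∑ i, B.ev p (h i) * B.evS p.2 (X (B.coord i)) := by
      have e3 := congrArg (B.res p.1) e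
      rw [res_pr] at e3
      rw [e3]
      simp [Derivation.leibniz, res_t, res_pr, evS_res]
    rw [ev_pr, e2]
    simp [Fin.sum_univ_three, e1, ev_pr, mul_comm]

theorem existsUnique_isExt (X : Derivation ℝ B.CS B.CS) : ∃! Y, B.IsExt X Y := by
  obtain ⟨Y, hY⟩ := exists_isExt X
  exact ⟨Y, hY, fun Z hZ => derivation_ext (hZ.1.trans hY.1.symm)
    fun g => (hZ.2 g).trans (hY.2 g).symm⟩

end Base

/-! ### Conjugation of the generators `σ₀`, `σᵢ`, `σᵢⱼ` and of lifted vector fields. -/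

section
variable {R R' : Type u} [CommRing R] [Algebra ℝ R] [CommRing R'] [Algebra ℝ R']

theorem op_sig0 (w : WMod R) : (sig0 : CDerEnd R).op w = w := rfl
theorem op_sigB (i : Fin 3) (w : WMod R) :
    (sigB i).op w = w 0 • th i.succ + w i.succ • th 0 := rfl
theorem op_sigR (i j : Fin 3) (w : WMod R) :
    (sigR i j).op w = w j.succ • th i.succ - w i.succ • th j.succ := rfl
theorem op_sub (δ ε : CDerEnd R) (w : WMod R) : (δ - ε).op w = δ.op w - ε.op w := rfl
theorem op_smul_apply (f : R) (δ : CDerEnd R) (w : WMod R) : (f • δ).op w = f • δ.op w := rfl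
theorem op_lift (X : Derivation ℝ R R) (w : WMod R) (a : Fin 4) :
    (CDerEnd.lift X).op w a = X (w a) := rfl

theorem lift_sub_smul (X Y : Derivation ℝ R R) (f : R) :
    CDerEnd.lift (X - f • Y) = CDerEnd.lift X - f • CDerEnd.lift Y :=
  ext_op fun _ => rfl

variable (τ : R' ≃ₐ[ℝ] R) (c : Rˣ)

theorem wPull_apply (w : WMod R') (a : Fin 4) : wPull τ c w a = c * τ (w a) := rfl

theorem wPull_th (a : Fin 4) : wPull τ c (th a) = (c : R) • th a :=
  (DiagIso.ofConst τ c).W_th a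

/-- Testing on vectors of the form `Ψw` avoids the inverse of `Ψ`. -/
theorem derPull_eq {δ : CDerEnd R'} {ε : CDerEnd R}
    (h : ∀ w, ε.op (wPull τ c w) = wPull τ c (δ.op w)) : derPull τ c δ = ε :=
  ext_op fun w => by
    obtain ⟨w, rfl⟩ := (wPull τ c).surjective w
    exact ((DiagIso.ofConst τ c).der_op_W δ w).trans (h w).symm

theorem derPull_sig0 : derPull τ c sig0 = sig0 := derPull_eq τ c fun _ => rfl

theorem derPull_sigB (i : Fin 3) : derPull τ c (sigB i) = sigB i := derPull_eq τ c fun w => by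
  simp only [op_sigB, map_add, wPull_smul, wPull_th, wPull_apply, smul_smul, mul_comm]

theorem derPull_sigR (i j : Fin 3) : derPull τ c (sigR i j) = sigR i j :=
  derPull_eq τ c fun w => by
    simp only [op_sigR, map_sub, wPull_smul, wPull_th, wPull_apply, smul_smul, mul_comm]

/-- The lift of the transported field also differentiates the factor in `cτ(w)`. The surplus
`X(c)τ(w)` is `c⁻¹X(c)` times the vector itself, a multiple of `σ₀`. -/
theorem derPull_lift (X : Derivation ℝ R' R') : derPull τ c (CDerEnd.lift X) =
    CDerEnd.lift (vecPull τ X) - ((c⁻¹ : Rˣ) * vecPull τ X c) • sig0 :=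
  derPull_eq τ c fun w => by
    ext a
    have h : vecPull τ X (τ (w a)) = τ (X (w a)) := by rw [vecPull_apply, AlgEquiv.symm_apply_apply]
    rw [op_sub, op_smul_apply, op_sig0, Pi.sub_apply, op_lift, Pi.smul_apply, wPull_apply,
      wPull_apply, op_lift, Derivation.leibniz, h, smul_eq_mul, smul_eq_mul, smul_eq_mul]
    linear_combination -(vecPull τ X c * τ (w a)) * c.mul_inv

end

/-! ### The functor on the groupoid and the explicit formulas. -/

namespace Base
open scoped Manifold ContDiff

variable {B B' B'' : Base.{u}}

theorem D0_pr (g : B.CS) : B.D0 (B.pr g) = 0 :=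
  ContMDiffMap.ext fun p => deriv_const p.1 (g p.2)

theorem D0_t : B.D0 B.t = 1 := ContMDiffMap.ext fun p => deriv_id p.1

theorem tau_pr (f : B ⟶ B') (g : B'.CS) : tau f (B'.pr g) = B.pr (pb (Hom.φ f) g) := rfl

theorem tau_t (f : B ⟶ B') : tau f B'.t = B.pr (Hom.a f) * B.t + B.pr (Hom.b f) := rfl

theorem pr_recip_mul (a : B.CS) (h : ∀ x, 0 < a x) : B.pr (recip a h) * B.pr a = 1 := by
  rw [← map_mul, ← map_one B.pr]
  exact congrArg B.pr (by ext x; exact inv_mul_cancel₀ (h x).ne')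

/-- Chain rule: at fixed `x`, `Φ` is affine in `t` with slope `a(x)`. -/
theorem D0_tau (f : B ⟶ B') (h : B'.CM) :
    B.D0 (tau f h) = B.pr (Hom.a f) * tau f (B'.D0 h) := by
  ext p
  have h1 := B'.hasDerivAt_dt h (Phi f p)
  have h2 : HasDerivAt (fun s => Hom.a f p.2 * s + Hom.b f p.2) (Hom.a f p.2) p.1 := by
    simpa using ((hasDerivAt_id p.1).const_mul (Hom.a f p.2)).add_const (Hom.b f p.2)
  have h3 : HasDerivAt (fun s => h (s, Hom.φ f p.2))
    (deriv (fun s => h (s, Hom.φ f p.2)) (Hom.a f p.2 * p.1 + Hom.b f p.2))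
    (Hom.a f p.2 * p.1 + Hom.b f p.2) := h1
  have h4 := (h3.comp p.1 h2).deriv
  exact h4.trans (mul_comm _ _)

/-- The transported field is compared with `Z` after moving `Z` back to the target manifold. There
`derivation_ext` applies literally to `t` and to functions from `S'`, whose pullbacks are the ones
tested. -/
theorem vecPull_eq (f : B ⟶ B') {Y : Derivation ℝ B'.CM B'.CM} {Z : Derivation ℝ B.CM B.CM}
    (ht : Z (tau f B'.t) = tau f (Y B'.t))
    (hp : ∀ g, Z (tau f (B'.pr g)) = tau f (Y (B'.pr g))) : vecPull (tau f) Y = Z := by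
  have key : vecPull (tau f).symm Z = Y := by
    refine derivation_ext ?_ fun g => ?_
    · exact (congrArg (tau f).symm ht).trans ((tau f).symm_apply_apply _)
    · exact (congrArg (tau f).symm (hp g)).trans ((tau f).symm_apply_apply _)
  refine Derivation.ext fun g => ?_
  rw [← key, vecPull_apply]
  change tau f ((tau f).symm (Z (tau f ((tau f).symm g)))) = _
  rw [AlgEquiv.apply_symm_apply, AlgEquiv.apply_symm_apply]

theorem vecPull_D0 (f : B ⟶ B') :
    vecPull (tau f) B'.D0 = B.pr (recip _ (Hom.a_pos f)) • B.D0 := by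
  refine Derivation.ext fun g => ?_
  obtain ⟨g, rfl⟩ := (tau f).surjective g
  rw [vecPull_apply, AlgEquiv.symm_apply_apply, Derivation.smul_apply, D0_tau, smul_eq_mul,
    ← mul_assoc, pr_recip_mul, one_mul]

/-- There is no term in `σ₀` because `c` does not depend on `t`. -/
theorem derMap_D0hat (f : B ⟶ B') :
    derMap f B'.D0hat = B.pr (recip _ (Hom.a_pos f)) • B.D0hat := by
  have h := derPull_lift (tau f) (cUnit f) B'.D0
  have hc : B.D0 (cUnit f) = 0 := D0_pr _
  rw [vecPull_D0, Derivation.smul_apply, hc, smul_zero, mul_zero, zero_smul, sub_zero] at h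
  exact h

/-- The transported field must annihilate `Φ^*t = at + b` and agree with `X` on functions from `S`.
Since `D₀(at + b) = a`, subtracting `a⁻¹X(at + b)D₀` achieves the first, and `D₀` does not disturb
the second. -/
theorem derMap_lift_of_φ_eq_refl (f : B ⟶ B) (hφ : Hom.φ f = Diffeomorph.refl _ _ _)
    {X : Derivation ℝ B.CS B.CS} {Y : Derivation ℝ B.CM B.CM} (h : B.IsExt X Y) :
    derMap f (CDerEnd.lift Y) = CDerEnd.lift Y
      - (B.pr (recip _ (Hom.a_pos f)) * Y (B.pr (Hom.a f) * B.t + B.pr (Hom.b f))) • B.D0hat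
      - (B.pr (recip _ (Hom.c_pos f)) * Y (B.pr (Hom.c f))) • sig0 := by
  have hpb : ∀ g : B.CS, pb (Hom.φ f) g = g := fun g => by rw [hφ]; rfl
  have hv : vecPull (tau f) Y =
      Y - (B.pr (recip _ (Hom.a_pos f)) * Y (B.pr (Hom.a f) * B.t + B.pr (Hom.b f))) • B.D0 := by
    refine vecPull_eq f ?_ fun g => ?_
    · have hD : B.D0 (B.pr (Hom.a f) * B.t + B.pr (Hom.b f)) = B.pr (Hom.a f) := by
        simp [Derivation.leibniz, D0_pr, D0_t]
      rw [h.1, map_zero, tau_t, Derivation.sub_apply, Derivation.smul_apply, hD, smul_eq_mul,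
        mul_right_comm, pr_recip_mul, one_mul, sub_self]
    · rw [h.2, tau_pr, tau_pr, hpb, hpb, Derivation.sub_apply, Derivation.smul_apply, D0_pr,
        smul_zero, sub_zero, h.2]
  have e := derPull_lift (tau f) (cUnit f) Y
  -- The correction along `D₀` does not see `c`, so the coefficient of `σ₀` involves only the
  -- original field.
  have hc : vecPull (tau f) Y (cUnit f) = Y (B.pr (Hom.c f)) := by
    rw [hv, Derivation.sub_apply, Derivation.smul_apply]
    have : B.D0 (cUnit f) = 0 := D0_pr _
    rw [this, smul_zero, sub_zero]; rfl
  rw [hc, hv, lift_sub_smul] at e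
  exact e

theorem derMap_lift_of_diffeo (f : B ⟶ B') (ha : Hom.a f = 1) (hb : Hom.b f = 0)
    (hc : Hom.c f = 1) {X : Derivation ℝ B.CS B.CS} {Y : Derivation ℝ B.CM B.CM}
    {X' : Derivation ℝ B'.CS B'.CS} {Y' : Derivation ℝ B'.CM B'.CM} (h : B.IsExt X Y)
    (h' : B'.IsExt X' Y') (hX : ∀ g, X (pb (Hom.φ f) g) = pb (Hom.φ f) (X' g)) :
    derMap f (CDerEnd.lift Y') = CDerEnd.lift Y := by
  have hv : vecPull (tau f) Y' = Y := by
    refine vecPull_eq f ?_ fun g => ?_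
    · rw [h'.1, map_zero, tau_t, ha, hb, map_one, map_zero, one_mul, add_zero, h.1]
    · rw [h'.2, tau_pr, tau_pr, h.2, hX]
  have e := derPull_lift (tau f) (cUnit f) Y'
  have hc' : Y (cUnit f) = 0 := by
    have : Y (B.pr (Hom.c f)) = 0 := by rw [hc, map_one, Derivation.map_one_eq_zero]
    exact this
  rw [hv, hc', mul_zero, zero_smul, sub_zero] at e
  exact e

/-- The semilinear conformal isomorphism of a morphism. -/
def diag (f : B ⟶ B') : DiagIso B'.CM B.CM := DiagIso.ofConst (tau f) (cUnit f)

theorem Phi_id (p : ℝ × B.S) : Phi (𝟙 B) p = p := by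
  refine Prod.ext ?_ rfl
  change 1 * p.1 + 0 = p.1
  ring

theorem Phi_comp (f : B ⟶ B') (g : B' ⟶ B'') (p : ℝ × B.S) :
    Phi (f ≫ g) p = Phi g (Phi f p) := by
  refine Prod.ext ?_ rfl
  change Hom.a f p.2 * Hom.a g (Hom.φ f p.2) * p.1 +
    (Hom.a g (Hom.φ f p.2) * Hom.b f p.2 + Hom.b g (Hom.φ f p.2)) =
    Hom.a g (Hom.φ f p.2) * (Hom.a f p.2 * p.1 + Hom.b f p.2) + Hom.b g (Hom.φ f p.2)
  ring

theorem Psi_apply (f : B ⟶ B') (w : WMod B'.CM) (i : Fin 4) (p : ℝ × B.S) :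
    Psi f w i p = Hom.c f p.2 * w i (Phi f p) := rfl

theorem Psi_id (w : WMod B.CM) : Psi (𝟙 B) w = w := by
  funext i
  refine ContMDiffMap.ext fun p => ?_
  rw [Psi_apply, Phi_id]
  exact one_mul _

theorem Psi_comp (f : B ⟶ B') (g : B' ⟶ B'') (w : WMod B''.CM) :
    Psi (f ≫ g) w = Psi f (Psi g w) := by
  funext i
  refine ContMDiffMap.ext fun p => ?_
  rw [Psi_apply, Psi_apply, Psi_apply, Phi_comp]
  exact mul_assoc _ _ _

/-- The values of `Φ` at `t = 0` and `t = 1` give `b` and `a`, its second component gives `φ`, and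
`Ψ` of a section with constant coefficients `1` gives `c`. -/
theorem hom_ext {f g : B ⟶ B'} (h₁ : ∀ p, Phi f p = Phi g p) (h₂ : ∀ w, Psi f w = Psi g w) :
    f = g := by
  have h : ∀ t x, Hom.a f x * t + Hom.b f x = Hom.a g x * t + Hom.b g x ∧
      Hom.φ f x = Hom.φ g x := fun t x => Prod.ext_iff.1 (h₁ (t, x))
  have hb : ∀ x, Hom.b f x = Hom.b g x := fun x => by simpa using (h 0 x).1
  refine Hom.ext ?_ ?_ ?_ ?_
  · exact ContMDiffMap.ext fun x => by simpa [hb] using (h 1 x).1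
  · exact ContMDiffMap.ext hb
  · refine ContMDiffMap.ext fun x => ?_
    have e := congrArg (fun w : WMod B.CM => w 0 (0, x)) (h₂ fun _ => 1)
    simp only [Psi_apply] at e
    exact (mul_one _).symm.trans (e.trans (mul_one _))
  · exact Diffeomorph.ext fun x => (h 0 x).2

theorem isId_diag (B : Base.{u}) : DiagIso.IsId (diag (𝟙 B)) :=
  ⟨fun g => ContMDiffMap.ext fun p => congrArg g (Phi_id p), Psi_id⟩

/-- Pullbacks compose in the opposite order, which is the source of contravariance. -/
theorem isComp_diag (f : B ⟶ B') (g : B' ⟶ B'') :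
    DiagIso.IsComp (diag (f ≫ g)) (diag g) (diag f) :=
  ⟨fun h => ContMDiffMap.ext fun p => congrArg h (Phi_comp f g p), Psi_comp f g⟩

/-- The functor `𝓔` from the groupoid to real graded Lie algebras. -/
def functorE : FunctorOn (fun B : Base.{u}ᵒᵖ => B.unop.gE) where
  map f := (diag f.unop).gla
  map_id B := DiagIso.gla_id (isId_diag B.unop)
  map_comp f g := DiagIso.gla_comp (isComp_diag g.unop f.unop)

/-- With all four factors equal to `c`, the general diagonal construction reduces by definition to
`wedgeMap` and `derMap`. -/
theorem functorE_elt (f : B ⟶ B') {n : ℕ} (η : ⋀[B'.CM]^n (WMod B'.CM)) (δ : CDerEnd B'.CM) :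
    GLA.ap (functorE.map f.op) n (elt η δ) = elt (wedgeMap f η) (derMap f δ) := rfl

theorem functorE_elt_of_eq (f : B ⟶ B') {n : ℕ} (η : ⋀[B'.CM]^n (WMod B'.CM)) {δ : CDerEnd B'.CM}
    {ε : CDerEnd B.CM} (h : derMap f δ = ε) :
    GLA.ap (functorE.map f.op) n (elt η δ) = elt (wedgeMap f η) ε := by
  rw [functorE_elt, h]

/-- The functor `𝓔` to filtered graded Lie algebras, for filtrations that it respects. -/
def functorFilt {σ : Type} (F : ∀ B : Base.{u}, (σ →₀ ℕ) → ∀ k, Submodule ℝ (B.gE.V k))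
    (hF : ∀ B, IsGLAFiltration B.gE (F B))
    (h : ∀ {B B' : Base.{u}} (f : B ⟶ B') n k, ∀ x ∈ F B' n k, GLA.ap (diag f).gla k x ∈ F B n k) :
    FunctorOn (fun B : Base.{u}ᵒᵖ => FiltGLA.mk B.unop.gE _ (hF B.unop)) where
  map f := FiltGLA.Hom.mk (G := FiltGLA.mk _ _ (hF _)) (H := FiltGLA.mk _ _ (hF _))
    (functorE.map f) (h f.unop)
  map_id _ := FiltGLA.Hom.ext (functorE.map_id _)
  map_comp _ _ := FiltGLA.Hom.ext (functorE.map_comp _ _)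

theorem exists_functorFilt {σ : Type} (F : ∀ B : Base.{u}, (σ →₀ ℕ) → ∀ k, Submodule ℝ (B.gE.V k))
    (hF : ∀ B, IsGLAFiltration B.gE (F B))
    (h : ∀ {B B' : Base.{u}} (f : B ⟶ B') n k, ∀ x ∈ F B' n k, GLA.ap (diag f).gla k x ∈ F B n k) :
    ∃ G : FunctorOn (fun B : Base.{u}ᵒᵖ => FiltGLA.mk B.unop.gE _ (hF B.unop)),
      ∀ {B B' : Base.{u}ᵒᵖ} (f : B ⟶ B'), (G.map f).hom = functorE.map f :=
  ⟨functorFilt F hF h, fun _ => rfl⟩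

/-- Every morphism of the groupoid is invertible, and its inverse is again a morphism, so it also
respects the filtrations. The isomorphism of filtered algebras is thus obtained from functoriality
alone. -/
theorem inducesIsos {σ : Type} [DecidableEq σ]
    (F : ∀ B : Base.{u}, (σ →₀ ℕ) → ∀ k, Submodule ℝ (B.gE.V k))
    (hF : ∀ B, IsGLAFiltration B.gE (F B))
    (h : ∀ {B B' : Base.{u}} (f : B ⟶ B') n k, ∀ x ∈ F B' n k, GLA.ap (diag f).gla k x ∈ F B n k)
    (f : B ⟶ B') :
    InducesIsos (FiltGLA.mk B'.gE _ (hF B')) (FiltGLA.mk B.gE _ (hF B)) (functorE.map f.op) := by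
  let G := functorFilt F hF h
  refine FiltGLA.inducesIsos (G := FiltGLA.mk B'.gE _ (hF B')) (H := FiltGLA.mk B.gE _ (hF B))
    ⟨G.map f.op, G.map (Groupoid.inv f).op, ?_, ?_⟩
  · refine (G.map_comp _ _).symm.trans ?_
    rw [← op_comp, Groupoid.inv_comp]
    exact G.map_id (Opposite.op B')
  · refine (G.map_comp _ _).symm.trans ?_
    rw [← op_comp, Groupoid.comp_inv]
    exact G.map_id (Opposite.op B)

theorem map_bkl1 (i : Fin 3) (f : B ⟶ B') (n : Fin 1 →₀ ℕ) (k : ℤ) (x : B'.gE.V k)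
    (h : x ∈ bkl1 B'.CM i n k) : GLA.ap (diag f).gla k x ∈ bkl1 B.CM i n k :=
  gla_mem_bkl1 (diag f) i n k x h

theorem exists_functor_bkl1 (i : Fin 3) : ∃ G : FunctorOn (fun B : Base.{u}ᵒᵖ =>
      FiltGLA.mk B.unop.gE _ (isGLAFiltration_bkl1 B.unop.CM i)),
    ∀ {B B' : Base.{u}ᵒᵖ} (f : B ⟶ B'), (G.map f).hom = functorE.map f := by
  have h := exists_functorFilt (fun B : Base.{u} => bkl1 B.CM i)
    (fun B => isGLAFiltration_bkl1 B.CM i) fun f => map_bkl1 i f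
  exact h

theorem map_bkl2 (f : B ⟶ B') (n : Fin 2 →₀ ℕ) (k : ℤ) (x : B'.gE.V k)
    (h : x ∈ bkl2 B'.CM n k) : GLA.ap (diag f).gla k x ∈ bkl2 B.CM n k :=
  gla_mem_bkl2 (diag f) n k x h

theorem exists_functor_bkl2 : ∃ G : FunctorOn (fun B : Base.{u}ᵒᵖ =>
      FiltGLA.mk B.unop.gE _ (isGLAFiltration_bkl2 B.unop.CM)),
    ∀ {B B' : Base.{u}ᵒᵖ} (f : B ⟶ B'), (G.map f).hom = functorE.map f := by
  have h := exists_functorFilt (fun B : Base.{u} => bkl2 B.CM)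
    (fun B => isGLAFiltration_bkl2 B.CM) fun f => map_bkl2 f
  exact h

theorem map_bkl3 (f : B ⟶ B') (n : Fin 3 →₀ ℕ) (k : ℤ) (x : B'.gE.V k)
    (h : x ∈ bkl3 B'.CM n k) : GLA.ap (diag f).gla k x ∈ bkl3 B.CM n k :=
  gla_mem_bkl3 (diag f) n k x h

theorem exists_functor_bkl3 : ∃ G : FunctorOn (fun B : Base.{u}ᵒᵖ =>
      FiltGLA.mk B.unop.gE _ (isGLAFiltration_bkl3 B.unop.CM)),
    ∀ {B B' : Base.{u}ᵒᵖ} (f : B ⟶ B'), (G.map f).hom = functorE.map f := by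
  have h := exists_functorFilt (fun B : Base.{u} => bkl3 B.CM)
    (fun B => isGLAFiltration_bkl3 B.CM) fun f => map_bkl3 f
  exact h

theorem inducesIsos_bkl2 (f : B ⟶ B') :
    InducesIsos (FiltGLA.mk B'.gE _ (isGLAFiltration_bkl2 B'.CM))
      (FiltGLA.mk B.gE _ (isGLAFiltration_bkl2 B.CM)) (functorE.map f.op) := by
  have h := inducesIsos (fun B : Base.{u} => bkl2 B.CM)
    (fun B => isGLAFiltration_bkl2 B.CM) (fun f => map_bkl2 f) f
  exact h

theorem inducesIsos_bkl3 (f : B ⟶ B') :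
    InducesIsos (FiltGLA.mk B'.gE _ (isGLAFiltration_bkl3 B'.CM))
      (FiltGLA.mk B.gE _ (isGLAFiltration_bkl3 B.CM)) (functorE.map f.op) := by
  have h := inducesIsos (fun B : Base.{u} => bkl3 B.CM)
    (fun B => isGLAFiltration_bkl3 B.CM) (fun f => map_bkl3 f) f
  exact h

end Base

end BKL

end

/-! ### The theorem, assembled. -/

theorem mainTheorem6 :
    -- the morphisms of the groupoid `Base` act faithfully by the maps `Φ` and `Ψ`
    ((∀ {B B' : Base.{u}} (f : B ⟶ B') (t : ℝ) (x : B.S),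
        Base.Phi f (t, x) = (Base.Hom.a f x * t + Base.Hom.b f x, Base.Hom.φ f x)) ∧
      (∀ {B B' : Base.{u}} (f : B ⟶ B') (w : WMod B'.CM) (i : Fin 4) (t : ℝ) (x : B.S),
        Base.Psi f w i (t, x) = Base.Hom.c f x * w i (Base.Phi f (t, x))) ∧
      (∀ (B : Base.{u}), (∀ p, Base.Phi (𝟙 B) p = p) ∧ ∀ w, Base.Psi (𝟙 B) w = w) ∧
      (∀ {B B' B'' : Base.{u}} (f : B ⟶ B') (g : B' ⟶ B''),
        (∀ p, Base.Phi (f ≫ g) p = Base.Phi g (Base.Phi f p)) ∧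
        ∀ w, Base.Psi (f ≫ g) w = Base.Psi f (Base.Psi g w)) ∧
      (∀ {B B' : Base.{u}} (f g : B ⟶ B'),
        (∀ p, Base.Phi f p = Base.Phi g p) → (∀ w, Base.Psi f w = Base.Psi g w) → f = g)) ∧
    -- vector fields on `S` extend uniquely by `X(t) = 0`
    (∀ (B : Base.{u}) (X : Derivation ℝ B.CS B.CS), ∃! Y, B.IsExt X Y) ∧
    -- the functor to real graded Lie algebras
    ∃ F : FunctorOn (fun B : Base.{u}ᵒᵖ => B.unop.gE),
      (∀ {B B' : Base.{u}} (f : B ⟶ B') {n : ℕ} (ω : ⋀[B'.CM]^n (WMod B'.CM))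
        (δ : CDerEnd B'.CM),
        GLA.ap (F.map f.op) n (elt ω δ) = elt (Base.wedgeMap f ω) (Base.derMap f δ)) ∧
      -- morphisms with `φ = 𝟙`
      (∀ {B : Base.{u}} (f : B ⟶ B), Base.Hom.φ f = Diffeomorph.refl _ _ _ →
        (∀ g : B.CM, wedgePull (Base.tau f) (Base.cUnit f) (algebraMap B.CM _ g) =
          algebraMap B.CM _ (g.comp (Base.Phi f).toContMDiffMap)) ∧
        (∀ i, wedgePull (Base.tau f) (Base.cUnit f) (wth i) = B.pr (Base.Hom.c f) • wth i) ∧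
        ∀ {n : ℕ} (ω : ⋀[B.CM]^n (WMod B.CM)),
          GLA.ap (F.map f.op) n (elt ω sig0) = elt (Base.wedgeMap f ω) sig0 ∧
          (∀ i, GLA.ap (F.map f.op) n (elt ω (sigB i)) = elt (Base.wedgeMap f ω) (sigB i)) ∧
          (∀ i j, GLA.ap (F.map f.op) n (elt ω (sigR i j)) = elt (Base.wedgeMap f ω) (sigR i j)) ∧
          GLA.ap (F.map f.op) n (elt ω B.D0hat) =
            elt (Base.wedgeMap f ω) (B.pr (Base.recip _ (Base.Hom.a_pos f)) • B.D0hat) ∧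
          ∀ X Y, B.IsExt X Y →
            GLA.ap (F.map f.op) n (elt ω (CDerEnd.lift Y)) =
              elt (Base.wedgeMap f ω) (CDerEnd.lift Y
                - (B.pr (Base.recip _ (Base.Hom.a_pos f)) *
                    Y (B.pr (Base.Hom.a f) * B.t + B.pr (Base.Hom.b f))) • B.D0hat
                - (B.pr (Base.recip _ (Base.Hom.c_pos f)) * Y (B.pr (Base.Hom.c f))) • sig0)) ∧
      -- morphisms with `a = c = 1` and `b = 0`
      (∀ {B B' : Base.{u}} (f : B ⟶ B'),
        Base.Hom.a f = 1 → Base.Hom.b f = 0 → Base.Hom.c f = 1 →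
        (∀ g : B'.CM, wedgePull (Base.tau f) (Base.cUnit f) (algebraMap B'.CM _ g) =
          algebraMap B.CM _ (g.comp (Base.Phi f).toContMDiffMap)) ∧
        (∀ i, wedgePull (Base.tau f) (Base.cUnit f) (wth i) = wth i) ∧
        ∀ {n : ℕ} (ω : ⋀[B'.CM]^n (WMod B'.CM)),
          GLA.ap (F.map f.op) n (elt ω sig0) = elt (Base.wedgeMap f ω) sig0 ∧
          (∀ i, GLA.ap (F.map f.op) n (elt ω (sigB i)) = elt (Base.wedgeMap f ω) (sigB i)) ∧
          (∀ i j, GLA.ap (F.map f.op) n (elt ω (sigR i j)) = elt (Base.wedgeMap f ω) (sigR i j)) ∧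
          GLA.ap (F.map f.op) n (elt ω B'.D0hat) = elt (Base.wedgeMap f ω) B.D0hat ∧
          ∀ X Y X' Y', B.IsExt X Y → B'.IsExt X' Y' →
            (∀ g, X (Base.pb (Base.Hom.φ f) g) = Base.pb (Base.Hom.φ f) (X' g)) →
            GLA.ap (F.map f.op) n (elt ω (CDerEnd.lift Y')) =
              elt (Base.wedgeMap f ω) (CDerEnd.lift Y)) ∧
      -- the BKL filtrations are filtrations, functorially
      ∃ (h₁ : ∀ (i : Fin 3) (B : Base.{u}), IsGLAFiltration B.gE (bkl1 B.CM i))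
        (h₂ : ∀ B : Base.{u}, IsGLAFiltration B.gE (bkl2 B.CM))
        (h₃ : ∀ B : Base.{u}, IsGLAFiltration B.gE (bkl3 B.CM)),
        (∀ i, ∃ G : FunctorOn (fun B : Base.{u}ᵒᵖ => FiltGLA.mk B.unop.gE _ (h₁ i B.unop)),
          ∀ {B B' : Base.{u}ᵒᵖ} (f : B ⟶ B'), (G.map f).hom = F.map f) ∧
        (∃ G : FunctorOn (fun B : Base.{u}ᵒᵖ => FiltGLA.mk B.unop.gE _ (h₂ B.unop)),
          ∀ {B B' : Base.{u}ᵒᵖ} (f : B ⟶ B'), (G.map f).hom = F.map f) ∧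
        (∃ G : FunctorOn (fun B : Base.{u}ᵒᵖ => FiltGLA.mk B.unop.gE _ (h₃ B.unop)),
          ∀ {B B' : Base.{u}ᵒᵖ} (f : B ⟶ B'), (G.map f).hom = F.map f) ∧
        -- the isomorphisms for the `2`-index (bounce) and the `3`-index (free) filtrations
        ∀ {B B' : Base.{u}} (f : B ⟶ B'),
          InducesIsos (FiltGLA.mk B'.gE _ (h₂ B')) (FiltGLA.mk B.gE _ (h₂ B)) (F.map f.op) ∧
          InducesIsos (FiltGLA.mk B'.gE _ (h₃ B')) (FiltGLA.mk B.gE _ (h₃ B)) (F.map f.op) := by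
  refine ⟨⟨fun _ _ _ => rfl, fun _ _ _ _ _ => rfl, fun B => ⟨Base.Phi_id, Base.Psi_id⟩,
      fun f g => ⟨Base.Phi_comp f g, Base.Psi_comp f g⟩, fun _ _ => Base.hom_ext⟩,
    fun _ => Base.existsUnique_isExt, Base.functorE, Base.functorE_elt, ?_, ?_,
    fun i B => isGLAFiltration_bkl1 _ i, fun B => isGLAFiltration_bkl2 _,
    fun B => isGLAFiltration_bkl3 _, Base.exists_functor_bkl1,
    Base.exists_functor_bkl2, Base.exists_functor_bkl3, fun f =>
      ⟨Base.inducesIsos_bkl2 f, Base.inducesIsos_bkl3 f⟩⟩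
  · intro B f hφ
    -- The ring homomorphism of the diagonal isomorphism with constant factor `c` is `wedgePull` by
    -- definition.
    refine ⟨wedgePull_algebraMap _ _, (Base.diag f).wedge_wth, fun ω => ⟨?_, fun i => ?_,
      fun i j => ?_, ?_, fun X Y h => ?_⟩⟩
    · exact Base.functorE_elt_of_eq f ω (derPull_sig0 _ _)
    · exact Base.functorE_elt_of_eq f ω (derPull_sigB _ _ i)
    · exact Base.functorE_elt_of_eq f ω (derPull_sigR _ _ i j)
    · exact Base.functorE_elt_of_eq f ω (Base.derMap_D0hat f)
    · exact Base.functorE_elt_of_eq f ω (Base.derMap_lift_of_φ_eq_refl f hφ h)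
  · intro B B' f ha hb hc
    refine ⟨wedgePull_algebraMap _ _, fun i => ?_, fun ω => ⟨?_, fun i => ?_,
      fun i j => ?_, ?_, fun X Y X' Y' h h' hX => ?_⟩⟩
    · refine ((Base.diag f).wedge_wth i).trans ?_
      have h : B.pr (Base.Hom.c f) = 1 := by rw [hc, map_one]
      exact (congrArg (· • wth i) h).trans (one_smul _ _)
    · exact Base.functorE_elt_of_eq f ω (derPull_sig0 _ _)
    · exact Base.functorE_elt_of_eq f ω (derPull_sigB _ _ i)
    · exact Base.functorE_elt_of_eq f ω (derPull_sigR _ _ i j)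
    · refine Base.functorE_elt_of_eq f ω ((Base.derMap_D0hat f).trans ?_)
      -- With `a = 1`, the relation `a⁻¹a = 1` says that the coefficient of `D₀` is `1`.
      have h := Base.pr_recip_mul _ (Base.Hom.a_pos f)
      rw [congrArg B.pr ha, map_one, mul_one] at h
      rw [h, one_smul]
    · exact Base.functorE_elt_of_eq f ω (Base.derMap_lift_of_diffeo f ha hb hc h h' hX)
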